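/- For integers $m,n\ge 0$ let $\mathcal P(\mathbb R^{m|2n})=\mathbb R[x_1,\dots,x_m]\otimes\Lambda(\theta_1,\dots,\theta_{2n})$ be the polynomials in $m$ commuting and $2n$ anticommuting variables. Put $$\Delta=\sum_{j=1}^m\partial_{x_j}^2-4\sum_{j=1}^n\partial_{\theta_{2j-1}}\partial_{\theta_{2j}},\qquad R^2=\sum_{j=1}^m x_j^2-\sum_{j=1}^n\theta_{2j-1}\theta_{2j},\qquad \mathbb E=\sum_{j=1}^m x_j\partial_{x_j}+\sum_{j=1}^{2n}\theta_j\partial_{\theta_j},$$ $\mathcal P_k=\{P:\mathbb E P=kP\}$, $\mathcal H_k(\mathbb R^{m|2n})=\mathcal P_k\cap\operatorname{Ker}\Delta$ and $\tilde{\mathcal H}_k(\mathbb R^{m|2n})=\mathcal P_k\cap\operatorname{Ker}(\Delta R^2\Delta)$. The real orthosymplectic Lie superalgebra $\mathfrak{osp}(m|2n)$, i.e. the superalgebra of linear maps of the superspace $V$ spanned by the variables which (in the super sense) preserve the scalar superproduct $g$ corresponding to $R^2$ (the Gram matrix of $g$ in the basis of variables is $\mathrm{diag}(E_m,J_{2n}^{-1})$,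 where $J_{2n}$ has the diagonal blocks $\tfrac12\begin{pmatrix}0&-1\\1&0\end{pmatrix}$), acts on $\mathcal P(\mathbb R^{m|2n})$ by superderivations, and $\mathcal H_k(\mathbb R^{m|2n})$, $\tilde{\mathcal H}_k(\mathbb R^{m|2n})$ are submodules. Theorem. Let $m\ge1$, $n\ge0$, let $M=m-2n\in-2\mathbb N_0$ and let $k\in\mathbb N_0$ with $2-M/2\le k\le 2-M$. Write $\underline{\mathcal H}_\ell=\mathcal H_\ell(\mathbb R^{m-1|2n})$ and regard $\mathfrak{osp}(m-1|2n)\subset\mathfrak{osp}(m|2n)$ as the subalgebra of the maps which act on the variables other than $x_m$ and send $x_m$ to $0$. Then there is a parity-preserving isomorphism of $\mathfrak{osp}(m-1|2n)$-modules $$\tilde{\mathcal H}_k(\mathbb R^{m|2n})\;\simeq\;\bigoplus_{\ell=0}^{2-M-k}\bigl(\underline{\mathcal H}_\ell\oplus\underline{\mathcal H}_\ell\bigr)\;\oplus\bigoplus_{\ell=3-M-k}^{k}\underline{\mathcal H}_\ell,$$ and the decomposition is irreducible: each $\underline{\mathcal H}_\ell$ with $0\le\ell\le k$ is a nonzero irreducible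 $\mathfrak{osp}(m-1|2n)$-module. -/

import Mathlib

open scoped TensorProduct DirectSum Matrix Kronecker

noncomputable section

/-! ## Superpolynomials on `ℝ^{m|2n}` -/

/-- Indices of the coordinates `X = (x_1, …, x_m, θ_1, …, θ_{2n})` of `ℝ^{m|2n}`: `inl i` stands for
the bosonic coordinate `x_i`, and `inr (j, 0)`, `inr (j, 1)` stand for the fermionic coordinates
`θ_{2j-1}`, `θ_{2j}`. -/
abbrev SuperIdx (m n : ℕ) : Type := Fin m ⊕ (Fin n × Fin 2)

/-- The parity of a coordinate: `0` for bosonic and `1` for fermionic ones. -/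
def par {m n : ℕ} : SuperIdx m n → ZMod 2
  | Sum.inl _ => 0
  | Sum.inr _ => 1

/-- The space `𝒫 = ℝ[x_1, …, x_m] ⊗ Λ(θ_1, …, θ_{2n})` of polynomials on `ℝ^{m|2n}`. -/
abbrev SuperPoly (m n : ℕ) : Type :=
  MvPolynomial (Fin m) ℝ ⊗[ℝ] ExteriorAlgebra ℝ (Fin n × Fin 2 → ℝ)

/-- Multiplication from the left by the coordinate `X_i`. -/
def mulX (m n : ℕ) : SuperIdx m n → Module.End ℝ (SuperPoly m n)
  | Sum.inl i => (LinearMap.mulLeft ℝ (MvPolynomial.X i : MvPolynomial (Fin m) ℝ)).rTensor _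
  | Sum.inr j => (LinearMap.mulLeft ℝ (ExteriorAlgebra.ι ℝ (Pi.single j (1 : ℝ)))).lTensor _

/-- The (left) partial derivative `∂_{X_i}`. -/
def dX (m n : ℕ) : SuperIdx m n → Module.End ℝ (SuperPoly m n)
  | Sum.inl i => ((MvPolynomial.pderiv i : Derivation ℝ (MvPolynomial (Fin m) ℝ)
      (MvPolynomial (Fin m) ℝ)) : MvPolynomial (Fin m) ℝ →ₗ[ℝ] MvPolynomial (Fin m) ℝ).rTensor _
  | Sum.inr j => (CliffordAlgebra.contractLeft (Q := (0 : QuadraticForm ℝ (Fin n × Fin 2 → ℝ)))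
      (LinearMap.proj j)).lTensor _

/-- The super Laplace operator
`Δ = ∑_j ∂_{x_j}² - 4 ∑_j ∂_{θ_{2j-1}} ∂_{θ_{2j}}`. -/
def superLaplacian (m n : ℕ) : Module.End ℝ (SuperPoly m n) :=
  ∑ j : Fin m, dX m n (Sum.inl j) ∘ₗ dX m n (Sum.inl j)
    - (4 : ℝ) • ∑ j : Fin n, dX m n (Sum.inr (j, 0)) ∘ₗ dX m n (Sum.inr (j, 1))

/-- Multiplication by `R² = ∑_j x_j² - ∑_j θ_{2j-1} θ_{2j}`. -/
def superRSq (m n : ℕ) : Module.End ℝ (SuperPoly m n) :=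
  ∑ j : Fin m, mulX m n (Sum.inl j) ∘ₗ mulX m n (Sum.inl j)
    - ∑ j : Fin n, mulX m n (Sum.inr (j, 0)) ∘ₗ mulX m n (Sum.inr (j, 1))

/-- The super Euler operator `𝔼 = ∑_j x_j ∂_{x_j} + ∑_j θ_j ∂_{θ_j}`. -/
def superEuler (m n : ℕ) : Module.End ℝ (SuperPoly m n) :=
  ∑ i : SuperIdx m n, mulX m n i ∘ₗ dX m n i

/-- The space `𝒫_k` of `k`-homogeneous polynomials: `𝔼 P = k P`. -/
def homogPoly (m n k : ℕ) : Submodule ℝ (SuperPoly m n) :=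
  Module.End.eigenspace (superEuler m n) (k : ℝ)

/-- The space `ℋ_k = Ker_k Δ` of `k`-homogeneous spherical harmonics on `ℝ^{m|2n}`. -/
def harmonics (m n k : ℕ) : Submodule ℝ (SuperPoly m n) :=
  LinearMap.ker (superLaplacian m n) ⊓ homogPoly m n k

/-- The space `Ker_k (Δ R² Δ)` of generalized `k`-homogeneous spherical harmonics. -/
def genHarmonics (m n k : ℕ) : Submodule ℝ (SuperPoly m n) :=
  LinearMap.ker (superLaplacian m n ∘ₗ superRSq m n ∘ₗ superLaplacian m n) ⊓ homogPoly m n k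

/-- The superdimension `M = m - 2n` of `ℝ^{m|2n}`. -/
def superdim (m n : ℕ) : ℤ := (m : ℤ) - 2 * (n : ℤ)

/-- The set `{k ∈ ℕ₀ | 2 - M/2 ≤ k ≤ 2 - M}` (real division), for `M ∈ -2ℕ₀`. -/
def exceptionalIndices (M : ℤ) : Set ℕ :=
  {k | (2 : ℝ) - (M : ℝ) / 2 ≤ (k : ℝ) ∧ (k : ℝ) ≤ 2 - (M : ℝ)}

/-- The parity involution of `𝒫`, which is `(-1)^r` on polynomials of degree `r` in the `θ_j`. -/
def parityInvol (m n : ℕ) : Module.End ℝ (SuperPoly m n) :=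
  (CliffordAlgebra.involute
    (Q := (0 : QuadraticForm ℝ (Fin n × Fin 2 → ℝ)))).toLinearMap.lTensor _

/-- The even (`p = 0`) and the odd (`p = 1`) part of `𝒫`. -/
def parityPart (m n : ℕ) (p : ZMod 2) : Submodule ℝ (SuperPoly m n) :=
  Module.End.eigenspace (parityInvol m n) ((-1 : ℝ) ^ p.val)

/-! ## The orthosymplectic Lie superalgebra and its action -/

/-- The matrix `(g^{ij}) = diag(E_m, J_{2n})`, where `J_{2n}` has the diagonal blocks
`½ (0, -1; 1, 0)`. Thus `R² = ∑_{i,j} g^{ij} X_i X_j`. -/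
def superMetric (m n : ℕ) : Matrix (SuperIdx m n) (SuperIdx m n) ℝ :=
  Matrix.fromBlocks 1 0 0 ((1 : Matrix (Fin n) (Fin n) ℝ) ⊗ₖ !![0, -(1 / 2); 1 / 2, 0])

/-- The inverse `(g_{ij})` of `(g^{ij})`. It is the Gram matrix `g_{ij} = g(X_i, X_j)` of the
scalar superproduct `g` on the superspace `V` spanned by the coordinates `X_i`
(so that `R² = ∑ g^{ij} X_i X_j` is invariant). -/
def superGram (m n : ℕ) : Matrix (SuperIdx m n) (SuperIdx m n) ℝ :=
  Matrix.fromBlocks 1 0 0 ((1 : Matrix (Fin n) (Fin n) ℝ) ⊗ₖ !![0, 2; -2, 0])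

theorem superMetric_mul_superGram (m n : ℕ) : superMetric m n * superGram m n = 1 := by
  have h : (!![0, -(1 / 2); 1 / 2, 0] * !![0, 2; -2, 0] : Matrix (Fin 2) (Fin 2) ℝ) = 1 := by
    ext i j; fin_cases i <;> fin_cases j <;> simp [Matrix.mul_apply]
  rw [superMetric, superGram, Matrix.fromBlocks_multiply, ← Matrix.mul_kronecker_mul, h]
  simp

theorem superGram_mul_superMetric (m n : ℕ) : superGram m n * superMetric m n = 1 :=
  _root_.mul_eq_one_comm.mp (superMetric_mul_superGram m n)

/-- The diagonal matrix of the signs `(-1)^{p |X_i|}`. -/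
def signMatrix (m n : ℕ) (p : ZMod 2) : Matrix (SuperIdx m n) (SuperIdx m n) ℝ :=
  Matrix.diagonal fun i => (-1 : ℝ) ^ (p * par i).val

/-- The even (`p = 0`) and the odd (`p = 1`) part of the Lie superalgebra `osp(m|2n) = osp(V, g)`,
realized by matrices: `A` stands for the map `X_j ↦ ∑_i A_{ij} X_i` on `V`. It has to be
homogeneous of parity `p` and to satisfy `g(A u, v) + (-1)^{p |u|} g(u, A v) = 0`. -/
def ospPart (m n : ℕ) (p : ZMod 2) : Submodule ℝ (Matrix (SuperIdx m n) (SuperIdx m n) ℝ) where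
  carrier := {A | (∀ i j, par i + par j ≠ p → A i j = 0) ∧
    Aᵀ * superGram m n + signMatrix m n p * superGram m n * A = 0}
  zero_mem' := by simp
  add_mem' := by
    rintro A B ⟨hA, hA'⟩ ⟨hB, hB'⟩
    refine ⟨fun i j h => by simp [hA i j h, hB i j h], ?_⟩
    rw [Matrix.transpose_add, add_mul, mul_add, add_add_add_comm, hA', hB', add_zero]
  smul_mem' := by
    rintro c A ⟨hA, hA'⟩
    refine ⟨fun i j h => by simp [hA i j h], ?_⟩
    rw [Matrix.transpose_smul, smul_mul_assoc, mul_smul_comm, ← smul_add, hA', smul_zero]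

/-- The Lie superalgebra `osp(m|2n)`, as a space of matrices. -/
def osp (m n : ℕ) : Submodule ℝ (Matrix (SuperIdx m n) (SuperIdx m n) ℝ) :=
  ospPart m n 0 ⊔ ospPart m n 1

/-- The action of matrices on superpolynomials by the superderivations
`∑_{i,j} A_{ij} X_i ∂_{X_j}`, which extend `X_j ↦ ∑_i A_{ij} X_i`. -/
def superAction (m n : ℕ) :
    Matrix (SuperIdx m n) (SuperIdx m n) ℝ →ₗ[ℝ] Module.End ℝ (SuperPoly m n) where
  toFun A := ∑ i, ∑ j, A i j • (mulX m n i ∘ₗ dX m n j)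
  map_add' A B := by simp [add_smul, Finset.sum_add_distrib]
  map_smul' c A := by simp [mul_smul, Finset.smul_sum]

/-! ### The action of `osp(m|2n)` commutes with `Δ`, `R²` and `𝔼` -/

/-- The sign `(-1)^{|X_i| |X_j|}`. -/
def superSign {m n : ℕ} : SuperIdx m n → SuperIdx m n → ℝ
  | Sum.inr _, Sum.inr _ => -1
  | _, _ => 1

theorem superSign_comm {m n : ℕ} (i j : SuperIdx m n) : superSign i j = superSign j i := by
  rcases i with i | i <;> rcases j with j | j <;> rfl

theorem mulX_mulX (m n : ℕ) (i j : SuperIdx m n) :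
    mulX m n i * mulX m n j = superSign i j • (mulX m n j * mulX m n i) := by
  rcases i with i | i <;> rcases j with j | j <;>
    (apply TensorProduct.ext'; intro f w)
  · simp [mulX, superSign, mul_left_comm]
  · simp [mulX, superSign]
  · simp [mulX, superSign]
  · have h := ExteriorAlgebra.ι_add_mul_swap (R := ℝ)
      (Pi.single i (1 : ℝ)) (Pi.single j (1 : ℝ) : Fin n × Fin 2 → ℝ)
    simp [mulX, superSign, ← mul_assoc, eq_neg_of_add_eq_zero_left h, TensorProduct.tmul_neg]

theorem dX_dX (m n : ℕ) (i j : SuperIdx m n) :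
    dX m n i * dX m n j = superSign i j • (dX m n j * dX m n i) := by
  rcases i with i | i <;> rcases j with j | j <;>
    (apply TensorProduct.ext'; intro f w)
  · have h : MvPolynomial.pderiv (R := ℝ) i (MvPolynomial.pderiv j f)
        = MvPolynomial.pderiv j (MvPolynomial.pderiv i f) := by
      have h0 : ⁅(MvPolynomial.pderiv i : Derivation ℝ (MvPolynomial (Fin m) ℝ)
        (MvPolynomial (Fin m) ℝ)), MvPolynomial.pderiv (R := ℝ) j⁆ = 0 := by
        apply MvPolynomial.derivation_ext
        intro k
        simp [Derivation.commutator_apply, MvPolynomial.pderiv_X, Pi.single_apply, apply_ite]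
      have := DFunLike.congr_fun h0 f
      simpa [Derivation.commutator_apply, sub_eq_zero] using this
    simp [dX, superSign, h]
  · simp [dX, superSign]
  · simp [dX, superSign]
  · simp only [dX, superSign, Module.End.mul_apply, LinearMap.lTensor_tmul, LinearMap.smul_apply]
    rw [CliffordAlgebra.contractLeft_comm, TensorProduct.tmul_neg, neg_one_smul]

theorem dX_mulX (m n : ℕ) (i j : SuperIdx m n) :
    dX m n i * mulX m n j =
      (1 : Matrix (SuperIdx m n) (SuperIdx m n) ℝ) i j • (1 : Module.End ℝ (SuperPoly m n))
        + superSign i j • (mulX m n j * dX m n i) := by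
  rcases i with i | i <;> rcases j with j | j <;>
    (apply TensorProduct.ext'; intro f w)
  · by_cases h : i = j
    · subst h
      simp [dX, mulX, superSign, TensorProduct.add_tmul, add_comm]
    · simp [dX, mulX, superSign, MvPolynomial.pderiv_X_of_ne (Ne.symm h), Matrix.one_apply_ne, h]
  · simp [dX, mulX, superSign]
  · simp [dX, mulX, superSign]
  · simp only [dX, mulX, superSign, Module.End.mul_apply, LinearMap.lTensor_tmul,
      LinearMap.add_apply, LinearMap.smul_apply, LinearMap.mulLeft_apply, ExteriorAlgebra.ι]
    rw [CliffordAlgebra.contractLeft_ι_mul, TensorProduct.tmul_sub, neg_one_smul, ← sub_eq_add_neg]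
    congr 1
    by_cases h : i = j
    · subst h; simp
    · simp [h, Matrix.one_apply_ne]

theorem superRSq_eq (m n : ℕ) :
    superRSq m n = ∑ i, ∑ j, superMetric m n i j • (mulX m n i * mulX m n j) := by
  have h (j : Fin n) := mulX_mulX m n (Sum.inr (j, 1)) (Sum.inr (j, 0))
  simp only [superSign, Module.End.mul_eq_comp] at h
  simp only [superRSq, superMetric, Fintype.sum_sum_type, Matrix.fromBlocks_apply₁₁,
    Matrix.fromBlocks_apply₁₂, Matrix.fromBlocks_apply₂₁, Matrix.fromBlocks_apply₂₂,
    Fintype.sum_prod_type, Matrix.kroneckerMap_apply, Fin.sum_univ_two]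
  simp only [Matrix.one_apply, ite_mul, one_mul, zero_mul, ite_smul, zero_smul, one_smul,
    Finset.sum_add_distrib, Matrix.zero_apply, Finset.sum_const_zero, add_zero, zero_add]
  simp [Module.End.mul_eq_comp]
  simp only [h, ← Finset.smul_sum]
  module

theorem superLaplacian_eq (m n : ℕ) : superLaplacian m n =
    ∑ i, ∑ j, superGram m n j i • (dX m n i * dX m n j) := by
  have h (j : Fin n) := dX_dX m n (Sum.inr (j, 1)) (Sum.inr (j, 0))
  simp only [superSign, Module.End.mul_eq_comp] at h
  simp only [superLaplacian, superGram, Fintype.sum_sum_type, Matrix.fromBlocks_apply₁₁,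
    Matrix.fromBlocks_apply₁₂, Matrix.fromBlocks_apply₂₁, Matrix.fromBlocks_apply₂₂,
    Fintype.sum_prod_type, Matrix.kroneckerMap_apply, Fin.sum_univ_two]
  simp only [Matrix.one_apply, ite_mul, one_mul, zero_mul, ite_smul, zero_smul, one_smul,
    Finset.sum_add_distrib, Matrix.zero_apply, Finset.sum_const_zero, add_zero, zero_add]
  simp [Module.End.mul_eq_comp]
  simp only [h, ← Finset.smul_sum]
  module

theorem superGram_swap (m n : ℕ) (i j : SuperIdx m n) :
    superSign i j * superGram m n i j = superGram m n j i := by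
  rcases i with i | ⟨i, a⟩ <;> rcases j with j | ⟨j, b⟩
  · simp [superGram, superSign, Matrix.one_apply, eq_comm]
  · simp [superGram]
  · simp [superGram]
  · by_cases h : i = j
    · subst h
      fin_cases a <;> fin_cases b <;> simp [superGram, superSign]
    · simp [superGram, h, Ne.symm h]

theorem superMetric_swap (m n : ℕ) (i j : SuperIdx m n) :
    superSign i j * superMetric m n i j = superMetric m n j i := by
  rcases i with i | ⟨i, a⟩ <;> rcases j with j | ⟨j, b⟩
  · simp [superMetric, superSign, Matrix.one_apply, eq_comm]
  · simp [superMetric]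
  · simp [superMetric]
  · by_cases h : i = j
    · subst h
      fin_cases a <;> fin_cases b <;> simp [superMetric, superSign]
    · simp [superMetric, h, Ne.symm h]

theorem superSign_mul_superGram (m n : ℕ) (l i j : SuperIdx m n) :
    superSign l i * superSign l j * superGram m n i j = superGram m n i j := by
  rcases i with i | i <;> rcases j with j | j <;> rcases l with l | l <;>
    simp [superSign, superGram]

theorem superSign_mul_superMetric (m n : ℕ) (l i j : SuperIdx m n) :
    superSign l i * superSign l j * superMetric m n i j = superMetric m n i j := by
  rcases i with i | i <;> rcases j with j | j <;> rcases l with l | l <;>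
    simp [superSign, superMetric]

theorem sum_eq_zero_of_superSkew {m n : ℕ} {R : Type*} [AddCommGroup R] [Module ℝ R]
    (N : SuperIdx m n → SuperIdx m n → ℝ) (Y : SuperIdx m n → SuperIdx m n → R)
    (hN : ∀ i j, N i j = -(superSign i j * N j i)) (hY : ∀ i j, Y i j = superSign i j • Y j i) :
    ∑ i, ∑ j, N i j • Y i j = 0 := by
  have h1 : ∑ i, ∑ j, N i j • Y i j = -∑ i, ∑ j, N i j • Y i j := by
    conv_rhs => rw [Finset.sum_comm]
    rw [← Finset.sum_neg_distrib]
    refine Finset.sum_congr rfl fun i _ => ?_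
    rw [← Finset.sum_neg_distrib]
    refine Finset.sum_congr rfl fun j _ => ?_
    rw [hY i j, hN i j, smul_smul, ← neg_smul]
    congr 1
    have : superSign i j * superSign i j = 1 := by
      rcases i with i | i <;> rcases j with j | j <;> simp [superSign]
    linear_combination (-N j i) * this
  have h2 : (2 : ℝ) • ∑ i, ∑ j, N i j • Y i j = 0 := by
    rw [two_smul]; nth_rewrite 1 [h1]; simp
  exact (smul_eq_zero.mp h2).resolve_left two_ne_zero

theorem osp_induction {m n : ℕ} {P : Matrix (SuperIdx m n) (SuperIdx m n) ℝ → Prop}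
    (h : ∀ p, ∀ A ∈ ospPart m n p, P A) (hadd : ∀ A B, P A → P B → P (A + B))
    {A : Matrix (SuperIdx m n) (SuperIdx m n) ℝ} (hA : A ∈ osp m n) : P A := by
  obtain ⟨B, hB, C, hC, rfl⟩ := Submodule.mem_sup.mp hA
  exact hadd B C (h _ B hB) (h _ C hC)

theorem superSign_of_par {m n : ℕ} (i j : SuperIdx m n) :
    (-1 : ℝ) ^ ((par i + par j) * par i).val * superSign i i = superSign i j := by
  have h1 : (1 : ZMod 2).val = 1 := by decide
  have h2 : (1 + 1 : ZMod 2).val = 0 := by decide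
  rcases i with i | i <;> rcases j with j | j <;> simp [par, superSign, h1, h2]

theorem superGram_swap' (m n : ℕ) (i j : SuperIdx m n) :
    superGram m n i j = superSign i i * superGram m n j i := by
  rw [← superGram_swap m n j i]
  rcases i with i | i <;> rcases j with j | j <;> simp [superSign, superGram]

theorem superMetric_swap' (m n : ℕ) (i j : SuperIdx m n) :
    superMetric m n i j = superSign i i * superMetric m n j i := by
  rw [← superMetric_swap m n j i]
  rcases i with i | i <;> rcases j with j | j <;> simp [superSign, superMetric]

theorem osp_gram_skew {m n : ℕ} {A : Matrix (SuperIdx m n) (SuperIdx m n) ℝ} (hA : A ∈ osp m n)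
    (i j : SuperIdx m n) :
    (Aᵀ * superGram m n) i j = -(superSign i j * (Aᵀ * superGram m n) j i) := by
  revert i j
  refine osp_induction (P := fun A => ∀ i j, (Aᵀ * superGram m n) i j =
    -(superSign i j * (Aᵀ * superGram m n) j i)) ?_ ?_ hA
  · rintro p A ⟨h0, h1⟩ i j
    have h2 := congrFun (congrFun h1 i) j
    rw [Matrix.add_apply, signMatrix, mul_assoc, Matrix.diagonal_mul] at h2
    have h3 : (superGram m n * A) i j = superSign i i * (Aᵀ * superGram m n) j i := by
      simp only [Matrix.mul_apply, Finset.mul_sum, Matrix.transpose_apply]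
      refine Finset.sum_congr rfl fun k _ => ?_
      rw [superGram_swap' m n i k]; ring
    rw [h3] at h2
    by_cases hp : par i + par j = p
    · subst hp
      rw [← superSign_of_par]
      simp only [Matrix.zero_apply] at h2
      linear_combination h2
    · have h4 : (Aᵀ * superGram m n) j i = 0 := by
        simp only [Matrix.mul_apply, Matrix.transpose_apply]
        refine Finset.sum_eq_zero fun k _ => ?_
        by_cases hk : par k = par i
        · rw [h0 k j (by rwa [hk]), zero_mul]
        · have : superGram m n k i = 0 := by
            rcases i with i | i <;> rcases k with k | k <;> simp_all [par, superGram]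
          rw [this, mul_zero]
      rw [h4] at h2 ⊢
      simpa using h2
  · intro A B h1 h2 i j
    rw [Matrix.transpose_add, add_mul, Matrix.add_apply, Matrix.add_apply, h1 i j, h2 i j]
    ring

theorem osp_metric_skew {m n : ℕ} {A : Matrix (SuperIdx m n) (SuperIdx m n) ℝ} (hA : A ∈ osp m n)
    (i j : SuperIdx m n) :
    (A * superMetric m n) i j = -(superSign i j * (A * superMetric m n) j i) := by
  have hU : ∀ i j, superMetric m n i j ≠ 0 → par i = par j := by
    rintro (i | i) (j | j) h <;> simp_all [par, superMetric]
  have hs (a b : SuperIdx m n) :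
      par a = par i → par b = par j → superSign a b = superSign i j := by
    rcases i with i | i <;> rcases j with j | j <;> rcases a with a | a <;> rcases b with b | b <;>
      simp [par, superSign]
  have hAU : A * superMetric m n =
      (superMetric m n)ᵀ * (Aᵀ * superGram m n)ᵀ * superMetric m n := by
    rw [← Matrix.transpose_mul, mul_assoc, superGram_mul_superMetric, mul_one,
      Matrix.transpose_transpose]
  have hN (a b : SuperIdx m n) := osp_gram_skew hA b a
  generalize Aᵀ * superGram m n = N at hAU hN
  rw [hAU]
  simp only [Matrix.mul_apply, Matrix.transpose_apply, Finset.sum_mul, Finset.mul_sum]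
  rw [Finset.sum_comm, ← Finset.sum_neg_distrib]
  refine Finset.sum_congr rfl fun a _ => ?_
  rw [← Finset.sum_neg_distrib]
  refine Finset.sum_congr rfl fun b _ => ?_
  by_cases h1 : superMetric m n a i = 0
  · simp [h1]
  by_cases h2 : superMetric m n b j = 0
  · simp [h2]
  rw [hN a b, superSign_comm b a, hs a b (hU _ _ h1) (hU _ _ h2)]
  ring

theorem superAction_comm_superLaplacian {m n : ℕ} {A : Matrix (SuperIdx m n) (SuperIdx m n) ℝ}
    (hA : A ∈ osp m n) : Commute (superAction m n A) (superLaplacian m n) := by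
  have key (k : SuperIdx m n) : superLaplacian m n * mulX m n k =
      mulX m n k * superLaplacian m n + (2 : ℝ) • ∑ a, superGram m n k a • dX m n a := by
    have h (i j : SuperIdx m n) : superGram m n j i • (dX m n i * dX m n j) * mulX m n k =
        superGram m n j i • (mulX m n k * (dX m n i * dX m n j)) +
        ((1 : Matrix (SuperIdx m n) (SuperIdx m n) ℝ) j k * superGram m n j i) • dX m n i +
        ((1 : Matrix (SuperIdx m n) (SuperIdx m n) ℝ) i k * superGram m n i j) • dX m n j := by
      have e : dX m n i * dX m n j * mulX m n k =
          (superSign k i * superSign k j) • (mulX m n k * (dX m n i * dX m n j)) +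
          (1 : Matrix (SuperIdx m n) (SuperIdx m n) ℝ) j k • dX m n i +
          (superSign j k * (1 : Matrix (SuperIdx m n) (SuperIdx m n) ℝ) i k) • dX m n j := by
        rw [mul_assoc, dX_mulX, mul_add, mul_smul_comm, mul_smul_comm, mul_one, ← mul_assoc,
          dX_mulX, add_mul, smul_mul_assoc, smul_mul_assoc, one_mul, superSign_comm k i,
          superSign_comm k j, mul_assoc]
        module
      rw [smul_mul_assoc, e]
      have e1 := superSign_mul_superGram m n k j i
      have e2 : superGram m n j i * (superSign j k * (1 : Matrix (SuperIdx m n) _ ℝ) i k) =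
          (1 : Matrix (SuperIdx m n) (SuperIdx m n) ℝ) i k * superGram m n i j := by
        by_cases hik : i = k
        · subst hik
          rw [← superGram_swap m n j i]; ring
        · simp [Matrix.one_apply_ne hik]
      rw [smul_add, smul_add, smul_smul, smul_smul, smul_smul, e2, mul_comm (superSign k i),
        mul_comm (superGram m n j i), e1, mul_comm (superGram m n j i)]
    rw [superLaplacian_eq, Finset.sum_mul]
    simp only [Finset.sum_mul, h, Finset.sum_add_distrib, Finset.mul_sum, mul_smul_comm]
    rw [Finset.sum_comm (f := fun i j => ((1 : Matrix (SuperIdx m n) (SuperIdx m n) ℝ) i k *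
      superGram m n i j) • dX m n j)]
    simp [Matrix.one_apply, ite_smul]
    module
  have hl (l : SuperIdx m n) : dX m n l * superLaplacian m n = superLaplacian m n * dX m n l := by
    rw [superLaplacian_eq]
    simp only [Finset.sum_mul, Finset.mul_sum, mul_smul_comm, smul_mul_assoc]
    refine Finset.sum_congr rfl fun i _ => Finset.sum_congr rfl fun j _ => ?_
    rw [← mul_assoc, dX_dX m n l i, smul_mul_assoc, mul_assoc, dX_dX m n l j, mul_smul_comm,
      smul_smul, smul_smul, ← mul_assoc]
    congr 1
    linear_combination superSign_mul_superGram m n l j i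
  have hz := sum_eq_zero_of_superSkew _ (fun i j => dX m n j * dX m n i) (osp_gram_skew hA)
    (fun i j => by rw [superSign_comm, ← dX_dX])
  have h (k l : SuperIdx m n) : superLaplacian m n * (mulX m n k * dX m n l) =
      mulX m n k * dX m n l * superLaplacian m n +
        (2 : ℝ) • ∑ a, superGram m n k a • (dX m n a * dX m n l) := by
    rw [← mul_assoc, key, add_mul, mul_assoc, ← hl, ← mul_assoc, smul_mul_assoc, Finset.sum_mul]
    simp only [smul_mul_assoc]
  symm
  change superLaplacian m n * (∑ k, ∑ l, A k l • (mulX m n k * dX m n l)) =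
    (∑ k, ∑ l, A k l • (mulX m n k * dX m n l)) * superLaplacian m n
  simp only [Finset.sum_mul, Finset.mul_sum, mul_smul_comm, smul_mul_assoc, h, smul_add,
    Finset.sum_add_distrib]
  have e : ∀ k l, A k l • (2 : ℝ) • ∑ a, superGram m n k a • (dX m n a * dX m n l) =
      (2 : ℝ) • ∑ a, (A k l * superGram m n k a) • (dX m n a * dX m n l) := by
    intro k l
    rw [smul_comm, Finset.smul_sum]
    simp only [smul_smul]
  simp only [e, ← Finset.smul_sum]
  suffices hs : ∑ k, ∑ l, ∑ a, (A k l * superGram m n k a) • (dX m n a * dX m n l) = 0 by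
    rw [hs, smul_zero, add_zero]
  rw [← hz, Finset.sum_comm]
  refine Finset.sum_congr rfl fun l _ => ?_
  rw [Finset.sum_comm]
  refine Finset.sum_congr rfl fun a _ => ?_
  rw [← Finset.sum_smul, Matrix.mul_apply]
  rfl

theorem superAction_comm_superRSq {m n : ℕ} {A : Matrix (SuperIdx m n) (SuperIdx m n) ℝ}
    (hA : A ∈ osp m n) : Commute (superAction m n A) (superRSq m n) := by
  have key (k : SuperIdx m n) : dX m n k * superRSq m n =
      superRSq m n * dX m n k + (2 : ℝ) • ∑ a, superMetric m n k a • mulX m n a := by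
    have h (i j : SuperIdx m n) : dX m n k * superMetric m n i j • (mulX m n i * mulX m n j) =
        superMetric m n i j • (mulX m n i * mulX m n j * dX m n k) +
        ((1 : Matrix (SuperIdx m n) (SuperIdx m n) ℝ) k i * superMetric m n i j) • mulX m n j +
        ((1 : Matrix (SuperIdx m n) (SuperIdx m n) ℝ) k j * superMetric m n j i) • mulX m n i := by
      have e : dX m n k * (mulX m n i * mulX m n j) =
          (superSign k i * superSign k j) • (mulX m n i * mulX m n j * dX m n k) +
          (1 : Matrix (SuperIdx m n) (SuperIdx m n) ℝ) k i • mulX m n j +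
          (superSign k i * (1 : Matrix (SuperIdx m n) (SuperIdx m n) ℝ) k j) • mulX m n i := by
        rw [← mul_assoc, dX_mulX, add_mul, smul_mul_assoc, smul_mul_assoc, one_mul, mul_assoc,
          dX_mulX, mul_add, mul_smul_comm, mul_smul_comm, mul_one, ← mul_assoc]
        module
      rw [mul_smul_comm, e]
      have e1 := superSign_mul_superMetric m n k i j
      have e2 : superMetric m n i j * (superSign k i * (1 : Matrix (SuperIdx m n) _ ℝ) k j) =
          (1 : Matrix (SuperIdx m n) (SuperIdx m n) ℝ) k j * superMetric m n j i := by
        by_cases hjk : k = j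
        · subst hjk
          rw [← superMetric_swap m n i k, superSign_comm i k]; ring
        · simp [Matrix.one_apply_ne hjk]
      rw [smul_add, smul_add, smul_smul, smul_smul, smul_smul, e2,
        mul_comm (superMetric m n i j), e1, mul_comm (superMetric m n i j)]
    rw [superRSq_eq, Finset.mul_sum]
    simp only [Finset.mul_sum, h, Finset.sum_add_distrib, Finset.sum_mul, smul_mul_assoc]
    rw [Finset.sum_comm (f := fun i j => ((1 : Matrix (SuperIdx m n) (SuperIdx m n) ℝ) k i *
      superMetric m n i j) • mulX m n j)]
    simp [Matrix.one_apply, ite_smul]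
    module
  have hl (l : SuperIdx m n) : mulX m n l * superRSq m n = superRSq m n * mulX m n l := by
    rw [superRSq_eq]
    simp only [Finset.sum_mul, Finset.mul_sum, mul_smul_comm, smul_mul_assoc]
    refine Finset.sum_congr rfl fun i _ => Finset.sum_congr rfl fun j _ => ?_
    rw [← mul_assoc, mulX_mulX m n l i, smul_mul_assoc, mul_assoc, mulX_mulX m n l j, mul_smul_comm,
      smul_smul, smul_smul, ← mul_assoc]
    congr 1
    linear_combination superSign_mul_superMetric m n l i j
  have hz := sum_eq_zero_of_superSkew _ (fun i j => mulX m n i * mulX m n j) (osp_metric_skew hA)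
    (mulX_mulX m n)
  have h (k l : SuperIdx m n) : mulX m n k * dX m n l * superRSq m n =
      superRSq m n * (mulX m n k * dX m n l) +
        (2 : ℝ) • ∑ a, superMetric m n l a • (mulX m n k * mulX m n a) := by
    rw [mul_assoc, key, mul_add, ← mul_assoc, hl, mul_assoc, mul_smul_comm, Finset.mul_sum]
    simp only [mul_smul_comm]
  change (∑ k, ∑ l, A k l • (mulX m n k * dX m n l)) * superRSq m n =
    superRSq m n * (∑ k, ∑ l, A k l • (mulX m n k * dX m n l))
  simp only [Finset.sum_mul, Finset.mul_sum, mul_smul_comm, smul_mul_assoc, h, smul_add,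
    Finset.sum_add_distrib]
  have e : ∀ k l, A k l • (2 : ℝ) • ∑ a, superMetric m n l a • (mulX m n k * mulX m n a) =
      (2 : ℝ) • ∑ a, (A k l * superMetric m n l a) • (mulX m n k * mulX m n a) := by
    intro k l
    rw [smul_comm, Finset.smul_sum]
    simp only [smul_smul]
  simp only [e, ← Finset.smul_sum]
  suffices hs : ∑ k, ∑ l, ∑ a, (A k l * superMetric m n l a) • (mulX m n k * mulX m n a) = 0 by
    rw [hs, smul_zero, add_zero]
  rw [← hz]
  refine Finset.sum_congr rfl fun k _ => ?_
  rw [Finset.sum_comm]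
  refine Finset.sum_congr rfl fun a _ => ?_
  rw [← Finset.sum_smul, Matrix.mul_apply]

theorem superAction_comm_superEuler {m n : ℕ} (A : Matrix (SuperIdx m n) (SuperIdx m n) ℝ) :
    Commute (superAction m n A) (superEuler m n) := by
  have hE : superEuler m n = ∑ i, mulX m n i * dX m n i := rfl
  have h1 (k : SuperIdx m n) :
      superEuler m n * mulX m n k = mulX m n k * superEuler m n + mulX m n k := by
    have h (i : SuperIdx m n) : mulX m n i * dX m n i * mulX m n k =
        mulX m n k * (mulX m n i * dX m n i) +
          (1 : Matrix (SuperIdx m n) (SuperIdx m n) ℝ) i k • mulX m n i := by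
      rw [mul_assoc, dX_mulX, mul_add, mul_smul_comm, mul_smul_comm, mul_one, ← mul_assoc,
        ← mul_assoc, mulX_mulX m n k i, smul_mul_assoc, superSign_comm k i, add_comm]
    rw [hE, Finset.sum_mul, Finset.mul_sum]
    simp only [h, Finset.sum_add_distrib, Matrix.one_apply, ite_smul, one_smul, zero_smul,
      Finset.sum_ite_eq', Finset.mem_univ, if_true]
  have h2 (k : SuperIdx m n) :
      dX m n k * superEuler m n = superEuler m n * dX m n k + dX m n k := by
    have h (i : SuperIdx m n) : dX m n k * (mulX m n i * dX m n i) =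
        mulX m n i * dX m n i * dX m n k +
          (1 : Matrix (SuperIdx m n) (SuperIdx m n) ℝ) k i • dX m n i := by
      rw [← mul_assoc, dX_mulX, add_mul, smul_mul_assoc, smul_mul_assoc, one_mul, mul_assoc,
        mul_assoc, dX_dX m n i k, mul_smul_comm, superSign_comm k i, add_comm]
    rw [hE, Finset.sum_mul, Finset.mul_sum]
    simp only [h, Finset.sum_add_distrib, Matrix.one_apply, ite_smul, one_smul, zero_smul,
      Finset.sum_ite_eq, Finset.mem_univ, if_true]
  change (∑ k, ∑ l, A k l • (mulX m n k * dX m n l)) * superEuler m n =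
    superEuler m n * (∑ k, ∑ l, A k l • (mulX m n k * dX m n l))
  simp only [Finset.sum_mul, Finset.mul_sum, mul_smul_comm, smul_mul_assoc]
  refine Finset.sum_congr rfl fun k _ => Finset.sum_congr rfl fun l _ => ?_
  rw [mul_assoc, h2, mul_add, ← mul_assoc, ← mul_assoc, h1, add_mul]

theorem superAction_mem_homogPoly {m n : ℕ} (A : Matrix (SuperIdx m n) (SuperIdx m n) ℝ) {k : ℕ}
    {P : SuperPoly m n} (hP : P ∈ homogPoly m n k) : superAction m n A P ∈ homogPoly m n k := by
  rw [homogPoly, Module.End.mem_eigenspace_iff] at hP ⊢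
  have h := LinearMap.congr_fun (superAction_comm_superEuler A).eq P
  simp only [Module.End.mul_apply] at h
  rw [← h, hP, map_smul]

theorem superAction_mem_harmonics {m n : ℕ} (k : ℕ) (A : osp m n) :
    ∀ P ∈ harmonics m n k, superAction m n A P ∈ harmonics m n k := by
  rintro P ⟨h1, h2⟩
  refine ⟨?_, superAction_mem_homogPoly _ h2⟩
  have h := LinearMap.congr_fun (superAction_comm_superLaplacian A.2).eq P
  simp only [SetLike.mem_coe, LinearMap.mem_ker] at h1 ⊢
  simp only [Module.End.mul_apply] at h
  rw [← h, h1, map_zero]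

theorem superAction_mem_genHarmonics {m n : ℕ} (k : ℕ) (A : osp m n) :
    ∀ P ∈ genHarmonics m n k, superAction m n A P ∈ genHarmonics m n k := by
  rintro P ⟨h1, h2⟩
  refine ⟨?_, superAction_mem_homogPoly _ h2⟩
  have hD := superAction_comm_superLaplacian A.2
  have h := LinearMap.congr_fun
    (hD.mul_right ((superAction_comm_superRSq A.2).mul_right hD)).eq P
  simp only [SetLike.mem_coe, LinearMap.mem_ker] at h1 ⊢
  simp only [Module.End.mul_apply, LinearMap.comp_apply] at h h1 ⊢
  rw [← h, h1, map_zero]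

/-! ## The modules of spherical harmonics -/

/-- The action of `osp(m|2n)` on `ℋ_k`. -/
def harmonicRep (m n k : ℕ) : osp m n →ₗ[ℝ] Module.End ℝ (harmonics m n k) where
  toFun A := (superAction m n A).restrict (superAction_mem_harmonics k A)
  map_add' A B := by ext; simp
  map_smul' c A := by ext; simp

/-- The action of `osp(m|2n)` on `Ker_k (Δ R² Δ)`. -/
def genHarmonicRep (m n k : ℕ) : osp m n →ₗ[ℝ] Module.End ℝ (genHarmonics m n k) where
  toFun A := (superAction m n A).restrict (superAction_mem_genHarmonics k A)
  map_add' A B := by ext; simp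
  map_smul' c A := by ext; simp

/-- The matrix of the inclusion of the span of the coordinates of `ℝ^{m|2n}` into that of
`ℝ^{m+1|2n}`, where the new coordinate is the last bosonic one, `x_{m+1}`. -/
def coordInclusion (m n : ℕ) : Matrix (SuperIdx (m + 1) n) (SuperIdx m n) ℝ :=
  Matrix.of fun i a => if i = Sum.map Fin.castSucc id a then 1 else 0

theorem coordInclusion_apply_eq_zero {m n : ℕ} {i : SuperIdx (m + 1) n} {a : SuperIdx m n}
    (h : par i ≠ par a) : coordInclusion m n i a = 0 := by
  rcases i with i | i <;> rcases a with a | a <;> simp_all [par, coordInclusion]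

theorem coordInclusion_eq (m n : ℕ) : coordInclusion m n =
    Matrix.fromBlocks (Matrix.of fun i a => if i = Fin.castSucc a then 1 else 0) 0 0 1 := by
  ext (i | i) (a | a) <;> simp [coordInclusion, Matrix.one_apply]

theorem superGram_mul_coordInclusion (m n : ℕ) :
    superGram (m + 1) n * coordInclusion m n = coordInclusion m n * superGram m n := by
  rw [superGram, superGram, coordInclusion_eq, Matrix.fromBlocks_multiply,
    Matrix.fromBlocks_multiply]
  simp

theorem coordInclusion_transpose_mul (m n : ℕ) :
    (coordInclusion m n)ᵀ * superGram (m + 1) n = superGram m n * (coordInclusion m n)ᵀ := by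
  rw [superGram, superGram, coordInclusion_eq, Matrix.fromBlocks_transpose,
    Matrix.fromBlocks_multiply, Matrix.fromBlocks_multiply]
  simp

theorem signMatrix_mul_coordInclusion (m n : ℕ) (p : ZMod 2) :
    signMatrix (m + 1) n p * coordInclusion m n = coordInclusion m n * signMatrix m n p := by
  ext i a
  rw [signMatrix, signMatrix, Matrix.diagonal_mul, Matrix.mul_diagonal]
  by_cases h : par i = par a
  · rw [h, mul_comm]
  · rw [coordInclusion_apply_eq_zero h]; simp

theorem extend_mem_osp {m n : ℕ} (A : osp m n) :
    coordInclusion m n * (A : Matrix (SuperIdx m n) (SuperIdx m n) ℝ) * (coordInclusion m n)ᵀ ∈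
      osp (m + 1) n := by
  refine osp_induction (P := fun A => coordInclusion m n * A * (coordInclusion m n)ᵀ ∈
    osp (m + 1) n) ?_ ?_ A.2
  · rintro p A ⟨h0, h1⟩
    have hp : ospPart (m + 1) n p ≤ osp (m + 1) n := by
      have h2 : ∀ q : ZMod 2, q = 0 ∨ q = 1 := by decide
      rcases h2 p with rfl | rfl
      exacts [le_sup_left, le_sup_right]
    refine hp ⟨fun i j hij => ?_, ?_⟩
    · simp only [Matrix.mul_apply, Matrix.transpose_apply]
      refine Finset.sum_eq_zero fun b _ => ?_
      by_cases hb : par j = par b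
      · rw [Finset.sum_eq_zero, zero_mul]
        intro a _
        by_cases ha : par i = par a
        · rw [h0 a b (by rwa [← ha, ← hb]), mul_zero]
        · rw [coordInclusion_apply_eq_zero ha, zero_mul]
      · rw [coordInclusion_apply_eq_zero hb, mul_zero]
    · have : coordInclusion m n * (Aᵀ * superGram m n + signMatrix m n p * superGram m n * A) *
          (coordInclusion m n)ᵀ = 0 := by rw [h1]; simp
      rw [← this, Matrix.transpose_mul, Matrix.transpose_mul, Matrix.transpose_transpose,
        Matrix.mul_add, Matrix.add_mul]
      simp only [Matrix.mul_assoc]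
      rw [coordInclusion_transpose_mul, ← Matrix.mul_assoc (superGram (m + 1) n),
        superGram_mul_coordInclusion, ← Matrix.mul_assoc, ← Matrix.mul_assoc (signMatrix _ _ _),
        ← Matrix.mul_assoc (signMatrix _ _ _), signMatrix_mul_coordInclusion]
      simp only [Matrix.mul_assoc]
  · intro A B hA hB
    rw [Matrix.mul_add, Matrix.add_mul]
    exact add_mem hA hB

/-- The inclusion `osp(m|2n) ⊂ osp(m+1|2n)`: matrices are extended by zero, so that
`x_{m+1} ↦ 0`. -/
def ospInclusion (m n : ℕ) : osp m n →ₗ[ℝ] osp (m + 1) n where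
  toFun A := ⟨coordInclusion m n * A.1 * (coordInclusion m n)ᵀ, extend_mem_osp A⟩
  map_add' A B := by ext; simp [Matrix.mul_add, Matrix.add_mul]
  map_smul' c A := by ext; simp

/-- Irreducibility of a space `V` on which operators `ρ A` act: `V ≠ 0`, and `0` and `V` are the
only invariant subspaces. -/
def IsIrreducibleRep {L V : Type*} [AddCommMonoid L] [Module ℝ L] [AddCommMonoid V] [Module ℝ V]
    (ρ : L →ₗ[ℝ] Module.End ℝ V) : Prop :=
  Nontrivial V ∧ ∀ U : Submodule ℝ V, (∀ A : L, ∀ u ∈ U, ρ A u ∈ U) → U = ⊥ ∨ U = ⊤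

/-- The external direct sum `⨁_{ℓ ∈ I} 2 ℋ_ℓ ⊕ ⨁_{ℓ ∈ J} ℋ_ℓ`. -/
abbrev HarmonicSum (m n : ℕ) (I J : Set ℕ) : Type :=
  (⨁ ℓ : I, (harmonics m n ℓ × harmonics m n ℓ)) × (⨁ ℓ : J, harmonics m n ℓ)

/-- The componentwise action of `osp(m|2n)` on `⨁_{ℓ ∈ I} 2 ℋ_ℓ ⊕ ⨁_{ℓ ∈ J} ℋ_ℓ`. -/
def harmonicSumAction (m n : ℕ) (I J : Set ℕ) (A : osp m n) :
    Module.End ℝ (HarmonicSum m n I J) :=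
  LinearMap.prodMap
    (DirectSum.lmap fun ℓ : I => LinearMap.prodMap (harmonicRep m n ℓ A) (harmonicRep m n ℓ A))
    (DirectSum.lmap fun ℓ : J => harmonicRep m n ℓ A)

end

/-! The hyperplane `x_{m+1} = 0` is ℝ^{m|2n}, inside the large space ℝ^{m+1|2n} of superdimension M
= -2s. The superdimension M - 1 of the hyperplane is odd. Put k' = 2 - M - k and t = k - 2 - s, so
that s = t + k' and k = 2t + 2 + k'. Underlined spaces live on the hyperplane. Everything rests on
one relation (`superLaplacian_superRSq_pow_apply`): in superdimension D, ΔR² acts on R^{2j}ℋ_ℓ by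
the scalar 2(j+1)(2j+2ℓ+D).

Branching. With Δ = Δ' + ∂² (∂ the derivative in the last bosonic variable), a harmonic polynomial
is determined by its Cauchy data, the values of f and ∂f on the hyperplane, and the Neumann series
of -I²Δ' (I is integration from 0) produces a harmonic polynomial from arbitrary data. On the
hyperplane D is odd, so the scalars never vanish and Fischer's decomposition holds: every
homogeneous polynomial of degree d is uniquely a sum of R^{d-ℓ}h_ℓ with h_ℓ harmonic, ℓ ≡ d mod 2.
Applied to both Cauchy data this gives ℋ_q ≃ ⨁_{ℓ ≤ q} ℋ̲_ℓ (`eq_zero_of_sum_harmonicExt_eq_zero`,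
`exists_sum_harmonicExt_eq`).

Generalized harmonics. On the large space the scalar vanishes for j = t, ℓ = k', so R^{2t+2}ℋ_{k'}
is harmonic. Conversely ΔR²g = 0 in degree k - 2 forces g ∈ R^{2t}ℋ_{k'} (`exists_eq_superRSq_pow`).
Hence Δ maps ℋ̃_k onto R^{2t}ℋ_{k'} with kernel ℋ_k. Integrating twice in the last variable and
correcting by the Neumann series gives a section which is equivariant for the subalgebra
(`laplacianLift`). As R² is injective, ℋ̃_k ≃ ℋ_k ⊕ ℋ_{k'}, and branching both summands yields ℋ̲_ℓ
twice for ℓ ≤ k' and once for k' < ℓ ≤ k. All maps involved commute with the subalgebra and with the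
parity involution (`Intertwines`).

Irreducibility. For harmonic u, products of super rotations send u to ((D+2k-4)X_i - R²ð_i)ð_j u up
to terms already in the submodule. Induction on the degree shows that the derivatives of a nonzero
invariant subspace fill the harmonics one degree lower, and contracting i with j recovers every
harmonic up to the scalar (D+2k-4)k, nonzero for odd D (`harmonics_le_of_superRot_mem`). The modules
are nonzero because a product of ℓ distinct θ's is Cauchy data of a nonzero harmonic, and ℓ ≤ k ≤
2n. -/

noncomputable section

/-! ### Commutation relations: the sl₂-triple Δ, R², 𝔼. -/

section OperatorAlgebra

variable {m n : ℕ}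

theorem superSign_mul_self (i j : SuperIdx m n) : superSign i j * superSign i j = 1 := by
  rcases i with i | i <;> rcases j with j | j <;> simp [superSign]

theorem superSign_congr {i j : SuperIdx m n} (h : par i = par j) (k : SuperIdx m n) :
    superSign i k = superSign j k := by
  rcases i with i | i <;> rcases j with j | j <;> rcases k with k | k <;>
    simp_all [par, superSign]

theorem par_eq_of_superGram_ne_zero {i j : SuperIdx m n} (h : superGram m n i j ≠ 0) :
    par i = par j := by
  rcases i with i | i <;> rcases j with j | j <;> simp_all [par, superGram]

theorem par_eq_of_superMetric_ne_zero {i j : SuperIdx m n} (h : superMetric m n i j ≠ 0) :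
    par i = par j := by
  rcases i with i | i <;> rcases j with j | j <;> simp_all [par, superMetric]

/-- The form is even, so a nonzero entry joins indices of equal parity, and contracted indices may
replace each other inside a sign. -/
theorem superGram_mul_sign (i j k : SuperIdx m n) :
    superGram m n i j * superSign j k = superGram m n i j * superSign i k := by
  by_cases h : superGram m n i j = 0
  · simp [h]
  · rw [superSign_congr (par_eq_of_superGram_ne_zero h)]

theorem superMetric_mul_sign (i j k : SuperIdx m n) :
    superMetric m n i j * superSign j k = superMetric m n i j * superSign i k := by
  by_cases h : superMetric m n i j = 0
  · simp [h]
  · rw [superSign_congr (par_eq_of_superMetric_ne_zero h)]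

theorem sum_superGram_mul_superMetric (i k : SuperIdx m n) :
    ∑ a, superGram m n i a * superMetric m n a k = (1 : Matrix _ _ ℝ) i k := by
  rw [← superGram_mul_superMetric, Matrix.mul_apply]

theorem sum_superMetric_mul_superGram (i k : SuperIdx m n) :
    ∑ a, superMetric m n i a * superGram m n a k = (1 : Matrix _ _ ℝ) i k := by
  rw [← superMetric_mul_superGram, Matrix.mul_apply]

variable (m n) in
/-- The derivative `∑_a g_{ia} ∂_{X_a}` with lowered index. -/
def lowD (i : SuperIdx m n) : Module.End ℝ (SuperPoly m n) :=
  ∑ a, superGram m n i a • dX m n a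

theorem lowD_mulX (i j : SuperIdx m n) : lowD m n i * mulX m n j =
    superGram m n i j • (1 : Module.End ℝ (SuperPoly m n)) +
      superSign i j • (mulX m n j * lowD m n i) := by
  simp only [lowD, Finset.sum_mul, smul_mul_assoc, dX_mulX, smul_add, Finset.sum_add_distrib,
    smul_smul, superGram_mul_sign, Finset.mul_sum, mul_smul_comm, Finset.smul_sum]
  congr 1
  · simp [Matrix.one_apply]
  · simp only [mul_comm]

theorem dX_eq_sum_lowD (i : SuperIdx m n) :
    dX m n i = ∑ a, superMetric m n i a • lowD m n a := by
  simp only [lowD, Finset.smul_sum, smul_smul]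
  rw [Finset.sum_comm]
  simp only [← Finset.sum_smul, sum_superMetric_mul_superGram, Matrix.one_apply, ite_smul,
    one_smul, zero_smul, Finset.sum_ite_eq, Finset.mem_univ, if_true]

theorem superEuler_eq :
    superEuler m n = ∑ a, ∑ b, superMetric m n a b • (mulX m n a * lowD m n b) := by
  have h : superEuler m n = ∑ i, mulX m n i * dX m n i := rfl
  rw [h]
  simp only [dX_eq_sum_lowD, Finset.mul_sum, mul_smul_comm]

/-- Puts Δ in the same shape as R² and 𝔼, so that all three arise by contracting `mulX` and `lowD`
with one metric. The transposition of the Gram matrix and that of the metric each cost the sign of a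
single index, and these signs cancel. -/
theorem superLaplacian_eq_sum_lowD :
    superLaplacian m n = ∑ a, ∑ b, superMetric m n a b • (lowD m n a * lowD m n b) := by
  have h (i j : SuperIdx m n) : superGram m n j i = superSign i i * superGram m n i j := by
    rw [superGram_swap' m n i j, ← mul_assoc, superSign_mul_self, one_mul]
  have h' (a i : SuperIdx m n) : superSign i i * superMetric m n i a = superMetric m n a i := by
    rw [superMetric_swap' m n i a, ← mul_assoc, superSign_mul_self, one_mul]
  have h1 (i : SuperIdx m n) : ∑ j, superGram m n j i • (dX m n i * dX m n j) =
      superSign i i • (dX m n i * lowD m n i) := by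
    simp only [lowD, Finset.mul_sum, mul_smul_comm, Finset.smul_sum, smul_smul]
    exact Finset.sum_congr rfl fun j _ => by rw [h]
  rw [superLaplacian_eq, Finset.sum_comm (γ := SuperIdx m n) (f := fun a b =>
    superMetric m n a b • (lowD m n a * lowD m n b))]
  refine Finset.sum_congr rfl fun i _ => ?_
  rw [h1, dX_eq_sum_lowD]
  simp only [Finset.sum_mul, Finset.smul_sum, smul_mul_assoc, smul_smul, h']

/-- The coordinate passes two derivatives, and the two resulting contractions agree by the
supersymmetry of the form. This is why `lowD` is the natural derivative. -/
theorem superLaplacian_mulX (k : SuperIdx m n) : superLaplacian m n * mulX m n k =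
    mulX m n k * superLaplacian m n + (2 : ℝ) • lowD m n k := by
  have h (i j : SuperIdx m n) : superGram m n j i • (dX m n i * dX m n j) * mulX m n k =
      superGram m n j i • (mulX m n k * (dX m n i * dX m n j)) +
      ((1 : Matrix (SuperIdx m n) (SuperIdx m n) ℝ) j k * superGram m n j i) • dX m n i +
      ((1 : Matrix (SuperIdx m n) (SuperIdx m n) ℝ) i k * superGram m n i j) • dX m n j := by
    have e : dX m n i * dX m n j * mulX m n k =
        (superSign k i * superSign k j) • (mulX m n k * (dX m n i * dX m n j)) +
        (1 : Matrix (SuperIdx m n) (SuperIdx m n) ℝ) j k • dX m n i +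
        (superSign j k * (1 : Matrix (SuperIdx m n) (SuperIdx m n) ℝ) i k) • dX m n j := by
      rw [mul_assoc, dX_mulX, mul_add, mul_smul_comm, mul_smul_comm, mul_one, ← mul_assoc,
        dX_mulX, add_mul, smul_mul_assoc, smul_mul_assoc, one_mul, superSign_comm k i,
        superSign_comm k j, mul_assoc]
      module
    rw [smul_mul_assoc, e]
    have e1 := superSign_mul_superGram m n k j i
    have e2 : superGram m n j i * (superSign j k * (1 : Matrix (SuperIdx m n) _ ℝ) i k) =
        (1 : Matrix (SuperIdx m n) (SuperIdx m n) ℝ) i k * superGram m n i j := by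
      by_cases hik : i = k
      · subst hik
        rw [← superGram_swap m n j i]; ring
      · simp [Matrix.one_apply_ne hik]
    rw [smul_add, smul_add, smul_smul, smul_smul, smul_smul, e2, mul_comm (superSign k i),
      mul_comm (superGram m n j i), e1, mul_comm (superGram m n j i)]
  rw [superLaplacian_eq, Finset.sum_mul, lowD]
  simp only [Finset.sum_mul, h, Finset.sum_add_distrib, Finset.mul_sum, mul_smul_comm]
  rw [Finset.sum_comm (f := fun i j => ((1 : Matrix (SuperIdx m n) (SuperIdx m n) ℝ) i k *
    superGram m n i j) • dX m n j)]
  simp [Matrix.one_apply, ite_smul]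
  module

theorem dX_superLaplacian (l : SuperIdx m n) :
    dX m n l * superLaplacian m n = superLaplacian m n * dX m n l := by
  rw [superLaplacian_eq]
  simp only [Finset.sum_mul, Finset.mul_sum, mul_smul_comm, smul_mul_assoc]
  refine Finset.sum_congr rfl fun i _ => Finset.sum_congr rfl fun j _ => ?_
  rw [← mul_assoc, dX_dX m n l i, smul_mul_assoc, mul_assoc, dX_dX m n l j, mul_smul_comm,
    smul_smul, smul_smul, ← mul_assoc]
  congr 1
  linear_combination superSign_mul_superGram m n l j i

theorem superEuler_mulX (k : SuperIdx m n) :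
    superEuler m n * mulX m n k = mulX m n k * superEuler m n + mulX m n k := by
  have hE : superEuler m n = ∑ i, mulX m n i * dX m n i := rfl
  have h (i : SuperIdx m n) : mulX m n i * dX m n i * mulX m n k =
      mulX m n k * (mulX m n i * dX m n i) +
        (1 : Matrix (SuperIdx m n) (SuperIdx m n) ℝ) i k • mulX m n i := by
    rw [mul_assoc, dX_mulX, mul_add, mul_smul_comm, mul_smul_comm, mul_one, ← mul_assoc,
      ← mul_assoc, mulX_mulX m n k i, smul_mul_assoc, superSign_comm k i, add_comm]
  rw [hE, Finset.sum_mul, Finset.mul_sum]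
  simp only [h, Finset.sum_add_distrib, Matrix.one_apply, ite_smul, one_smul, zero_smul,
    Finset.sum_ite_eq', Finset.mem_univ, if_true]

theorem dX_superEuler (k : SuperIdx m n) :
    dX m n k * superEuler m n = superEuler m n * dX m n k + dX m n k := by
  have hE : superEuler m n = ∑ i, mulX m n i * dX m n i := rfl
  have h (i : SuperIdx m n) : dX m n k * (mulX m n i * dX m n i) =
      mulX m n i * dX m n i * dX m n k +
        (1 : Matrix (SuperIdx m n) (SuperIdx m n) ℝ) k i • dX m n i := by
    rw [← mul_assoc, dX_mulX, add_mul, smul_mul_assoc, smul_mul_assoc, one_mul, mul_assoc,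
      mul_assoc, dX_dX m n i k, mul_smul_comm, superSign_comm k i, add_comm]
  rw [hE, Finset.sum_mul, Finset.mul_sum]
  simp only [h, Finset.sum_add_distrib, Matrix.one_apply, ite_smul, one_smul, zero_smul,
    Finset.sum_ite_eq, Finset.mem_univ, if_true]

theorem lowD_superLaplacian (l : SuperIdx m n) :
    lowD m n l * superLaplacian m n = superLaplacian m n * lowD m n l := by
  simp only [lowD, Finset.sum_mul, Finset.mul_sum, mul_smul_comm, smul_mul_assoc,
    dX_superLaplacian]

theorem lowD_superEuler (k : SuperIdx m n) :
    lowD m n k * superEuler m n = superEuler m n * lowD m n k + lowD m n k := by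
  simp only [lowD, Finset.sum_mul, Finset.mul_sum, mul_smul_comm, smul_mul_assoc,
    dX_superEuler, smul_add, Finset.sum_add_distrib]

/-- A supertrace of the identity: each bosonic index contributes 1, each fermionic index -1. The
superdimension enters all later formulas through this sum. -/
theorem sum_superMetric_mul_superGram_eq :
    ∑ a, ∑ b, superMetric m n a b * superGram m n a b = superdim m n := by
  have h (a : SuperIdx m n) : ∑ b, superMetric m n a b * superGram m n a b = superSign a a := by
    simp only [superGram_swap' m n a, mul_left_comm _ (superSign a a), ← Finset.mul_sum,
      sum_superMetric_mul_superGram, Matrix.one_apply_eq, mul_one]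
  simp [h, superSign, superdim]
  ring

theorem sum_lowD_mulX :
    ∑ a, ∑ b, superMetric m n a b • (lowD m n a * mulX m n b) =
      (superdim m n : ℝ) • (1 : Module.End ℝ (SuperPoly m n)) + superEuler m n := by
  simp only [lowD_mulX, smul_add, Finset.sum_add_distrib, smul_smul]
  congr 1
  · simp only [← Finset.sum_smul, sum_superMetric_mul_superGram_eq]
  · rw [superEuler_eq, Finset.sum_comm]
    simp only [mul_comm (superMetric m n _ _), superMetric_swap]

theorem superLaplacian_superRSq : superLaplacian m n * superRSq m n =
    superRSq m n * superLaplacian m n + (4 : ℝ) • superEuler m n +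
      (2 * (superdim m n : ℝ)) • (1 : Module.End ℝ (SuperPoly m n)) := by
  have h (a b : SuperIdx m n) : superLaplacian m n * (mulX m n a * mulX m n b) =
      mulX m n a * mulX m n b * superLaplacian m n + (2 : ℝ) • (mulX m n a * lowD m n b) +
        (2 : ℝ) • (lowD m n a * mulX m n b) := by
    rw [← mul_assoc, superLaplacian_mulX, add_mul, mul_assoc, superLaplacian_mulX, mul_add,
      mul_smul_comm, smul_mul_assoc, mul_assoc]
  have h1 := sum_lowD_mulX (m := m) (n := n)
  have h2 := superEuler_eq (m := m) (n := n)
  rw [superRSq_eq, Finset.mul_sum]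
  simp only [Finset.mul_sum, mul_smul_comm, h, smul_add, Finset.sum_add_distrib, Finset.sum_mul,
    smul_mul_assoc]
  simp only [smul_comm _ (2 : ℝ), ← Finset.smul_sum, h1, ← h2]
  module

theorem superEuler_superRSq : superEuler m n * superRSq m n =
    superRSq m n * superEuler m n + (2 : ℝ) • superRSq m n := by
  have h (a b : SuperIdx m n) : superEuler m n * (mulX m n a * mulX m n b) =
      mulX m n a * mulX m n b * superEuler m n + (2 : ℝ) • (mulX m n a * mulX m n b) := by
    rw [← mul_assoc, superEuler_mulX, add_mul, mul_assoc, superEuler_mulX, mul_add, two_smul,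
      mul_assoc, add_assoc]
  rw [superRSq_eq]
  simp only [Finset.mul_sum, mul_smul_comm, h, smul_add, Finset.sum_add_distrib, Finset.sum_mul,
    smul_mul_assoc, Finset.smul_sum, smul_comm _ (2 : ℝ)]

theorem superLaplacian_superEuler : superLaplacian m n * superEuler m n =
    superEuler m n * superLaplacian m n + (2 : ℝ) • superLaplacian m n := by
  have h (a b : SuperIdx m n) : dX m n a * dX m n b * superEuler m n =
      superEuler m n * (dX m n a * dX m n b) + (2 : ℝ) • (dX m n a * dX m n b) := by
    rw [mul_assoc, dX_superEuler, mul_add, ← mul_assoc, dX_superEuler, add_mul, two_smul,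
      mul_assoc, add_assoc]
  rw [superLaplacian_eq]
  simp only [Finset.mul_sum, mul_smul_comm, h, smul_add, Finset.sum_add_distrib, Finset.sum_mul,
    smul_mul_assoc, Finset.smul_sum, smul_comm _ (2 : ℝ)]

theorem mem_homogPoly_iff {k : ℕ} {f : SuperPoly m n} :
    f ∈ homogPoly m n k ↔ superEuler m n f = (k : ℝ) • f :=
  Module.End.mem_eigenspace_iff

theorem mem_harmonics_iff {k : ℕ} {f : SuperPoly m n} :
    f ∈ harmonics m n k ↔ superLaplacian m n f = 0 ∧ superEuler m n f = (k : ℝ) • f := by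
  rw [harmonics, Submodule.mem_inf, LinearMap.mem_ker, mem_homogPoly_iff]

theorem mulX_mem_homogPoly {k : ℕ} (i : SuperIdx m n) {f : SuperPoly m n}
    (hf : f ∈ homogPoly m n k) : mulX m n i f ∈ homogPoly m n (k + 1) := by
  rw [mem_homogPoly_iff] at hf ⊢
  have h := LinearMap.congr_fun (superEuler_mulX i) f
  simp only [Module.End.mul_apply, LinearMap.add_apply, hf, map_smul] at h
  rw [h]; push_cast; module

theorem superEuler_dX_apply {c : ℝ} (i : SuperIdx m n) {f : SuperPoly m n}
    (hf : superEuler m n f = c • f) :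
    superEuler m n (dX m n i f) = (c - 1) • dX m n i f := by
  have h := LinearMap.congr_fun (dX_superEuler i) f
  simp only [Module.End.mul_apply, LinearMap.add_apply, hf, map_smul] at h
  rw [eq_sub_of_add_eq h.symm]; module

theorem superEuler_lowD_apply {c : ℝ} (i : SuperIdx m n) {f : SuperPoly m n}
    (hf : superEuler m n f = c • f) :
    superEuler m n (lowD m n i f) = (c - 1) • lowD m n i f := by
  have h := LinearMap.congr_fun (lowD_superEuler i) f
  simp only [Module.End.mul_apply, LinearMap.add_apply, hf, map_smul] at h
  rw [eq_sub_of_add_eq h.symm]; module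

theorem superEuler_superLaplacian_apply {c : ℝ} {f : SuperPoly m n}
    (hf : superEuler m n f = c • f) :
    superEuler m n (superLaplacian m n f) = (c - 2) • superLaplacian m n f := by
  have h := LinearMap.congr_fun (superLaplacian_superEuler (m := m) (n := n)) f
  simp only [Module.End.mul_apply, LinearMap.add_apply, hf, map_smul, LinearMap.smul_apply] at h
  rw [eq_sub_of_add_eq h.symm]; module

theorem superEuler_superRSq_apply {c : ℝ} {f : SuperPoly m n}
    (hf : superEuler m n f = c • f) :
    superEuler m n (superRSq m n f) = (c + 2) • superRSq m n f := by
  have h := LinearMap.congr_fun (superEuler_superRSq (m := m) (n := n)) f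
  simp only [Module.End.mul_apply, LinearMap.add_apply, hf, map_smul, LinearMap.smul_apply] at h
  rw [h]; module

theorem superEuler_superRSq_pow_apply {c : ℝ} {f : SuperPoly m n}
    (hf : superEuler m n f = c • f) (i : ℕ) :
    superEuler m n ((superRSq m n ^ i) f) = (c + 2 * i) • (superRSq m n ^ i) f := by
  induction i with
  | zero => simpa using hf
  | succ i ih =>
    rw [pow_succ', Module.End.mul_apply, superEuler_superRSq_apply ih]
    push_cast; module

/-- The usual sl₂ ladder computation. The factor 2i + 2c + M governs everything below: for natural c
it never vanishes when M is odd, while for even M it vanishes at i + c = -M/2. -/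
theorem superLaplacian_superRSq_pow_apply {c : ℝ} {f : SuperPoly m n}
    (hf : superEuler m n f = c • f) (i : ℕ) :
    superLaplacian m n ((superRSq m n ^ (i + 1)) f) =
      (superRSq m n ^ (i + 1)) (superLaplacian m n f) +
        (2 * (i + 1) * (2 * i + 2 * c + superdim m n) : ℝ) • (superRSq m n ^ i) f := by
  induction i with
  | zero =>
    have h := LinearMap.congr_fun (superLaplacian_superRSq (m := m) (n := n)) f
    simp only [Module.End.mul_apply, LinearMap.add_apply, hf, LinearMap.smul_apply] at h
    simp only [zero_add, pow_one, h, pow_zero, Module.End.one_apply, CharP.cast_eq_zero]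
    module
  | succ i ih =>
    have h := LinearMap.congr_fun (superLaplacian_superRSq (m := m) (n := n))
      ((superRSq m n ^ (i + 1)) f)
    simp only [Module.End.mul_apply, LinearMap.add_apply, LinearMap.smul_apply, ih,
      superEuler_superRSq_pow_apply hf, map_add, map_smul, Module.End.one_apply] at h
    rw [pow_succ', Module.End.mul_apply, h, Module.End.mul_apply]
    rw [← Module.End.mul_apply (superRSq m n) (superRSq m n ^ i), ← pow_succ']
    push_cast; module

end OperatorAlgebra

/-! ### Super rotations and their contracted products. -/

section Rotations

variable {m n : ℕ}

variable (m n) in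
/-- The super rotation `X_i ð_j - (-1)^{|i||j|} X_j ð_i`, where `ð` is `lowD`. -/
def superRot (i j : SuperIdx m n) : Module.End ℝ (SuperPoly m n) :=
  mulX m n i * lowD m n j + (-superSign i j) • (mulX m n j * lowD m n i)

/-- The proof of irreducibility uses invariance under the Lie superalgebra only through these
elements. -/
theorem exists_superAction_eq_superRot (i j : SuperIdx m n) :
    ∃ A ∈ osp m n, superAction m n A = superRot m n i j := by
  -- The entries are the coefficients of X_k ∂_l in the rotation, after writing ð_j = ∑ g_{jl} ∂_l.
  refine ⟨Matrix.of fun k l => (1 : Matrix _ _ ℝ) k i * superGram m n j l +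
    -superSign i j * ((1 : Matrix _ _ ℝ) k j * superGram m n i l), ?_, ?_⟩
  · have hp : ospPart m n (par i + par j) ≤ osp m n := by
      have h2 : ∀ q : ZMod 2, q = 0 ∨ q = 1 := by decide
      rcases h2 (par i + par j) with h | h <;> rw [h]
      exacts [le_sup_left, le_sup_right]
    refine hp ⟨fun k l h => ?_, ?_⟩
    · have h1 : (1 : Matrix _ _ ℝ) k i * superGram m n j l = 0 := by
        by_contra h3
        have hk : k = i := by
          by_contra hk; exact h3 (by rw [Matrix.one_apply_ne hk, zero_mul])
        exact h (by rw [hk, par_eq_of_superGram_ne_zero (right_ne_zero_of_mul h3)])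
      have h2 : (1 : Matrix _ _ ℝ) k j * superGram m n i l = 0 := by
        by_contra h3
        have hk : k = j := by
          by_contra hk; exact h3 (by rw [Matrix.one_apply_ne hk, zero_mul])
        exact h (by rw [hk, par_eq_of_superGram_ne_zero (right_ne_zero_of_mul h3), add_comm])
      simp [h1, h2]
    · ext k l
      rw [Matrix.add_apply, signMatrix, mul_assoc, Matrix.diagonal_mul]
      simp only [Matrix.mul_apply, Matrix.transpose_apply, Matrix.of_apply, add_mul, mul_add,
        Finset.sum_add_distrib, Matrix.one_apply, ite_mul, mul_ite, one_mul, zero_mul,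
        mul_zero, Finset.sum_ite_eq', Finset.mem_univ, if_true, Matrix.zero_apply]
      have h1 : superGram m n j k =
          superSign i j * (-1 : ℝ) ^ ((par i + par j) * par k).val * superGram m n k j := by
        by_cases hk : superGram m n k j = 0
        · rw [superGram_swap' m n j k, hk]; simp
        · have h3 := superSign_of_par j i
          rw [add_comm (par j), superSign_comm j i] at h3
          have h4 : ((-1 : ℝ) ^ ((par i + par j) * par j).val) ^ 2 = 1 := by
            rw [← pow_mul, mul_comm, pow_mul]; simp
          rw [par_eq_of_superGram_ne_zero hk, superGram_swap' m n j k, ← h3]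
          linear_combination -superSign j j * superGram m n k j * h4
      have h2 : superSign i j * superGram m n i k =
          (-1 : ℝ) ^ ((par i + par j) * par k).val * superGram m n k i := by
        by_cases hk : superGram m n k i = 0
        · rw [superGram_swap' m n i k, hk]; simp
        · rw [par_eq_of_superGram_ne_zero hk, superGram_swap' m n i k, ← superSign_of_par i j]
          linear_combination (-1 : ℝ) ^ ((par i + par j) * par i).val * superGram m n k i *
            superSign_mul_self i i
      rw [add_mul] at h1 h2
      linear_combination superGram m n i l * h1 - superGram m n j l * h2
  · change ∑ k, ∑ l, _ • (mulX m n k * dX m n l) = _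
    have h (k l : SuperIdx m n) : ((1 : Matrix _ _ ℝ) k i * superGram m n j l +
        -superSign i j * ((1 : Matrix _ _ ℝ) k j * superGram m n i l)) •
          (mulX m n k * dX m n l) =
        (1 : Matrix _ _ ℝ) k i • (mulX m n k * superGram m n j l • dX m n l) +
        -superSign i j • (1 : Matrix _ _ ℝ) k j • (mulX m n k * superGram m n i l • dX m n l) := by
      simp only [mul_smul_comm]
      module
    simp only [Matrix.of_apply, h, Finset.sum_add_distrib, ← Finset.smul_sum, ← Finset.mul_sum,
      superRot, lowD]
    simp only [Matrix.one_apply, ite_smul, one_smul, zero_smul, Finset.sum_ite_eq',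
      Finset.mem_univ, if_true]

/-- This contraction and those up to `sum_mulX_lowD_mulX_lowD` evaluate the terms of a contracted
product of two rotations. In each, the sign carried by the contracted index cancels the one created
by moving a factor past another. -/
theorem sum_lowD_mulX_lowD (j : SuperIdx m n) :
    ∑ a, ∑ b, (superMetric m n a b * superSign b j) •
      (lowD m n a * (mulX m n j * lowD m n b)) =
    lowD m n j + mulX m n j * superLaplacian m n := by
  have h (a b : SuperIdx m n) : (superMetric m n a b * superSign b j) •
      (lowD m n a * (mulX m n j * lowD m n b)) =
      (superGram m n j a * superMetric m n a b) • lowD m n b +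
        superMetric m n a b • (mulX m n j * (lowD m n a * lowD m n b)) := by
    rw [← mul_assoc, lowD_mulX, add_mul, smul_mul_assoc, one_mul, smul_mul_assoc, smul_add,
      smul_smul, smul_smul, superMetric_mul_sign, mul_assoc, mul_assoc, superSign_mul_self,
      mul_one, superGram_swap, mul_assoc, mul_comm (superMetric m n a b)]
  simp only [h, Finset.sum_add_distrib]
  congr 1
  · rw [Finset.sum_comm]
    simp only [← Finset.sum_smul, sum_superGram_mul_superMetric, Matrix.one_apply, ite_smul,
      one_smul, zero_smul, Finset.sum_ite_eq, Finset.mem_univ, if_true]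
  · simp only [superLaplacian_eq_sum_lowD, Finset.mul_sum, mul_smul_comm]

theorem sum_mulX_lowD_mulX (i : SuperIdx m n) :
    ∑ a, ∑ b, (superMetric m n a b * superSign i a) •
      (mulX m n a * (lowD m n i * mulX m n b)) =
    mulX m n i + superRSq m n * lowD m n i := by
  have h (a b : SuperIdx m n) : (superMetric m n a b * superSign i a) •
      (mulX m n a * (lowD m n i * mulX m n b)) =
      (superMetric m n a b * superGram m n b i) • mulX m n a +
        superMetric m n a b • (mulX m n a * mulX m n b * lowD m n i) := by
    rw [lowD_mulX, mul_add, mul_smul_comm, mul_one, mul_smul_comm, smul_add,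
      smul_smul, smul_smul, superSign_comm i a, ← superMetric_mul_sign, superSign_comm b i,
      mul_assoc, mul_assoc, superSign_mul_self, mul_one, superGram_swap, ← mul_assoc]
  simp only [h, Finset.sum_add_distrib]
  congr 1
  · simp only [← Finset.sum_smul, sum_superMetric_mul_superGram, Matrix.one_apply, ite_smul,
      one_smul, zero_smul, Finset.sum_ite_eq', Finset.mem_univ, if_true]
  · simp only [superRSq_eq, Finset.sum_mul, smul_mul_assoc]

theorem sum_mulX_lowD_lowD (i : SuperIdx m n) :
    ∑ a, ∑ b, (superMetric m n a b * superSign i a) •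
      (mulX m n a * (lowD m n i * lowD m n b)) =
    lowD m n i * superEuler m n + (-1 : ℝ) • lowD m n i := by
  have h (a b : SuperIdx m n) : (superMetric m n a b * superSign i a) •
      (mulX m n a * (lowD m n i * lowD m n b)) =
      superMetric m n a b • (lowD m n i * (mulX m n a * lowD m n b)) +
        (-1 : ℝ) • (superGram m n i a * superMetric m n a b) • lowD m n b := by
    rw [← mul_assoc (lowD m n i), lowD_mulX, add_mul, smul_mul_assoc, one_mul, smul_mul_assoc,
      mul_assoc]
    module
  simp only [h, Finset.sum_add_distrib, ← Finset.smul_sum (r := (-1 : ℝ))]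
  congr 1
  · simp only [superEuler_eq, Finset.mul_sum, mul_smul_comm]
  · congr 1
    rw [Finset.sum_comm]
    simp only [← Finset.sum_smul, sum_superGram_mul_superMetric, Matrix.one_apply, ite_smul,
      one_smul, zero_smul, Finset.sum_ite_eq, Finset.mem_univ, if_true]

theorem sum_mulX_lowD_mulX_lowD (i j : SuperIdx m n) :
    ∑ a, ∑ b, (superMetric m n a b * superSign i a * superSign b j) •
      (mulX m n a * (lowD m n i * (mulX m n j * lowD m n b))) =
    superGram m n i j • superEuler m n + superSign i j •
      (mulX m n j * (lowD m n i * superEuler m n + (-1 : ℝ) • lowD m n i)) := by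
  have h (a b : SuperIdx m n) : (superMetric m n a b * superSign i a * superSign b j) •
      (mulX m n a * (lowD m n i * (mulX m n j * lowD m n b))) =
      superGram m n i j • superMetric m n a b • (mulX m n a * lowD m n b) +
      superSign i j • (mulX m n j * (superMetric m n a b * superSign i a) •
        (mulX m n a * (lowD m n i * lowD m n b))) := by
    have e1 := superMetric_mul_sign a b j
    have e2 := superGram_mul_sign i j a
    rw [superSign_comm j a] at e2
    have e3 := superSign_mul_self a j
    have e4 := superSign_mul_self i a
    have e5 : superMetric m n a b * superSign i a * superSign b j * superGram m n i j =
        superGram m n i j * superMetric m n a b := by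
      linear_combination superGram m n i j * superSign i a * e1 +
        superMetric m n a b * superSign i a * e2 + superMetric m n a b * superGram m n i j * e4
    have e6 : superMetric m n a b * superSign i a * superSign b j * superSign a j =
        superMetric m n a b * superSign i a := by
      linear_combination superSign i a * superSign a j * e1 +
        superMetric m n a b * superSign i a * e3
    rw [← mul_assoc (lowD m n i), lowD_mulX, add_mul, smul_mul_assoc, one_mul, smul_mul_assoc,
      mul_add, smul_add, mul_smul_comm, smul_smul, e5, mul_smul_comm, mul_smul_comm,
      mul_assoc (mulX m n j), ← mul_assoc (mulX m n a), mulX_mulX m n a j, smul_mul_assoc,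
      smul_smul, smul_smul, smul_smul, smul_smul, mul_assoc (mulX m n j),
      mul_right_comm _ _ (superSign a j), e6, mul_comm (superSign i j)]
  simp only [h, Finset.sum_add_distrib, ← Finset.smul_sum, ← Finset.mul_sum,
    sum_mulX_lowD_lowD, ← superEuler_eq]

/-- A Casimir computation with two free indices: expanding both rotations gives four contracted
terms, which are expressible through R², Δ, 𝔼 and single coordinates and derivatives. On harmonics
it simplifies to the lemma that follows. -/
theorem sum_superRot_superRot (i j : SuperIdx m n) :
    ∑ a, ∑ b, superMetric m n a b • (superRot m n i a * superRot m n b j) =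
    mulX m n i * ((superdim m n : ℝ) • (1 : Module.End ℝ (SuperPoly m n)) + superEuler m n) *
        lowD m n j
      + (-1 : ℝ) • (mulX m n i * (lowD m n j + mulX m n j * superLaplacian m n))
      + (-1 : ℝ) • ((mulX m n i + superRSq m n * lowD m n i) * lowD m n j)
      + (superGram m n i j • superEuler m n + superSign i j •
          (mulX m n j * (lowD m n i * superEuler m n + (-1 : ℝ) • lowD m n i))) := by
  have h (a b : SuperIdx m n) : superMetric m n a b • (superRot m n i a * superRot m n b j) =
      mulX m n i * (superMetric m n a b • (lowD m n a * mulX m n b)) * lowD m n j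
      + (-1 : ℝ) • (mulX m n i * ((superMetric m n a b * superSign b j) •
          (lowD m n a * (mulX m n j * lowD m n b))))
      + (-1 : ℝ) • (((superMetric m n a b * superSign i a) •
          (mulX m n a * (lowD m n i * mulX m n b))) * lowD m n j)
      + (superMetric m n a b * superSign i a * superSign b j) •
          (mulX m n a * (lowD m n i * (mulX m n j * lowD m n b))) := by
    simp only [superRot, add_mul, mul_add, smul_mul_assoc, mul_smul_comm, mul_assoc]
    module
  simp only [h, Finset.sum_add_distrib, ← Finset.smul_sum (r := (-1 : ℝ)), ← Finset.mul_sum,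
    ← Finset.sum_mul, sum_lowD_mulX, sum_lowD_mulX_lowD, sum_mulX_lowD_mulX,
    sum_mulX_lowD_mulX_lowD]

/-- On harmonics, the operator `((M + 2k - 4) X_i - R² ð_i) ð_j` lies in the algebra generated by
the super rotations. -/
theorem sum_superRot_superRot_apply {k : ℕ} {u : SuperPoly m n} (hu : u ∈ harmonics m n k)
    (i j : SuperIdx m n) :
    ((superdim m n : ℝ) + 2 * k - 4) • mulX m n i (lowD m n j u) +
        (-1 : ℝ) • superRSq m n (lowD m n i (lowD m n j u)) =
      (∑ a, ∑ b, superMetric m n a b • superRot m n i a (superRot m n b j u)) +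
        ((k : ℝ) - 1) • superRot m n i j u + (-(k * superGram m n i j) : ℝ) • u := by
  rw [mem_harmonics_iff] at hu
  have h := LinearMap.congr_fun (sum_superRot_superRot i j) u
  simp only [LinearMap.sum_apply, LinearMap.smul_apply, Module.End.mul_apply, LinearMap.add_apply,
    LinearMap.add_apply, Module.End.one_apply, hu.1, hu.2, map_zero, map_add, map_smul,
    superEuler_lowD_apply j hu.2] at h
  rw [h]
  simp only [superRot, LinearMap.add_apply, LinearMap.smul_apply, Module.End.mul_apply]
  module

theorem lowD_lowD (i j : SuperIdx m n) :
    lowD m n i * lowD m n j = superSign i j • (lowD m n j * lowD m n i) := by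
  simp only [lowD, Finset.sum_mul, smul_mul_assoc, Finset.mul_sum, mul_smul_comm, Finset.smul_sum]
  rw [Finset.sum_comm]
  refine Finset.sum_congr rfl fun a _ => Finset.sum_congr rfl fun b _ => ?_
  have h : superGram m n j b * superGram m n i a * superSign a b =
      superSign i j * (superGram m n i a * superGram m n j b) := by
    have h1 := superGram_mul_sign i a b
    have h2 := superGram_mul_sign j b i
    rw [superSign_comm b i, superSign_comm j i] at h2
    linear_combination superGram m n j b * h1 + superGram m n i a * h2
  rw [dX_dX m n a b, smul_smul, smul_smul, smul_smul, smul_smul]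
  congr 1
  linear_combination h

/-- Rotations normalize the span of the derivatives, so the derivatives of a rotation invariant
space again span an invariant space. -/
theorem superRot_lowD (c i j : SuperIdx m n) : superRot m n i j * lowD m n c =
    (superSign c i * superSign c j) • (lowD m n c * superRot m n i j +
      (-superGram m n c i) • lowD m n j +
      (superSign i j * superGram m n c j) • lowD m n i) := by
  have e1 := superSign_mul_self c i
  have e2 := superSign_mul_self c j
  have h1 : mulX m n i * (lowD m n c * lowD m n j) =
      superSign c i • (lowD m n c * (mulX m n i * lowD m n j)) +
        (-(superSign c i * superGram m n c i)) • lowD m n j := by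
    rw [← mul_assoc (lowD m n c), lowD_mulX, add_mul, smul_mul_assoc, smul_mul_assoc, one_mul,
      smul_add, smul_smul, smul_smul, e1, mul_assoc]
    module
  have h2 : mulX m n j * (lowD m n c * lowD m n i) =
      superSign c j • (lowD m n c * (mulX m n j * lowD m n i)) +
        (-(superSign c j * superGram m n c j)) • lowD m n i := by
    rw [← mul_assoc (lowD m n c), lowD_mulX, add_mul, smul_mul_assoc, smul_mul_assoc, one_mul,
      smul_add, smul_smul, smul_smul, e2, mul_assoc]
    module
  rw [superRot, add_mul, smul_mul_assoc, mul_assoc, mul_assoc, lowD_lowD j c, lowD_lowD i c,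
    mul_smul_comm, mul_smul_comm, h1, h2, superSign_comm j c, superSign_comm i c, mul_add,
    mul_smul_comm]
  module

end Rotations

/-! ### The grading by degree, and irreducibility of the harmonics in odd superdimension. -/

section Homogeneous

variable {m n : ℕ}

/-- All superpolynomials arise from 1 by multiplying with coordinates and taking linear
combinations, so the grading can be studied through the commutator of 𝔼 with a coordinate. -/
theorem submodule_eq_top_of_mulX_mem {S : Submodule ℝ (SuperPoly m n)}
    (h1 : (1 : MvPolynomial (Fin m) ℝ) ⊗ₜ[ℝ] (1 : ExteriorAlgebra ℝ (Fin n × Fin 2 → ℝ)) ∈ S)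
    (hX : ∀ i, ∀ f ∈ S, mulX m n i f ∈ S) : S = ⊤ := by
  have hw (w : ExteriorAlgebra ℝ (Fin n × Fin 2 → ℝ)) :
      (1 : MvPolynomial (Fin m) ℝ) ⊗ₜ[ℝ] w ∈ S := by
    refine CliffordAlgebra.left_induction (Q := (0 : QuadraticForm ℝ (Fin n × Fin 2 → ℝ)))
      (P := fun w => (1 : MvPolynomial (Fin m) ℝ) ⊗ₜ[ℝ] w ∈ S) ?_ ?_ ?_ w
    · intro r
      rw [Algebra.algebraMap_eq_smul_one, TensorProduct.tmul_smul]
      exact S.smul_mem r h1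
    · intro x y hx hy
      rw [TensorProduct.tmul_add]
      exact S.add_mem hx hy
    · intro x v hx
      have hv : CliffordAlgebra.ι (0 : QuadraticForm ℝ (Fin n × Fin 2 → ℝ)) v =
          ∑ j, v j • ExteriorAlgebra.ι ℝ (Pi.single j (1 : ℝ)) := by
        simp only [← map_smul, ← map_sum, ExteriorAlgebra.ι]
        congr 1
        exact pi_eq_sum_univ' v
      rw [hv, Finset.sum_mul, TensorProduct.tmul_sum]
      refine S.sum_mem fun j _ => ?_
      rw [smul_mul_assoc, TensorProduct.tmul_smul]
      exact S.smul_mem _ (hX (Sum.inr j) _ hx)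
  refine eq_top_iff.mpr fun f _ => ?_
  induction f using TensorProduct.induction_on with
  | zero => exact S.zero_mem
  | add x y hx hy => exact S.add_mem (hx trivial) (hy trivial)
  | tmul p w =>
    induction p using MvPolynomial.induction_on with
    | C r =>
      rw [← mul_one (MvPolynomial.C r), ← MvPolynomial.smul_eq_C_mul, TensorProduct.smul_tmul,
        TensorProduct.tmul_smul]
      exact S.smul_mem r (hw w)
    | add p q hp hq =>
      rw [TensorProduct.add_tmul]
      exact S.add_mem (hp trivial) (hq trivial)
    | mul_X p i hp =>
      have h := hX (Sum.inl i) _ (hp trivial)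
      rw [mul_comm]
      exact h

variable (m n) in
/-- The constant superpolynomial `1`. -/
def superOne : SuperPoly m n := 1 ⊗ₜ[ℝ] 1

theorem dX_superOne (i : SuperIdx m n) : dX m n i (superOne m n) = 0 := by
  rcases i with i | i <;> simp [dX, superOne]

theorem superEuler_superOne : superEuler m n (superOne m n) = 0 := by
  simp [superEuler, dX_superOne]

theorem iSup_eigenspace_superEuler_pos :
    ℝ ∙ superOne m n ⊔ ⨆ k : ℕ, homogPoly m n (k + 1) = ⊤ := by
  refine submodule_eq_top_of_mulX_mem
    (Submodule.mem_sup_left (Submodule.mem_span_singleton_self _)) fun i => ?_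
  have h : ℝ ∙ superOne m n ⊔ ⨆ k : ℕ, homogPoly m n (k + 1) ≤
      (⨆ k : ℕ, homogPoly m n (k + 1)).comap (mulX m n i) := by
    refine sup_le ?_ (iSup_le fun k f hf => ?_)
    · rw [Submodule.span_singleton_le_iff_mem]
      have h0 : superOne m n ∈ homogPoly m n 0 := by
        rw [mem_homogPoly_iff, superEuler_superOne]; simp
      exact Submodule.mem_iSup_of_mem 0 (mulX_mem_homogPoly i h0)
    · exact Submodule.mem_iSup_of_mem (k + 1) (mulX_mem_homogPoly i hf)
  exact fun f hf => Submodule.mem_sup_right (h hf)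

/-- Eigenspaces are independent, and those for 0, 1, 2, … already span everything. Below this is the
tool for killing anything whose degree has been lowered under zero. -/
theorem eq_zero_of_superEuler_neg {c : ℝ} (hc : c < 0) {f : SuperPoly m n}
    (hf : superEuler m n f = c • f) : f = 0 := by
  have hi := Module.End.eigenspaces_iSupIndep (superEuler m n) c
  have ht : ⨆ j, ⨆ (_ : j ≠ c), Module.End.eigenspace (superEuler m n) j = ⊤ := by
    rw [eq_top_iff, ← iSup_eigenspace_superEuler_pos]
    refine sup_le ?_ (iSup_le fun k => ?_)
    · rw [Submodule.span_singleton_le_iff_mem]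
      refine Submodule.mem_iSup_of_mem 0 (Submodule.mem_iSup_of_mem hc.ne' ?_)
      rw [Module.End.mem_eigenspace_iff, superEuler_superOne]; simp
    · refine le_iSup₂_of_le ((k + 1 : ℕ) : ℝ) (fun h => ?_) le_rfl
      rw [← h] at hc
      exact absurd hc (not_lt.mpr (Nat.cast_nonneg _))
  rw [ht, disjoint_top] at hi
  have : f ∈ Module.End.eigenspace (superEuler m n) c := Module.End.mem_eigenspace_iff.mpr hf
  rw [hi] at this
  exact (Submodule.mem_bot ℝ).mp this

theorem homogPoly_zero : homogPoly m n 0 = ℝ ∙ superOne m n := by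
  have h1 : superOne m n ∈ homogPoly m n 0 := by
    rw [mem_homogPoly_iff, superEuler_superOne]; simp
  refine le_antisymm (fun f hf => ?_) ((Submodule.span_singleton_le_iff_mem _ _).mpr h1)
  have hi := Module.End.eigenspaces_iSupIndep (superEuler m n) ((0 : ℕ) : ℝ)
  have hft : f ∈ ℝ ∙ superOne m n ⊔ ⨆ k : ℕ, homogPoly m n (k + 1) := by
    rw [iSup_eigenspace_superEuler_pos]; trivial
  obtain ⟨t, ht, g, hg, rfl⟩ := Submodule.mem_sup.mp hft
  have ht0 := (Submodule.span_singleton_le_iff_mem _ _).mpr h1 ht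
  have hg0 : g ∈ homogPoly m n 0 := (Submodule.add_mem_iff_right _ ht0).mp hf
  have hg1 : g ∈ ⨆ j, ⨆ (_ : j ≠ ((0 : ℕ) : ℝ)), Module.End.eigenspace (superEuler m n) j := by
    refine (iSup_le fun k => ?_ : ⨆ k : ℕ, homogPoly m n (k + 1) ≤ _) hg
    refine le_iSup₂_of_le ((k + 1 : ℕ) : ℝ) (fun h => ?_) le_rfl
    exact Nat.succ_ne_zero k (Nat.cast_injective h)
  rw [Submodule.disjoint_def.mp hi g hg0 hg1, add_zero]
  exact ht

/-- Euler's formula: 𝔼 is a combination of the X_a ð_b, and its eigenvalue k + 1 is not zero. -/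
theorem eq_zero_of_superEuler_of_lowD {k : ℕ} {f : SuperPoly m n}
    (hf : f ∈ homogPoly m n (k + 1)) (h : ∀ i, lowD m n i f = 0) : f = 0 := by
  rw [mem_homogPoly_iff, superEuler_eq] at hf
  simp only [LinearMap.sum_apply, LinearMap.smul_apply, Module.End.mul_apply, h, map_zero,
    smul_zero, Finset.sum_const_zero] at hf
  exact (smul_eq_zero.mp hf.symm).resolve_left (Nat.cast_ne_zero.mpr (Nat.succ_ne_zero k))

theorem lowD_mem_harmonics {k : ℕ} {f : SuperPoly m n} (hf : f ∈ harmonics m n (k + 1))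
    (i : SuperIdx m n) : lowD m n i f ∈ harmonics m n k := by
  rw [mem_harmonics_iff] at hf ⊢
  refine ⟨?_, ?_⟩
  · have h := LinearMap.congr_fun (lowD_superLaplacian i) f
    simp only [Module.End.mul_apply, hf.1, map_zero] at h
    exact h.symm
  · rw [superEuler_lowD_apply i hf.2]; push_cast; congr 1; ring

/-- Induction on the degree: differentiate the invariant subspace to descend, apply the inductive
hypothesis, and climb back with operators obtained from products of rotations. -/
theorem harmonics_le_of_superRot_mem (hM : Odd (superdim m n)) (k : ℕ)
    {U : Submodule ℝ (SuperPoly m n)} (hU : U ≤ harmonics m n k) (hne : U ≠ ⊥)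
    (hinv : ∀ i j, ∀ u ∈ U, superRot m n i j u ∈ U) : harmonics m n k ≤ U := by
  induction k generalizing U with
  | zero =>
    have h0 : harmonics m n 0 ≤ ℝ ∙ superOne m n := homogPoly_zero.le.trans' inf_le_right
    obtain ⟨u, hu, hu0⟩ := Submodule.exists_mem_ne_zero_of_ne_bot hne
    obtain ⟨c, rfl⟩ := Submodule.mem_span_singleton.mp (h0 (hU hu))
    have hc : c ≠ 0 := fun h => hu0 (by rw [h, zero_smul])
    refine h0.trans ((Submodule.span_singleton_le_iff_mem _ _).mpr ?_)
    exact (U.smul_mem_iff hc).mp hu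
  | succ k ih =>
    -- An odd number plus even numbers. This is where odd superdimension is needed.
    have hc : (superdim m n : ℝ) + 2 * (k + 1 : ℕ) - 4 ≠ 0 := by
      obtain ⟨t, ht⟩ := hM
      rw [ht]
      intro h
      have h' : 2 * t + 1 + 2 * ((k + 1 : ℕ) : ℤ) - 4 = 0 := by exact_mod_cast h
      omega
    have hk : ∀ u ∈ U, ∀ i j,
        ((superdim m n : ℝ) + 2 * (k + 1 : ℕ) - 4) • mulX m n i (lowD m n j u) +
        (-1 : ℝ) • superRSq m n (lowD m n i (lowD m n j u)) ∈ U := by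
      intro u hu i j
      rw [sum_superRot_superRot_apply (hU hu)]
      refine U.add_mem (U.add_mem ?_ (U.smul_mem _ (hinv i j u hu))) (U.smul_mem _ hu)
      exact U.sum_mem fun a _ => U.sum_mem fun b _ =>
        U.smul_mem _ (hinv _ _ _ (hinv _ _ _ hu))
    -- The span of all derivatives of `U` is invariant by `superRot_lowD` and nonzero by Euler's
    -- formula, so the inductive hypothesis applies to it.
    have hD : harmonics m n k ≤ ⨆ i, U.map (lowD m n i) := by
      refine ih (iSup_le fun i => ?_) (fun h => hne ?_) fun i j => ?_
      · rintro _ ⟨u, hu, rfl⟩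
        exact lowD_mem_harmonics (hU hu) i
      · refine (Submodule.eq_bot_iff _).mpr fun u hu =>
          eq_zero_of_superEuler_of_lowD (hU hu).2 fun i => ?_
        have h' : lowD m n i u ∈ ⨆ i, U.map (lowD m n i) :=
          Submodule.mem_iSup_of_mem i (Submodule.mem_map_of_mem hu)
        rw [h] at h'
        exact (Submodule.mem_bot ℝ).mp h'
      · suffices h : ⨆ i, U.map (lowD m n i) ≤
            (⨆ i, U.map (lowD m n i)).comap (superRot m n i j) from fun u hu => h hu
        refine iSup_le fun c => ?_
        rintro _ ⟨u, hu, rfl⟩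
        have hm (a : SuperIdx m n) {v} (hv : v ∈ U) : lowD m n a v ∈ ⨆ i, U.map (lowD m n i) :=
          Submodule.mem_iSup_of_mem a (Submodule.mem_map_of_mem hv)
        have h := LinearMap.congr_fun (superRot_lowD c i j) u
        simp only [Module.End.mul_apply, LinearMap.add_apply, LinearMap.smul_apply] at h
        rw [Submodule.mem_comap, h]
        exact Submodule.smul_mem _ _ (Submodule.add_mem _ (Submodule.add_mem _
          (hm c (hinv i j u hu)) (Submodule.smul_mem _ _ (hm j hu)))
          (Submodule.smul_mem _ _ (hm i hu)))
    -- By `hk` the raising operator sends each derivative of an element of `U` into `U`; these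
    -- derivatives now span all harmonics of degree k.
    have hK : ∀ i, harmonics m n k ≤ U.comap
        (((superdim m n : ℝ) + 2 * (k + 1 : ℕ) - 4) • mulX m n i +
          (-1 : ℝ) • (superRSq m n ∘ₗ lowD m n i)) := by
      refine fun i => hD.trans (iSup_le fun j => ?_)
      rintro _ ⟨u, hu, rfl⟩
      exact hk u hu i j
    intro v hv
    have hs : ∑ i, ∑ j, superMetric m n i j •
        ((((superdim m n : ℝ) + 2 * (k + 1 : ℕ) - 4) • mulX m n i +
          (-1 : ℝ) • (superRSq m n ∘ₗ lowD m n i)) (lowD m n j v)) ∈ U :=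
      U.sum_mem fun i _ => U.sum_mem fun j _ =>
        U.smul_mem _ (hK i (lowD_mem_harmonics hv j))
    have hv' := mem_harmonics_iff.mp hv
    have hE := LinearMap.congr_fun (superEuler_eq (m := m) (n := n)) v
    have hL := LinearMap.congr_fun (superLaplacian_eq_sum_lowD (m := m) (n := n)) v
    simp only [LinearMap.sum_apply, LinearMap.smul_apply, Module.End.mul_apply, hv'.1, hv'.2]
      at hE hL
    have hL' := congrArg (superRSq m n) hL
    simp only [map_zero, map_sum, map_smul] at hL'
    -- Contracting, the first term gives 𝔼v = (k + 1)v, and the second gives R²Δv = 0.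
    have he : ∑ i, ∑ j, superMetric m n i j •
        ((((superdim m n : ℝ) + 2 * (k + 1 : ℕ) - 4) • mulX m n i +
          (-1 : ℝ) • (superRSq m n ∘ₗ lowD m n i)) (lowD m n j v)) =
        (((superdim m n : ℝ) + 2 * (k + 1 : ℕ) - 4) * (k + 1 : ℕ)) • v := by
      simp only [LinearMap.add_apply, LinearMap.smul_apply, LinearMap.comp_apply, smul_add,
        Finset.sum_add_distrib, smul_comm (superMetric m n _ _), ← Finset.smul_sum, ← hE]
      rw [← hL', smul_zero, add_zero, mul_smul]
    rw [he] at hs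
    exact (U.smul_mem_iff (mul_ne_zero hc (Nat.cast_ne_zero.mpr (Nat.succ_ne_zero k)))).mp hs

theorem isIrreducibleRep_harmonicRep (hM : Odd (superdim m n)) {k : ℕ}
    (hk : harmonics m n k ≠ ⊥) : IsIrreducibleRep (harmonicRep m n k) := by
  refine ⟨Submodule.nontrivial_iff_ne_bot.mpr hk, fun U hU => ?_⟩
  by_cases h : U = ⊥
  · exact Or.inl h
  right
  have h1 : harmonics m n k ≤ U.map (harmonics m n k).subtype := by
    refine harmonics_le_of_superRot_mem hM k (Submodule.map_subtype_le _ _) (fun h' => h ?_) ?_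
    · exact Submodule.map_injective_of_injective
        (Submodule.subtype_injective _) (h'.trans (Submodule.map_bot _).symm)
    · rintro i j _ ⟨u, hu, rfl⟩
      obtain ⟨A, hA, hAR⟩ := exists_superAction_eq_superRot i j
      refine ⟨_, hU ⟨A, hA⟩ u hu, ?_⟩
      rw [← hAR]; rfl
  refine eq_top_iff.mpr fun u _ => ?_
  obtain ⟨v, hv, hvu⟩ := h1 u.2
  rwa [← Subtype.ext hvu]

end Homogeneous

/-! ### Restriction and integration in the last commuting variable. -/

section PolynomialSplitting

open MvPolynomial

variable (m : ℕ)

/-- Substitution of `0` for the last variable. -/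
def polyRestr : MvPolynomial (Fin (m + 1)) ℝ →ₐ[ℝ] MvPolynomial (Fin m) ℝ :=
  aeval (Fin.snoc (α := fun _ => MvPolynomial (Fin m) ℝ) X 0)

/-- Integration from `0` with respect to the last variable. -/
def polyInteg : MvPolynomial (Fin (m + 1)) ℝ →ₗ[ℝ] MvPolynomial (Fin (m + 1)) ℝ :=
  (basisMonomials (Fin (m + 1)) ℝ).constr ℝ fun s =>
    monomial (s + Finsupp.single (Fin.last m) 1) ((s (Fin.last m) + 1 : ℝ)⁻¹)

variable {m}

theorem polyInteg_monomial (s : Fin (m + 1) →₀ ℕ) (c : ℝ) : polyInteg m (monomial s c) =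
    monomial (s + Finsupp.single (Fin.last m) 1) (c * (s (Fin.last m) + 1 : ℝ)⁻¹) := by
  have h : (monomial s c : MvPolynomial (Fin (m + 1)) ℝ) = c • monomial s 1 := by
    rw [smul_monomial, smul_eq_mul, mul_one]
  have hb : (monomial s 1 : MvPolynomial (Fin (m + 1)) ℝ) =
      basisMonomials (Fin (m + 1)) ℝ s := by rw [coe_basisMonomials]
  rw [h, map_smul, polyInteg, hb, Module.Basis.constr_basis, smul_monomial, smul_eq_mul]

theorem polyRestr_X_castSucc (i : Fin m) : polyRestr m (X (Fin.castSucc i)) = X i := by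
  simp [polyRestr]

theorem polyRestr_X_last : polyRestr m (X (Fin.last m)) = 0 := by
  simp [polyRestr]

theorem polyRestr_rename (p : MvPolynomial (Fin m) ℝ) :
    polyRestr m (rename Fin.castSucc p) = p := by
  have h : (polyRestr m).comp (rename Fin.castSucc) = AlgHom.id ℝ _ := by
    ext i; simp [polyRestr_X_castSucc]
  exact DFunLike.congr_fun h p

theorem polyRestr_polyInteg (p : MvPolynomial (Fin (m + 1)) ℝ) :
    polyRestr m (polyInteg m p) = 0 := by
  induction p using MvPolynomial.induction_on' with
  | monomial s c =>
    rw [polyInteg_monomial, ← mul_one (c * _), ← monomial_mul, map_mul]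
    have : (monomial (Finsupp.single (Fin.last m) 1) (1 : ℝ)) = X (Fin.last m) := rfl
    rw [this, polyRestr_X_last, mul_zero]
  | add p q hp hq => rw [map_add, map_add, hp, hq, add_zero]

theorem pderiv_last_polyInteg (p : MvPolynomial (Fin (m + 1)) ℝ) :
    pderiv (Fin.last m) (polyInteg m p) = p := by
  induction p using MvPolynomial.induction_on' with
  | monomial s c =>
    rw [polyInteg_monomial, pderiv_monomial]
    have h : (s (Fin.last m) : ℝ) + 1 ≠ 0 := by positivity
    congr 1
    · simp
    · simp [mul_assoc, inv_mul_cancel₀ h]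
  | add p q hp hq => rw [map_add, map_add, hp, hq]

theorem pderiv_castSucc_polyInteg (i : Fin m) (p : MvPolynomial (Fin (m + 1)) ℝ) :
    pderiv (Fin.castSucc i) (polyInteg m p) = polyInteg m (pderiv (Fin.castSucc i) p) := by
  induction p using MvPolynomial.induction_on' with
  | monomial s c =>
    have hne : Fin.last m ≠ Fin.castSucc i := (Fin.castSucc_lt_last i).ne'
    rw [polyInteg_monomial, pderiv_monomial, pderiv_monomial, polyInteg_monomial]
    by_cases h0 : s (Fin.castSucc i) = 0
    · simp [h0, hne]
    · congr 1
      · rw [tsub_add_eq_add_tsub]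
        rwa [Finsupp.single_le_iff, Nat.one_le_iff_ne_zero]
      · simp [hne, hne.symm]; ring
  | add p q hp hq => simp only [map_add, hp, hq]

theorem X_castSucc_mul_polyInteg (i : Fin m) (p : MvPolynomial (Fin (m + 1)) ℝ) :
    X (Fin.castSucc i) * polyInteg m p = polyInteg m (X (Fin.castSucc i) * p) := by
  induction p using MvPolynomial.induction_on' with
  | monomial s c =>
    have hne : Fin.last m ≠ Fin.castSucc i := (Fin.castSucc_lt_last i).ne'
    rw [polyInteg_monomial, X, monomial_mul, monomial_mul, polyInteg_monomial, add_assoc]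
    simp [hne]
  | add p q hp hq => simp only [map_add, mul_add, hp, hq]

theorem polyRestr_pderiv_castSucc (i : Fin m) (p : MvPolynomial (Fin (m + 1)) ℝ) :
    polyRestr m (pderiv (Fin.castSucc i) p) = pderiv i (polyRestr m p) := by
  induction p using MvPolynomial.induction_on with
  | C r => simp
  | add p q hp hq => simp only [map_add, hp, hq]
  | mul_X p j hp =>
    rw [Derivation.leibniz, map_mul (polyRestr m), Derivation.leibniz, map_add]
    simp only [smul_eq_mul, map_mul, hp]
    congr 2
    refine Fin.lastCases ?_ (fun j => ?_) j
    · rw [polyRestr_X_last, pderiv_X_of_ne (Fin.castSucc_lt_last i).ne']; simp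
    · rw [polyRestr_X_castSucc]
      by_cases h : j = i
      · subst h; simp
      · rw [pderiv_X_of_ne h, pderiv_X_of_ne (fun h' => h (Fin.castSucc_injective m h')), map_zero]

theorem pderiv_castSucc_rename (i : Fin m) (p : MvPolynomial (Fin m) ℝ) :
    pderiv (Fin.castSucc i) (rename Fin.castSucc p) = rename Fin.castSucc (pderiv i p) := by
  induction p using MvPolynomial.induction_on with
  | C r => simp
  | add p q hp hq => simp only [map_add, hp, hq]
  | mul_X p j hp =>
    rw [map_mul, Derivation.leibniz, Derivation.leibniz, map_add]
    simp only [smul_eq_mul, map_mul, hp, rename_X]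
    congr 2
    by_cases h : j = i
    · subst h; simp
    · rw [pderiv_X_of_ne h, pderiv_X_of_ne (fun h' => h (Fin.castSucc_injective m h')), map_zero]

theorem pderiv_last_rename (p : MvPolynomial (Fin m) ℝ) :
    pderiv (Fin.last m) (rename Fin.castSucc p) = 0 := by
  induction p using MvPolynomial.induction_on with
  | C r => simp
  | add p q hp hq => simp only [map_add, hp, hq, add_zero]
  | mul_X p j hp =>
    rw [map_mul, Derivation.leibniz, hp, rename_X, pderiv_X_of_ne (Fin.castSucc_lt_last j).ne]
    simp

/-- The fundamental theorem of calculus. On monomials, one of the two terms vanishes according to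
whether the last variable occurs. -/
theorem polyInteg_pderiv_last (p : MvPolynomial (Fin (m + 1)) ℝ) :
    polyInteg m (pderiv (Fin.last m) p) + rename Fin.castSucc (polyRestr m p) = p := by
  induction p using MvPolynomial.induction_on' with
  | monomial s c =>
    by_cases h0 : s (Fin.last m) = 0
    · rw [pderiv_monomial, h0, Nat.cast_zero, mul_zero, monomial_zero, map_zero, zero_add]
      have hs : monomial s c = rename Fin.castSucc (monomial (s.comapDomain Fin.castSucc
          (Fin.castSucc_injective m).injOn) c) := by
        rw [rename_monomial, Finsupp.mapDomain_comapDomain _ (Fin.castSucc_injective m)]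
        intro i hi
        induction i using Fin.lastCases with
        | last => simp [h0] at hi
        | cast i => exact ⟨i, rfl⟩
      rw [hs, polyRestr_rename]
    · have hle : Finsupp.single (Fin.last m) 1 ≤ s := by
        rwa [Finsupp.single_le_iff, Nat.one_le_iff_ne_zero]
      have hs : monomial s c = monomial (s - Finsupp.single (Fin.last m) 1) c * X (Fin.last m) := by
        rw [X, monomial_mul, tsub_add_cancel_of_le hle, mul_one]
      have h2 : polyRestr m (monomial s c) = 0 := by
        rw [hs, map_mul, polyRestr_X_last, mul_zero]
      rw [h2, map_zero, add_zero, pderiv_monomial, polyInteg_monomial, tsub_add_cancel_of_le hle]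
      congr 1
      obtain ⟨t, ht⟩ := Nat.exists_eq_succ_of_ne_zero h0
      have h : (t : ℝ) + 1 ≠ 0 := by positivity
      simp [ht, mul_assoc, mul_inv_cancel₀ h]
  | add p q hp hq =>
    simp only [map_add]
    rw [add_add_add_comm, hp, hq]

end PolynomialSplitting

/-! ### Separating the last bosonic variable from the other supercoordinates. -/

section LastVariable

/-- The inclusion of the coordinates of `ℝ^{m|2n}` into those of `ℝ^{m+1|2n}`. -/
def embedIdx {m n : ℕ} : SuperIdx m n → SuperIdx (m + 1) n := Sum.map Fin.castSucc id

variable (m n : ℕ)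

/-- The last bosonic coordinate. -/
abbrev lastIdx : SuperIdx (m + 1) n := Sum.inl (Fin.last m)

/-- The inclusion of the superpolynomials which do not depend on the last bosonic variable. -/
def superEmbed : SuperPoly m n →ₗ[ℝ] SuperPoly (m + 1) n :=
  (MvPolynomial.rename Fin.castSucc : MvPolynomial (Fin m) ℝ →ₐ[ℝ] _).toLinearMap.rTensor _

/-- Restriction to the hyperplane where the last bosonic variable vanishes. -/
def superRestr : SuperPoly (m + 1) n →ₗ[ℝ] SuperPoly m n :=
  (polyRestr m).toLinearMap.rTensor _

/-- Integration from `0` with respect to the last bosonic variable. -/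
def superInteg : Module.End ℝ (SuperPoly (m + 1) n) :=
  (polyInteg m).rTensor _

variable {m n}

theorem superRestr_superEmbed (f : SuperPoly m n) : superRestr m n (superEmbed m n f) = f := by
  induction f using TensorProduct.induction_on with
  | zero => simp
  | add x y hx hy => simp only [map_add, hx, hy]
  | tmul p w => simp [superRestr, superEmbed, polyRestr_rename]

theorem superRestr_superInteg (f : SuperPoly (m + 1) n) :
    superRestr m n (superInteg m n f) = 0 := by
  induction f using TensorProduct.induction_on with
  | zero => simp
  | add x y hx hy => simp only [map_add, hx, hy, add_zero]
  | tmul p w => simp [superRestr, superInteg, polyRestr_polyInteg]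

theorem dX_last_superInteg (f : SuperPoly (m + 1) n) :
    dX (m + 1) n (lastIdx m n) (superInteg m n f) = f := by
  induction f using TensorProduct.induction_on with
  | zero => simp
  | add x y hx hy => simp only [map_add, hx, hy]
  | tmul p w => simp [dX, superInteg, pderiv_last_polyInteg]

theorem superInteg_dX_last (f : SuperPoly (m + 1) n) :
    superInteg m n (dX (m + 1) n (lastIdx m n) f) + superEmbed m n (superRestr m n f) = f := by
  induction f using TensorProduct.induction_on with
  | zero => simp
  | add x y hx hy =>
    simp only [map_add]
    rw [add_add_add_comm, hx, hy]
  | tmul p w =>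
    simp only [dX, superInteg, superEmbed, superRestr, LinearMap.rTensor_tmul,
      ← TensorProduct.add_tmul]
    congr 1
    exact polyInteg_pderiv_last p

theorem dX_last_superEmbed (f : SuperPoly m n) :
    dX (m + 1) n (lastIdx m n) (superEmbed m n f) = 0 := by
  induction f using TensorProduct.induction_on with
  | zero => simp
  | add x y hx hy => simp only [map_add, hx, hy, add_zero]
  | tmul p w => simp [dX, superEmbed, pderiv_last_rename]

theorem superRestr_mulX_last (f : SuperPoly (m + 1) n) :
    superRestr m n (mulX (m + 1) n (lastIdx m n) f) = 0 := by
  induction f using TensorProduct.induction_on with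
  | zero => simp
  | add x y hx hy => simp only [map_add, hx, hy, add_zero]
  | tmul p w => simp [mulX, superRestr, polyRestr_X_last]

theorem mulX_superEmbed (i : SuperIdx m n) (f : SuperPoly m n) :
    mulX (m + 1) n (embedIdx i) (superEmbed m n f) = superEmbed m n (mulX m n i f) := by
  induction f using TensorProduct.induction_on with
  | zero => simp
  | add x y hx hy => simp only [map_add, hx, hy]
  | tmul p w => rcases i with i | i <;> simp [mulX, superEmbed, embedIdx]

theorem dX_superEmbed (i : SuperIdx m n) (f : SuperPoly m n) :
    dX (m + 1) n (embedIdx i) (superEmbed m n f) = superEmbed m n (dX m n i f) := by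
  induction f using TensorProduct.induction_on with
  | zero => simp
  | add x y hx hy => simp only [map_add, hx, hy]
  | tmul p w => rcases i with i | i <;> simp [dX, superEmbed, embedIdx, pderiv_castSucc_rename]

theorem superRestr_mulX (i : SuperIdx m n) (f : SuperPoly (m + 1) n) :
    superRestr m n (mulX (m + 1) n (embedIdx i) f) = mulX m n i (superRestr m n f) := by
  induction f using TensorProduct.induction_on with
  | zero => simp
  | add x y hx hy => simp only [map_add, hx, hy]
  | tmul p w => rcases i with i | i <;> simp [mulX, superRestr, embedIdx, polyRestr_X_castSucc]

theorem superRestr_dX (i : SuperIdx m n) (f : SuperPoly (m + 1) n) :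
    superRestr m n (dX (m + 1) n (embedIdx i) f) = dX m n i (superRestr m n f) := by
  induction f using TensorProduct.induction_on with
  | zero => simp
  | add x y hx hy => simp only [map_add, hx, hy]
  | tmul p w =>
    rcases i with i | i <;> simp [dX, superRestr, embedIdx, polyRestr_pderiv_castSucc]

theorem mulX_superInteg (i : SuperIdx m n) :
    Commute (mulX (m + 1) n (embedIdx i)) (superInteg m n) := by
  refine LinearMap.ext fun f => ?_
  simp only [Module.End.mul_apply]
  induction f using TensorProduct.induction_on with
  | zero => simp
  | add x y hx hy => simp only [map_add, hx, hy]
  | tmul p w =>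
    rcases i with i | i <;> simp [mulX, superInteg, embedIdx, X_castSucc_mul_polyInteg]

theorem dX_commute_superInteg (i : SuperIdx m n) :
    Commute (dX (m + 1) n (embedIdx i)) (superInteg m n) := by
  refine LinearMap.ext fun f => ?_
  simp only [Module.End.mul_apply]
  induction f using TensorProduct.induction_on with
  | zero => simp
  | add x y hx hy => simp only [map_add, hx, hy]
  | tmul p w =>
    rcases i with i | i <;> simp [dX, superInteg, embedIdx, pderiv_castSucc_polyInteg]

theorem superSign_lastIdx_left (i : SuperIdx (m + 1) n) : superSign (lastIdx m n) i = 1 := by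
  rcases i with i | i <;> rfl

theorem superSign_lastIdx_right (i : SuperIdx (m + 1) n) : superSign i (lastIdx m n) = 1 := by
  rcases i with i | i <;> rfl

theorem embedIdx_ne_lastIdx (i : SuperIdx m n) : embedIdx i ≠ lastIdx m n := by
  rcases i with i | i <;> simp [embedIdx, (Fin.castSucc_lt_last _).ne]

theorem embedIdx_injective : Function.Injective (embedIdx (m := m) (n := n)) :=
  Function.Injective.sumMap (Fin.castSucc_injective m) Function.injective_id

theorem mulX_commute_dX_last (i : SuperIdx m n) :
    Commute (mulX (m + 1) n (embedIdx i)) (dX (m + 1) n (lastIdx m n)) := by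
  have h := dX_mulX (m + 1) n (lastIdx m n) (embedIdx i)
  rw [superSign_lastIdx_left, one_smul, Matrix.one_apply_ne (embedIdx_ne_lastIdx i).symm,
    zero_smul, zero_add] at h
  exact h.symm

theorem dX_commute_dX_last (i : SuperIdx (m + 1) n) :
    Commute (dX (m + 1) n i) (dX (m + 1) n (lastIdx m n)) := by
  have h := dX_dX (m + 1) n i (lastIdx m n)
  rwa [superSign_lastIdx_right, one_smul] at h

theorem sum_superIdx_succ {R : Type*} [AddCommMonoid R] (f : SuperIdx (m + 1) n → R) :
    ∑ i, f i = ∑ i, f (embedIdx i) + f (lastIdx m n) := by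
  simp only [Fintype.sum_sum_type, Fin.sum_univ_castSucc, embedIdx, Sum.map_inl, Sum.map_inr, id]
  exact add_right_comm _ _ _

theorem superGram_embedIdx (i j : SuperIdx m n) :
    superGram (m + 1) n (embedIdx i) (embedIdx j) = superGram m n i j := by
  rcases i with i | i <;> rcases j with j | j <;> simp [superGram, embedIdx, Matrix.one_apply]

theorem superGram_lastIdx_left (i : SuperIdx m n) :
    superGram (m + 1) n (lastIdx m n) (embedIdx i) = 0 := by
  rcases i with i | i <;>
    simp [superGram, embedIdx, (Fin.castSucc_lt_last _).ne']

theorem superGram_lastIdx_right (i : SuperIdx m n) :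
    superGram (m + 1) n (embedIdx i) (lastIdx m n) = 0 := by
  rcases i with i | i <;>
    simp [superGram, embedIdx, (Fin.castSucc_lt_last _).ne]

theorem superMetric_embedIdx (i j : SuperIdx m n) :
    superMetric (m + 1) n (embedIdx i) (embedIdx j) = superMetric m n i j := by
  rcases i with i | i <;> rcases j with j | j <;> simp [superMetric, embedIdx, Matrix.one_apply]

theorem superMetric_lastIdx_left (i : SuperIdx m n) :
    superMetric (m + 1) n (lastIdx m n) (embedIdx i) = 0 := by
  rcases i with i | i <;>
    simp [superMetric, embedIdx, (Fin.castSucc_lt_last _).ne']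

theorem superMetric_lastIdx_right (i : SuperIdx m n) :
    superMetric (m + 1) n (embedIdx i) (lastIdx m n) = 0 := by
  rcases i with i | i <;>
    simp [superMetric, embedIdx, (Fin.castSucc_lt_last _).ne]

variable (m n) in
/-- The super Laplace operator in all variables but the last bosonic one. -/
def transLaplacian : Module.End ℝ (SuperPoly (m + 1) n) :=
  ∑ i, ∑ j, superGram m n j i • (dX (m + 1) n (embedIdx i) * dX (m + 1) n (embedIdx j))

variable (m n) in
/-- Multiplication by `R²`, without the square of the last bosonic variable. -/
def transRSq : Module.End ℝ (SuperPoly (m + 1) n) :=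
  ∑ i, ∑ j, superMetric m n i j • (mulX (m + 1) n (embedIdx i) * mulX (m + 1) n (embedIdx j))

theorem superLaplacian_succ : superLaplacian (m + 1) n =
    transLaplacian m n + dX (m + 1) n (lastIdx m n) * dX (m + 1) n (lastIdx m n) := by
  have h : superGram (m + 1) n (lastIdx m n) (lastIdx m n) = 1 := by simp [superGram]
  rw [superLaplacian_eq, sum_superIdx_succ]
  simp only [sum_superIdx_succ, superGram_embedIdx, superGram_lastIdx_left,
    superGram_lastIdx_right, zero_smul, add_zero, Finset.sum_const_zero, zero_add, h, one_smul,
    transLaplacian]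

theorem superRSq_succ : superRSq (m + 1) n =
    transRSq m n + mulX (m + 1) n (lastIdx m n) * mulX (m + 1) n (lastIdx m n) := by
  have h : superMetric (m + 1) n (lastIdx m n) (lastIdx m n) = 1 := by simp [superMetric]
  rw [superRSq_eq, sum_superIdx_succ]
  simp only [sum_superIdx_succ, superMetric_embedIdx, superMetric_lastIdx_left,
    superMetric_lastIdx_right, zero_smul, add_zero, Finset.sum_const_zero, zero_add, h, one_smul,
    transRSq]

theorem transLaplacian_commute_superInteg : Commute (transLaplacian m n) (superInteg m n) :=
  Commute.sum_left _ _ _ fun i _ => Commute.sum_left _ _ _ fun j _ =>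
    Commute.smul_left ((dX_commute_superInteg i).mul_left (dX_commute_superInteg j)) _

theorem transRSq_commute_dX_last :
    Commute (transRSq m n) (dX (m + 1) n (lastIdx m n)) :=
  Commute.sum_left _ _ _ fun _ _ => Commute.sum_left _ _ _ fun _ _ =>
    Commute.smul_left ((mulX_commute_dX_last _).mul_left (mulX_commute_dX_last _)) _

theorem superEuler_superEmbed (f : SuperPoly m n) :
    superEuler (m + 1) n (superEmbed m n f) = superEmbed m n (superEuler m n f) := by
  rw [superEuler, superEuler, sum_superIdx_succ]
  simp only [LinearMap.add_apply, LinearMap.sum_apply, LinearMap.comp_apply, dX_superEmbed,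
    mulX_superEmbed, dX_last_superEmbed, map_zero, add_zero, map_sum]

theorem superRestr_superEuler (f : SuperPoly (m + 1) n) :
    superRestr m n (superEuler (m + 1) n f) = superEuler m n (superRestr m n f) := by
  rw [superEuler, superEuler, sum_superIdx_succ]
  simp only [LinearMap.add_apply, LinearMap.sum_apply, LinearMap.comp_apply, superRestr_dX,
    superRestr_mulX, superRestr_mulX_last, add_zero, map_sum, map_add]

theorem superEuler_superInteg_apply {c : ℝ} {f : SuperPoly (m + 1) n}
    (hf : superEuler (m + 1) n f = c • f) :
    superEuler (m + 1) n (superInteg m n f) = (c + 1) • superInteg m n f := by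
  -- The integrand is ∂(xf) for the last variable x, and xf has no boundary term at x = 0.
  have h1 : superInteg m n (f + mulX (m + 1) n (lastIdx m n) (dX (m + 1) n (lastIdx m n) f)) =
      mulX (m + 1) n (lastIdx m n) f := by
    have h := superInteg_dX_last (mulX (m + 1) n (lastIdx m n) f)
    have h2 := LinearMap.congr_fun (dX_mulX (m + 1) n (lastIdx m n) (lastIdx m n)) f
    simp only [Module.End.mul_apply, LinearMap.add_apply,
      superSign_lastIdx_left, Matrix.one_apply_eq, one_smul, Module.End.one_apply] at h2
    rwa [superRestr_mulX_last, map_zero, add_zero, h2] at h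
  have h3 (i : SuperIdx m n) (g : SuperPoly (m + 1) n) :
      mulX (m + 1) n (embedIdx i) (dX (m + 1) n (embedIdx i) (superInteg m n g)) =
      superInteg m n (mulX (m + 1) n (embedIdx i) (dX (m + 1) n (embedIdx i) g)) :=
    LinearMap.congr_fun ((mulX_superInteg i).mul_left (dX_commute_superInteg i)).eq g
  rw [superEuler, sum_superIdx_succ] at hf ⊢
  simp only [LinearMap.add_apply, LinearMap.sum_apply, LinearMap.comp_apply, h3,
    dX_last_superInteg, ← map_sum] at hf ⊢
  rw [← h1, ← map_add, add_left_comm, hf, map_add, map_smul]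
  module

/-- No term involves the last variable, since its row and column vanish. Hence the subalgebra
commutes with integration and differentiation in that variable. -/
theorem superAction_ospInclusion (A : osp m n) :
    superAction (m + 1) n (ospInclusion m n A) =
      ∑ i, ∑ j, A.1 i j • (mulX (m + 1) n (embedIdx i) * dX (m + 1) n (embedIdx j)) := by
  have hl (a : SuperIdx m n) : coordInclusion m n (lastIdx m n) a = 0 := by
    rw [coordInclusion, Matrix.of_apply, if_neg]
    exact (embedIdx_ne_lastIdx a).symm
  have he (i a : SuperIdx m n) : coordInclusion m n (embedIdx i) a =
      (1 : Matrix _ _ ℝ) i a := by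
    rw [coordInclusion, Matrix.of_apply, Matrix.one_apply]
    exact if_congr embedIdx_injective.eq_iff rfl rfl
  change ∑ k, ∑ l, (coordInclusion m n * A.1 * (coordInclusion m n)ᵀ) k l •
    (mulX (m + 1) n k * dX (m + 1) n l) = _
  simp only [sum_superIdx_succ, Matrix.mul_apply, Matrix.transpose_apply, hl, he, zero_mul,
    mul_zero, Finset.sum_const_zero, zero_smul, add_zero, Matrix.one_apply, ite_mul, mul_ite,
    one_mul, mul_one, Finset.sum_ite_eq, Finset.mem_univ, if_true]

end LastVariable

/-! ### Harmonic extension of Cauchy data, and injectivity of R². -/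

section HarmonicExtension

variable {m n : ℕ}

theorem superEuler_transLaplacian_apply {c : ℝ} {f : SuperPoly (m + 1) n}
    (hf : superEuler (m + 1) n f = c • f) :
    superEuler (m + 1) n (transLaplacian m n f) = (c - 2) • transLaplacian m n f := by
  simp only [transLaplacian, LinearMap.sum_apply, LinearMap.smul_apply, Module.End.mul_apply,
    map_sum, map_smul, Finset.smul_sum]
  refine Finset.sum_congr rfl fun i _ => Finset.sum_congr rfl fun j _ => ?_
  rw [superEuler_dX_apply _ (superEuler_dX_apply _ hf), smul_comm,
    show c - 1 - 1 = c - 2 by ring]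

/-- Each application lowers the degree by two, and q - 2(q + 1) < 0. This makes the Neumann series
finite. -/
theorem transLaplacian_pow_apply_eq_zero {q : ℕ} {f : SuperPoly (m + 1) n}
    (hf : f ∈ homogPoly (m + 1) n q) : (transLaplacian m n ^ (q + 1)) f = 0 := by
  have h (i : ℕ) : superEuler (m + 1) n ((transLaplacian m n ^ i) f) =
      ((q : ℝ) - 2 * i) • (transLaplacian m n ^ i) f := by
    induction i with
    | zero => simpa using mem_homogPoly_iff.mp hf
    | succ i ih =>
      rw [pow_succ', Module.End.mul_apply, superEuler_transLaplacian_apply ih]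
      congr 1; push_cast; ring
  refine eq_zero_of_superEuler_neg ?_ (h (q + 1))
  push_cast
  linarith [Nat.cast_nonneg (α := ℝ) q]

variable (m n) in
/-- The operator `I² Δ'`, where `I` is integration with respect to the last bosonic variable and
`Δ'` is the Laplace operator in the other variables. -/
def integLaplacian : Module.End ℝ (SuperPoly (m + 1) n) :=
  superInteg m n * superInteg m n * transLaplacian m n

theorem integLaplacian_pow (i : ℕ) : integLaplacian m n ^ i =
    (superInteg m n * superInteg m n) ^ i * transLaplacian m n ^ i :=
  Commute.mul_pow (transLaplacian_commute_superInteg.mul_right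
    transLaplacian_commute_superInteg).symm i

variable (m n) in
/-- The truncated Neumann series `∑_{i ≤ q} (-I² Δ')^i`, which gives the harmonic extension of
Cauchy data on the hyperplane where the last bosonic variable vanishes. -/
def neumannSum (q : ℕ) : Module.End ℝ (SuperPoly (m + 1) n) :=
  ∑ i ∈ Finset.range (q + 1), (-1 : ℝ) ^ i • integLaplacian m n ^ i

theorem superEuler_integLaplacian_pow_apply {c : ℝ} {f : SuperPoly (m + 1) n}
    (hf : superEuler (m + 1) n f = c • f) (i : ℕ) :
    superEuler (m + 1) n ((integLaplacian m n ^ i) f) = c • (integLaplacian m n ^ i) f := by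
  induction i with
  | zero => simpa using hf
  | succ i ih =>
    rw [pow_succ', Module.End.mul_apply]
    have h := superEuler_superInteg_apply
      (superEuler_superInteg_apply (superEuler_transLaplacian_apply ih))
    rw [show c - 2 + 1 + 1 = c by ring] at h
    exact h

theorem superEuler_neumannSum_apply {c : ℝ} {f : SuperPoly (m + 1) n}
    (hf : superEuler (m + 1) n f = c • f) (q : ℕ) :
    superEuler (m + 1) n (neumannSum m n q f) = c • neumannSum m n q f := by
  simp only [neumannSum, LinearMap.sum_apply, LinearMap.smul_apply, map_sum, map_smul,
    superEuler_integLaplacian_pow_apply hf, Finset.smul_sum]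
  exact Finset.sum_congr rfl fun i _ => smul_comm _ _ _

/-- Serves twice: data affine in the last variable are extended to harmonics, and data of the form
I²g give a solution of Δu = g. -/
theorem superLaplacian_neumannSum_apply {q : ℕ} {f : SuperPoly (m + 1) n}
    (hf : f ∈ homogPoly (m + 1) n q) :
    superLaplacian (m + 1) n (neumannSum m n q f) =
      dX (m + 1) n (lastIdx m n) (dX (m + 1) n (lastIdx m n) f) := by
  -- The sum telescopes: ∂² of each term cancels Δ' of the preceding one, leaving ∂²f and Δ' of the
  -- last term.
  have h (p : ℕ) : superLaplacian (m + 1) n (neumannSum m n p f) =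
      dX (m + 1) n (lastIdx m n) (dX (m + 1) n (lastIdx m n) f) +
      (-1 : ℝ) ^ p • transLaplacian m n ((integLaplacian m n ^ p) f) := by
    induction p with
    | zero =>
      simp [neumannSum, superLaplacian_succ, add_comm]
    | succ p ih =>
      have h1 : neumannSum m n (p + 1) f =
          neumannSum m n p f + (-1 : ℝ) ^ (p + 1) • (integLaplacian m n ^ (p + 1)) f := by
        rw [neumannSum, Finset.sum_range_succ]; rfl
      have h2 : dX (m + 1) n (lastIdx m n) (dX (m + 1) n (lastIdx m n)
          ((integLaplacian m n ^ (p + 1)) f)) =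
          transLaplacian m n ((integLaplacian m n ^ p) f) := by
        rw [pow_succ', integLaplacian]
        simp only [Module.End.mul_apply, dX_last_superInteg]
      rw [h1, map_add, ih, map_smul]
      rw [superLaplacian_succ]
      rw [LinearMap.add_apply, Module.End.mul_apply, h2]
      module
  -- The remainder contains Δ' to the power q + 1, once Δ' is moved past the integrations, so it
  -- vanishes.
  rw [h, integLaplacian_pow, Module.End.mul_apply]
  have h3 := LinearMap.congr_fun ((transLaplacian_commute_superInteg.mul_right
    transLaplacian_commute_superInteg).pow_right q).eq ((transLaplacian m n ^ q) f)
  simp only [Module.End.mul_apply] at h3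
  rw [h3, ← Module.End.mul_apply (transLaplacian m n), ← pow_succ',
    transLaplacian_pow_apply_eq_zero hf, map_zero, smul_zero, add_zero]

/-- Corrections in the image of I² have zero Cauchy data, so the Neumann sum changes neither the
value nor the normal derivative on the hyperplane. -/
theorem neumannSum_apply_eq_add_superInteg (q : ℕ) (f : SuperPoly (m + 1) n) :
    ∃ g, neumannSum m n q f = f + superInteg m n (superInteg m n g) := by
  induction q with
  | zero => exact ⟨0, by simp [neumannSum]⟩
  | succ q ih =>
    obtain ⟨g, hg⟩ := ih
    refine ⟨g + (-1 : ℝ) ^ (q + 1) • transLaplacian m n ((integLaplacian m n ^ q) f), ?_⟩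
    have h1 : neumannSum m n (q + 1) f =
        neumannSum m n q f + (-1 : ℝ) ^ (q + 1) • (integLaplacian m n ^ (q + 1)) f := by
      rw [neumannSum, Finset.sum_range_succ]; rfl
    rw [h1, hg, map_add, map_add, map_smul, map_smul, add_assoc, pow_succ' (integLaplacian m n)]
    rfl

theorem superRestr_neumannSum (q : ℕ) (f : SuperPoly (m + 1) n) :
    superRestr m n (neumannSum m n q f) = superRestr m n f := by
  obtain ⟨g, hg⟩ := neumannSum_apply_eq_add_superInteg q f
  rw [hg, map_add, superRestr_superInteg, add_zero]

theorem superRestr_dX_last_neumannSum (q : ℕ) (f : SuperPoly (m + 1) n) :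
    superRestr m n (dX (m + 1) n (lastIdx m n) (neumannSum m n q f)) =
      superRestr m n (dX (m + 1) n (lastIdx m n) f) := by
  obtain ⟨g, hg⟩ := neumannSum_apply_eq_add_superInteg q f
  rw [hg, map_add, map_add, dX_last_superInteg, superRestr_superInteg, add_zero]

/-- Uniqueness in the Cauchy problem: without boundary terms f = I²∂²f = -I²Δ'f, and iterating q + 1
times gives zero. -/
theorem eq_zero_of_mem_harmonics_of_superRestr {q : ℕ} {f : SuperPoly (m + 1) n}
    (hf : f ∈ harmonics (m + 1) n q) (h0 : superRestr m n f = 0)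
    (h1 : superRestr m n (dX (m + 1) n (lastIdx m n) f) = 0) : f = 0 := by
  have e0 := superInteg_dX_last f
  have e1 := superInteg_dX_last (dX (m + 1) n (lastIdx m n) f)
  rw [h0, map_zero, add_zero] at e0
  rw [h1, map_zero, add_zero] at e1
  have e2 := (mem_harmonics_iff.mp hf).1
  rw [superLaplacian_succ, LinearMap.add_apply, Module.End.mul_apply] at e2
  have e3 : f = (-1 : ℝ) • integLaplacian m n f := by
    have e5 : transLaplacian m n f =
        (-1 : ℝ) • dX (m + 1) n (lastIdx m n) (dX (m + 1) n (lastIdx m n) f) := by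
      rw [eq_neg_of_add_eq_zero_left e2]; module
    rw [integLaplacian, Module.End.mul_apply, Module.End.mul_apply, e5, map_smul, map_smul, e1, e0]
    module
  have e4 (i : ℕ) : f = (-1 : ℝ) ^ i • (integLaplacian m n ^ i) f := by
    induction i with
    | zero => simp
    | succ i ih =>
      rw [pow_succ, pow_succ, Module.End.mul_apply, mul_smul, ← map_smul, ← map_smul]
      nth_rewrite 1 [ih]
      rw [← map_smul, e3.symm]
  rw [e4 (q + 1), integLaplacian_pow, Module.End.mul_apply,
    transLaplacian_pow_apply_eq_zero hf.2, map_zero, smul_zero]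

theorem dX_last_pow_mulX_last (a : ℕ) :
    dX (m + 1) n (lastIdx m n) ^ (a + 1) * mulX (m + 1) n (lastIdx m n) =
      mulX (m + 1) n (lastIdx m n) * dX (m + 1) n (lastIdx m n) ^ (a + 1) +
        (a + 1 : ℝ) • dX (m + 1) n (lastIdx m n) ^ a := by
  have h := dX_mulX (m + 1) n (lastIdx m n) (lastIdx m n)
  rw [superSign_lastIdx_left, Matrix.one_apply_eq, one_smul, one_smul] at h
  induction a with
  | zero => simp [h, add_comm]
  | succ a ih =>
    rw [pow_succ', mul_assoc, ih, mul_add, ← mul_assoc, h, add_mul, one_mul, mul_smul_comm,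
      ← pow_succ', mul_assoc, ← pow_succ']
    push_cast
    module

/-- A bosonic variable x is available, and the x² in R² raises the top power of x in f without being
cancelled by the other terms. In terms of derivatives: if ∂^{a+1}f = 0, then applying ∂^{a+2} to R²f
leaves (a + 2)(a + 1)∂^a f. -/
theorem eq_zero_of_superRSq_apply_eq_zero {q : ℕ} {f : SuperPoly (m + 1) n}
    (hf : f ∈ homogPoly (m + 1) n q) (h : superRSq (m + 1) n f = 0) : f = 0 := by
  have hd (a : ℕ) : superEuler (m + 1) n ((dX (m + 1) n (lastIdx m n) ^ a) f) =
      ((q : ℝ) - a) • (dX (m + 1) n (lastIdx m n) ^ a) f := by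
    induction a with
    | zero => simpa using mem_homogPoly_iff.mp hf
    | succ a ih =>
      rw [pow_succ', Module.End.mul_apply, superEuler_dX_apply _ ih]
      congr 1; push_cast; ring
  have h0 : (dX (m + 1) n (lastIdx m n) ^ (q + 1)) f = 0 := by
    refine eq_zero_of_superEuler_neg ?_ (hd (q + 1))
    push_cast; linarith
  have hstep (a : ℕ) (ha : (dX (m + 1) n (lastIdx m n) ^ (a + 1)) f = 0) :
      (dX (m + 1) n (lastIdx m n) ^ a) f = 0 := by
    have h2 : (dX (m + 1) n (lastIdx m n) ^ (a + 2)) f = 0 := by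
      rw [pow_succ', Module.End.mul_apply, ha, map_zero]
    have h3 := congrArg (dX (m + 1) n (lastIdx m n) ^ (a + 2)) h
    have h4 := LinearMap.congr_fun (transRSq_commute_dX_last (m := m) (n := n)
      |>.pow_right (a + 2)).eq f
    have h5 := LinearMap.congr_fun (dX_last_pow_mulX_last (m := m) (n := n) (a + 1))
      (mulX (m + 1) n (lastIdx m n) f)
    have h6 := LinearMap.congr_fun (dX_last_pow_mulX_last (m := m) (n := n) (a + 1)) f
    have h7 := LinearMap.congr_fun (dX_last_pow_mulX_last (m := m) (n := n) a) f
    simp only [Module.End.mul_apply, LinearMap.add_apply, LinearMap.smul_apply] at h4 h5 h6 h7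
    rw [superRSq_succ, LinearMap.add_apply, map_add, Module.End.mul_apply, ← h4, h2, h5, h6, h7,
      h2, ha] at h3
    simp only [map_zero, smul_zero, zero_add, smul_smul, add_zero] at h3
    refine (smul_eq_zero.mp h3).resolve_left ?_
    positivity
  have hall (a : ℕ) : (dX (m + 1) n (lastIdx m n) ^ a) f = 0 → f = 0 := by
    induction a with
    | zero => exact fun h => h
    | succ a ih => exact fun h => ih (hstep a h)
  exact hall _ h0

theorem eq_zero_of_superRSq_pow_apply_eq_zero {q : ℕ} {f : SuperPoly (m + 1) n}
    (hf : f ∈ homogPoly (m + 1) n q) {i : ℕ} (h : (superRSq (m + 1) n ^ i) f = 0) : f = 0 := by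
  induction i with
  | zero => exact h
  | succ i ih =>
    refine ih (eq_zero_of_superRSq_apply_eq_zero (q := q + 2 * i) ?_
      (by rwa [pow_succ', Module.End.mul_apply] at h))
    rw [mem_homogPoly_iff, superEuler_superRSq_pow_apply (mem_homogPoly_iff.mp hf)]
    push_cast; rfl

end HarmonicExtension

/-! ### Fischer decomposition in odd superdimension. -/

section Fischer

variable {m n : ℕ}

variable (m n) in
/-- The sum `∑ R^{d-ℓ} h_ℓ` over the `ℓ ≤ d` of the parity of `d`. -/
def fischerSum (d : ℕ) (h : ℕ → SuperPoly m n) : SuperPoly m n :=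
  ∑ ℓ ∈ Finset.range (d + 1),
    if (d - ℓ) % 2 = 0 then (superRSq m n ^ ((d - ℓ) / 2)) (h ℓ) else 0

theorem fischerSum_add_two (d : ℕ) (h : ℕ → SuperPoly m n) :
    fischerSum m n (d + 2) h = superRSq m n (fischerSum m n d h) + h (d + 2) := by
  rw [fischerSum, Finset.sum_range_succ, Finset.sum_range_succ, if_neg (by omega),
    if_pos (by omega), add_zero, fischerSum, map_sum]
  simp only [Nat.sub_self, Nat.zero_div, pow_zero, Module.End.one_apply]
  congr 1
  refine Finset.sum_congr rfl fun ℓ hℓ => ?_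
  have hl : ℓ ≤ d := by simpa [Nat.lt_succ_iff] using hℓ
  rw [show (d + 2 - ℓ) % 2 = (d - ℓ) % 2 by omega,
    show (d + 2 - ℓ) / 2 = (d - ℓ) / 2 + 1 by omega]
  split_ifs
  · rw [pow_succ', Module.End.mul_apply]
  · rw [map_zero]

/-- ΔR² is diagonal with respect to the Fischer decomposition; the eigenvalues come from
`superLaplacian_superRSq_pow_apply` with Δh_ℓ = 0. -/
theorem superLaplacian_superRSq_fischerSum (d : ℕ) {h : ℕ → SuperPoly m n}
    (hh : ∀ ℓ, h ℓ ∈ harmonics m n ℓ) :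
    superLaplacian m n (superRSq m n (fischerSum m n d h)) = fischerSum m n d fun ℓ =>
      (2 * (((d - ℓ) / 2 : ℕ) + 1) * (2 * ((d - ℓ) / 2 : ℕ) + 2 * ℓ + superdim m n) : ℝ) • h ℓ := by
  simp only [fischerSum, map_sum]
  refine Finset.sum_congr rfl fun ℓ _ => ?_
  split_ifs
  · obtain ⟨h1, h2⟩ := mem_harmonics_iff.mp (hh ℓ)
    rw [← Module.End.mul_apply (superRSq m n), ← pow_succ', superLaplacian_superRSq_pow_apply h2,
      h1, map_zero, zero_add, map_smul]
  · simp

theorem fischer_coeff_ne_zero (hM : Odd (superdim m n)) (j ℓ : ℕ) :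
    (2 * ((j : ℝ) + 1) * (2 * j + 2 * ℓ + superdim m n) : ℝ) ≠ 0 := by
  refine mul_ne_zero (by positivity) ?_
  obtain ⟨t, ht⟩ := hM
  rw [ht]
  intro h
  have h' : 2 * (j : ℤ) + 2 * ℓ + (2 * t + 1) = 0 := by exact_mod_cast h
  omega

theorem eq_zero_of_superLaplacian_apply {q : ℕ} (hq : q < 2) {f : SuperPoly m n}
    (hf : f ∈ homogPoly m n q) : superLaplacian m n f = 0 := by
  refine eq_zero_of_superEuler_neg ?_ (superEuler_superLaplacian_apply (mem_homogPoly_iff.mp hf))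
  have : (q : ℝ) < 2 := by exact_mod_cast hq
  linarith

/-- Decompose Δf in degree two lower and invert ΔR² componentwise to find g with ΔR²g = Δf. Then f -
R²g is harmonic and supplies the top component. -/
theorem exists_fischerSum_eq (hM : Odd (superdim m n)) (d : ℕ) {f : SuperPoly m n}
    (hf : f ∈ homogPoly m n d) :
    ∃ h : ℕ → SuperPoly m n, (∀ ℓ, h ℓ ∈ harmonics m n ℓ) ∧ fischerSum m n d h = f := by
  induction d using Nat.twoStepInduction generalizing f with
  | zero =>
    refine ⟨Pi.single 0 f, fun ℓ => ?_, by simp [fischerSum]⟩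
    by_cases hℓ : ℓ = 0
    · subst hℓ
      rw [Pi.single_eq_same]
      exact ⟨eq_zero_of_superLaplacian_apply (by norm_num) hf, hf⟩
    · rw [Pi.single_eq_of_ne hℓ]; exact Submodule.zero_mem _
  | one =>
    refine ⟨Pi.single 1 f, fun ℓ => ?_, by simp [fischerSum, Finset.sum_range_succ]⟩
    by_cases hℓ : ℓ = 1
    · subst hℓ
      rw [Pi.single_eq_same]
      exact ⟨eq_zero_of_superLaplacian_apply (by norm_num) hf, hf⟩
    · rw [Pi.single_eq_of_ne hℓ]; exact Submodule.zero_mem _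
  | more d ih _ =>
    have hL : superLaplacian m n f ∈ homogPoly m n d := by
      rw [mem_homogPoly_iff, superEuler_superLaplacian_apply (mem_homogPoly_iff.mp hf)]
      congr 1; push_cast; ring
    obtain ⟨h, hh, hs⟩ := ih hL
    let c : ℕ → ℝ := fun ℓ =>
      2 * (((d - ℓ) / 2 : ℕ) + 1) * (2 * ((d - ℓ) / 2 : ℕ) + 2 * ℓ + superdim m n)
    have hc (ℓ : ℕ) : c ℓ ≠ 0 := fischer_coeff_ne_zero hM _ _
    let g : ℕ → SuperPoly m n := fun ℓ => (c ℓ)⁻¹ • h ℓ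
    have hg (ℓ : ℕ) : g ℓ ∈ harmonics m n ℓ := Submodule.smul_mem _ _ (hh ℓ)
    have hgs : superLaplacian m n (superRSq m n (fischerSum m n d g)) = superLaplacian m n f := by
      rw [superLaplacian_superRSq_fischerSum d hg, ← hs]
      congr 1
      funext ℓ
      exact smul_inv_smul₀ (hc ℓ) (h ℓ)
    have hgd : superRSq m n (fischerSum m n d g) ∈ homogPoly m n (d + 2) := by
      rw [fischerSum, map_sum]
      refine Submodule.sum_mem _ fun ℓ hℓ => ?_
      have hl : ℓ ≤ d := by simpa [Nat.lt_succ_iff] using hℓ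
      split_ifs with hp
      · rw [← Module.End.mul_apply (superRSq m n), ← pow_succ', mem_homogPoly_iff,
          superEuler_superRSq_pow_apply (mem_harmonics_iff.mp (hg ℓ)).2]
        congr 1
        have : ℓ + 2 * ((d - ℓ) / 2 + 1) = d + 2 := by omega
        exact_mod_cast this
      · rw [map_zero]; exact Submodule.zero_mem _
    refine ⟨Function.update g (d + 2)
      (f + (-1 : ℝ) • superRSq m n (fischerSum m n d g)), fun ℓ => ?_, ?_⟩
    · by_cases hℓ : ℓ = d + 2
      · subst hℓ
        rw [Function.update_self]
        refine ⟨?_, Submodule.add_mem _ hf (Submodule.smul_mem _ _ hgd)⟩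
        change superLaplacian m n _ = 0
        rw [map_add, map_smul, hgs]
        module
      · rw [Function.update_of_ne hℓ]; exact hg ℓ
    · rw [fischerSum_add_two, Function.update_self]
      have : fischerSum m n d (Function.update g (d + 2)
          (f + (-1 : ℝ) • superRSq m n (fischerSum m n d g))) = fischerSum m n d g := by
        refine Finset.sum_congr rfl fun ℓ hℓ => ?_
        have hl : ℓ ≤ d := by simpa [Nat.lt_succ_iff] using hℓ
        rw [Function.update_of_ne (by omega)]
      rw [this]
      module

/-- Δ kills the top component and multiplies the others by nonzero scalars, which leaves a vanishing
Fischer sum of degree two lower. -/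
theorem eq_zero_of_fischerSum_eq_zero (hM : Odd (superdim m n)) (d : ℕ) {h : ℕ → SuperPoly m n}
    (hh : ∀ ℓ, h ℓ ∈ harmonics m n ℓ) (hs : fischerSum m n d h = 0) {ℓ : ℕ} (hℓ : ℓ ≤ d)
    (hp : (d - ℓ) % 2 = 0) : h ℓ = 0 := by
  induction d using Nat.twoStepInduction generalizing h ℓ with
  | zero =>
    obtain rfl : ℓ = 0 := by omega
    simpa [fischerSum] using hs
  | one =>
    obtain rfl : ℓ = 1 := by omega
    simpa [fischerSum, Finset.sum_range_succ] using hs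
  | more d ih _ =>
    have hL := congrArg (superLaplacian m n) hs
    rw [fischerSum_add_two, map_add, superLaplacian_superRSq_fischerSum d hh,
      (mem_harmonics_iff.mp (hh _)).1, add_zero, map_zero] at hL
    have h0 : ∀ ℓ ≤ d, (d - ℓ) % 2 = 0 → h ℓ = 0 := fun ℓ hℓ hp =>
      (smul_eq_zero.mp (ih (fun ℓ => Submodule.smul_mem _ _ (hh ℓ)) hL hℓ hp)).resolve_left
        (fischer_coeff_ne_zero hM _ _)
    by_cases hd : ℓ = d + 2
    · subst hd
      have h1 : fischerSum m n d h = 0 := Finset.sum_eq_zero fun ℓ hℓ => by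
        split_ifs with hp
        · rw [h0 ℓ (by simpa [Nat.lt_succ_iff] using hℓ) hp, map_zero]
        · rfl
      rwa [fischerSum_add_two, h1, map_zero, zero_add] at hs
    · exact h0 ℓ (by omega) (by omega)

end Fischer

/-! ### Branching of harmonics to the hyperplane. -/

section Branching

variable {m n : ℕ}

variable (m n) in
/-- The embedding of the harmonics of degree `ℓ` on `ℝ^{m|2n}` into those of degree `q` on
`ℝ^{m+1|2n}`. -/
def harmonicExt (q ℓ : ℕ) : SuperPoly m n →ₗ[ℝ] SuperPoly (m + 1) n :=
  neumannSum m n q ∘ₗ (superInteg m n ^ ((q - ℓ) % 2)) ∘ₗ superEmbed m n ∘ₗ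
    (superRSq m n ^ ((q - ℓ) / 2))

theorem harmonicExt_of_even {q ℓ : ℕ} (h : (q - ℓ) % 2 = 0) (f : SuperPoly m n) :
    harmonicExt m n q ℓ f =
      neumannSum m n q (superEmbed m n ((superRSq m n ^ ((q - ℓ) / 2)) f)) := by
  simp [harmonicExt, h]

theorem harmonicExt_of_odd {q ℓ : ℕ} (h : ¬(q - ℓ) % 2 = 0) (f : SuperPoly m n) :
    harmonicExt m n q ℓ f = neumannSum m n q
      (superInteg m n (superEmbed m n ((superRSq m n ^ ((q - ℓ) / 2)) f))) := by
  simp [harmonicExt, show (q - ℓ) % 2 = 1 by omega]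

theorem superRestr_harmonicExt (q ℓ : ℕ) (f : SuperPoly m n) :
    superRestr m n (harmonicExt m n q ℓ f) =
      if (q - ℓ) % 2 = 0 then (superRSq m n ^ ((q - ℓ) / 2)) f else 0 := by
  split_ifs with h
  · rw [harmonicExt_of_even h, superRestr_neumannSum, superRestr_superEmbed]
  · rw [harmonicExt_of_odd h, superRestr_neumannSum, superRestr_superInteg]

theorem superRestr_dX_last_harmonicExt (q ℓ : ℕ) (f : SuperPoly m n) :
    superRestr m n (dX (m + 1) n (lastIdx m n) (harmonicExt m n q ℓ f)) =
      if (q - ℓ) % 2 = 0 then 0 else (superRSq m n ^ ((q - ℓ) / 2)) f := by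
  split_ifs with h
  · rw [harmonicExt_of_even h, superRestr_dX_last_neumannSum, dX_last_superEmbed, map_zero]
  · rw [harmonicExt_of_odd h, superRestr_dX_last_neumannSum, dX_last_superInteg,
      superRestr_superEmbed]

theorem neumannSum_mem_harmonics {q : ℕ} {f : SuperPoly (m + 1) n}
    (hf : f ∈ homogPoly (m + 1) n q)
    (h : dX (m + 1) n (lastIdx m n) (dX (m + 1) n (lastIdx m n) f) = 0) :
    neumannSum m n q f ∈ harmonics (m + 1) n q := by
  rw [mem_harmonics_iff, superLaplacian_neumannSum_apply hf]
  exact ⟨h, superEuler_neumannSum_apply (mem_homogPoly_iff.mp hf) q⟩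

theorem superEmbed_mem_homogPoly {q : ℕ} {f : SuperPoly m n} (hf : f ∈ homogPoly m n q) :
    superEmbed m n f ∈ homogPoly (m + 1) n q := by
  rw [mem_homogPoly_iff] at hf ⊢
  rw [superEuler_superEmbed, hf, map_smul]

theorem superRSq_pow_mem_homogPoly {q : ℕ} {f : SuperPoly m n} (hf : f ∈ homogPoly m n q) (i : ℕ) :
    (superRSq m n ^ i) f ∈ homogPoly m n (q + 2 * i) := by
  rw [mem_homogPoly_iff, superEuler_superRSq_pow_apply (mem_homogPoly_iff.mp hf)]
  push_cast; rfl

theorem superInteg_mem_homogPoly {q : ℕ} {f : SuperPoly (m + 1) n}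
    (hf : f ∈ homogPoly (m + 1) n q) : superInteg m n f ∈ homogPoly (m + 1) n (q + 1) := by
  rw [mem_homogPoly_iff, superEuler_superInteg_apply (mem_homogPoly_iff.mp hf)]
  push_cast; rfl

theorem harmonicExt_mem_harmonics {q ℓ : ℕ} (hℓ : ℓ ≤ q) {f : SuperPoly m n}
    (hf : f ∈ harmonics m n ℓ) : harmonicExt m n q ℓ f ∈ harmonics (m + 1) n q := by
  have h1 := superEmbed_mem_homogPoly (superRSq_pow_mem_homogPoly hf.2 ((q - ℓ) / 2))
  by_cases h : (q - ℓ) % 2 = 0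
  · rw [harmonicExt_of_even h]
    rw [show ℓ + 2 * ((q - ℓ) / 2) = q by omega] at h1
    exact neumannSum_mem_harmonics h1 (by rw [dX_last_superEmbed, map_zero])
  · rw [harmonicExt_of_odd h]
    have h2 := superInteg_mem_homogPoly h1
    rw [show ℓ + 2 * ((q - ℓ) / 2) + 1 = q by omega] at h2
    exact neumannSum_mem_harmonics h2 (by rw [dX_last_superInteg, dX_last_superEmbed])

/-- Normal derivatives on the hyperplane have degree one less, so the components of opposite parity
form a Fischer sum there. -/
theorem sum_ite_odd_eq_fischerSum (q : ℕ) (h : ℕ → SuperPoly m n) :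
    ∑ ℓ ∈ Finset.range (q + 2), (if (q + 1 - ℓ) % 2 = 0 then 0 else
      (superRSq m n ^ ((q + 1 - ℓ) / 2)) (h ℓ)) = fischerSum m n q h := by
  rw [Finset.sum_range_succ, if_pos (by omega), add_zero]
  refine Finset.sum_congr rfl fun ℓ hℓ => ?_
  have hl : ℓ ≤ q := by simpa [Nat.lt_succ_iff] using hℓ
  split_ifs with h1 h2 h2
  · omega
  · rfl
  · rw [show (q + 1 - ℓ) / 2 = (q - ℓ) / 2 by omega]
  · omega

/-- Components with q - ℓ even are read off from the value on the hyperplane, those with q - ℓ odd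
from the normal derivative; Fischer uniqueness treats each. -/
theorem eq_zero_of_sum_harmonicExt_eq_zero (hM : Odd (superdim m n)) {q : ℕ}
    {h : ℕ → SuperPoly m n} (hh : ∀ ℓ, h ℓ ∈ harmonics m n ℓ)
    (hs : ∑ ℓ ∈ Finset.range (q + 1), harmonicExt m n q ℓ (h ℓ) = 0) {ℓ : ℕ} (hℓ : ℓ ≤ q) :
    h ℓ = 0 := by
  by_cases hp : (q - ℓ) % 2 = 0
  · have h1 := congrArg (superRestr m n) hs
    simp only [map_sum, superRestr_harmonicExt, map_zero] at h1
    exact eq_zero_of_fischerSum_eq_zero hM q hh h1 hℓ hp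
  · obtain ⟨q, rfl⟩ : ∃ p, q = p + 1 := ⟨q - 1, by omega⟩
    have h1 := congrArg (superRestr m n ∘ₗ dX (m + 1) n (lastIdx m n)) hs
    simp only [map_sum, LinearMap.comp_apply, superRestr_dX_last_harmonicExt, map_zero] at h1
    rw [sum_ite_odd_eq_fischerSum] at h1
    exact eq_zero_of_fischerSum_eq_zero hM q hh h1 (by omega) (by omega)

theorem exists_sum_harmonicExt_eq (hM : Odd (superdim m n)) {q : ℕ} {f : SuperPoly (m + 1) n}
    (hf : f ∈ harmonics (m + 1) n q) :
    ∃ h : ℕ → SuperPoly m n, (∀ ℓ, h ℓ ∈ harmonics m n ℓ) ∧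
      ∑ ℓ ∈ Finset.range (q + 1), harmonicExt m n q ℓ (h ℓ) = f := by
  have hE := (mem_harmonics_iff.mp hf).2
  have hf0 : superRestr m n f ∈ homogPoly m n q := by
    rw [mem_homogPoly_iff, ← superRestr_superEuler, hE, map_smul]
  obtain ⟨h0, hh0, hs0⟩ := exists_fischerSum_eq hM q hf0
  have hf1 : ∃ h1 : ℕ → SuperPoly m n, (∀ ℓ, h1 ℓ ∈ harmonics m n ℓ) ∧
      ∑ ℓ ∈ Finset.range (q + 1), (if (q - ℓ) % 2 = 0 then 0 else
        (superRSq m n ^ ((q - ℓ) / 2)) (h1 ℓ)) =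
      superRestr m n (dX (m + 1) n (lastIdx m n) f) := by
    have hE1 := superEuler_dX_apply (lastIdx m n) hE
    cases q with
    | zero =>
      refine ⟨0, fun ℓ => Submodule.zero_mem _, ?_⟩
      -- In degree zero the normal derivative has degree -1.
      rw [eq_zero_of_superEuler_neg (by norm_num) hE1]
      simp
    | succ q =>
      have hd : superRestr m n (dX (m + 1) n (lastIdx m n) f) ∈ homogPoly m n q := by
        rw [mem_homogPoly_iff, ← superRestr_superEuler, hE1, map_smul]
        congr 1; push_cast; ring
      obtain ⟨h1, hh1, hs1⟩ := exists_fischerSum_eq hM q hd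
      exact ⟨h1, hh1, (sum_ite_odd_eq_fischerSum q h1).trans hs1⟩
  obtain ⟨h1, hh1, hs1⟩ := hf1
  -- The two Fischer decompositions use complementary parities of ℓ, so they merge into one family.
  let h : ℕ → SuperPoly m n := fun ℓ => if (q - ℓ) % 2 = 0 then h0 ℓ else h1 ℓ
  have hh (ℓ : ℕ) : h ℓ ∈ harmonics m n ℓ := by
    by_cases hp : (q - ℓ) % 2 = 0
    · simp only [h, if_pos hp]; exact hh0 ℓ
    · simp only [h, if_neg hp]; exact hh1 ℓ
  refine ⟨h, hh, ?_⟩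
  have hsm : ∑ ℓ ∈ Finset.range (q + 1), harmonicExt m n q ℓ (h ℓ) ∈ harmonics (m + 1) n q :=
    Submodule.sum_mem _ fun ℓ hℓ =>
      harmonicExt_mem_harmonics (by simpa [Nat.lt_succ_iff] using hℓ) (hh ℓ)
  have e0 : superRestr m n (∑ ℓ ∈ Finset.range (q + 1), harmonicExt m n q ℓ (h ℓ)) =
      superRestr m n f := by
    rw [← hs0, map_sum]
    refine Finset.sum_congr rfl fun ℓ _ => ?_
    rw [superRestr_harmonicExt]
    split_ifs with hp
    · simp only [h, if_pos hp]
    · rfl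
  have e1 : superRestr m n (dX (m + 1) n (lastIdx m n)
      (∑ ℓ ∈ Finset.range (q + 1), harmonicExt m n q ℓ (h ℓ))) =
      superRestr m n (dX (m + 1) n (lastIdx m n) f) := by
    rw [← hs1, map_sum, map_sum]
    refine Finset.sum_congr rfl fun ℓ _ => ?_
    rw [superRestr_dX_last_harmonicExt]
    split_ifs with hp
    · rfl
    · simp only [h, if_neg hp]
  -- The sum and f are harmonics with the same Cauchy data.
  have hz := eq_zero_of_mem_harmonics_of_superRestr
    (Submodule.add_mem _ hsm (Submodule.smul_mem _ (-1 : ℝ) hf))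
    (by rw [map_add, map_smul, e0]; module)
    (by rw [map_add, map_add, map_smul, map_smul, e1]; module)
  rw [neg_one_smul] at hz
  exact add_neg_eq_zero.mp hz

end Branching

/-! ### Generalized harmonics as an extension of ℋ_{k'} by ℋ_k. -/

section GeneralizedHarmonics

variable {m n : ℕ}

/-- If `M = -2(t + k')`, the harmonics divisible by `R²` of degree `2t + 2 + k'` are
`R^{2t+2} ℋ_{k'}`. -/
theorem exists_eq_superRSq_pow {t k' : ℕ} (hM : superdim (m + 1) n = -2 * ((t + k' : ℕ) : ℤ))
    {g : SuperPoly (m + 1) n} (hg : g ∈ homogPoly (m + 1) n (2 * t + k'))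
    (h : superLaplacian (m + 1) n (superRSq (m + 1) n g) = 0) :
    ∃ f ∈ harmonics (m + 1) n k', g = (superRSq (m + 1) n ^ t) f := by
  have hMR : (superdim (m + 1) n : ℝ) = -2 * (t + k') := by rw [hM]; push_cast; ring
  -- If g = R^{2i}f, then ΔR²g = R^{2i}(R²Δf + cf) with c = 2(i+1)(2i + 2 deg f + M) = 4(i+1)(t-i),
  -- and R^{2i} can be cancelled.
  have hL (i : ℕ) (f : SuperPoly (m + 1) n) (hf : f ∈ homogPoly (m + 1) n (2 * (t - i) + k'))
      (hi : i ≤ t) (hgf : g = (superRSq (m + 1) n ^ i) f) :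
      superRSq (m + 1) n (superLaplacian (m + 1) n f) + (4 * (i + 1) * (t - i) : ℝ) • f = 0 := by
    have hE := mem_homogPoly_iff.mp hf
    have h1 := superLaplacian_superRSq_pow_apply hE i
    rw [pow_succ', Module.End.mul_apply, ← hgf, h] at h1
    have hd : superRSq (m + 1) n (superLaplacian (m + 1) n f) + (4 * (i + 1) * (t - i) : ℝ) • f ∈
        homogPoly (m + 1) n (2 * (t - i) + k') := by
      refine Submodule.add_mem _ ?_ (Submodule.smul_mem _ _ hf)
      rw [mem_homogPoly_iff,
        superEuler_superRSq_apply (superEuler_superLaplacian_apply hE)]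
      congr 1; ring
    refine eq_zero_of_superRSq_pow_apply_eq_zero hd (i := i) ?_
    rw [map_add, map_smul, ← Module.End.mul_apply, ← pow_succ, h1, pow_succ']
    congr 2
    · rw [hMR]
      push_cast [Nat.cast_sub hi]
      ring
    · exact hgf.symm
  have hex (i : ℕ) (hi : i ≤ t) : ∃ f ∈ homogPoly (m + 1) n (2 * (t - i) + k'),
      g = (superRSq (m + 1) n ^ i) f := by
    induction i with
    | zero => exact ⟨g, by simpa using hg, by simp⟩
    | succ i ih =>
      obtain ⟨f, hf, hgf⟩ := ih (by omega)
      have h2 := hL i f hf (by omega) hgf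
      -- As long as i < t, `hL` can be solved for f, which splits off another factor R².
      have hc : (4 * (i + 1) * (t - i) : ℝ) ≠ 0 := by
        have : (i : ℝ) < t := by exact_mod_cast hi
        have : (t - i : ℝ) ≠ 0 := by linarith
        positivity
      refine ⟨(-(4 * (i + 1) * (t - i) : ℝ)⁻¹) • superLaplacian (m + 1) n f,
        Submodule.smul_mem _ _ ?_, ?_⟩
      · rw [mem_homogPoly_iff, superEuler_superLaplacian_apply (mem_homogPoly_iff.mp hf)]
        congr 1
        have : 2 * (t - i) + k' = 2 * (t - (i + 1)) + k' + 2 := by omega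
        rw [this]; push_cast; ring
      · have h3 : f = (-(4 * (i + 1) * (t - i) : ℝ)⁻¹) •
            superRSq (m + 1) n (superLaplacian (m + 1) n f) := by
          rw [eq_neg_of_add_eq_zero_left h2, smul_neg, smul_smul, neg_mul, inv_mul_cancel₀ hc]
          module
        rw [hgf, map_smul, pow_succ, Module.End.mul_apply, ← map_smul, ← h3]
  obtain ⟨f, hf, hgf⟩ := hex t le_rfl
  -- At i = t the scalar is zero, so R²Δf = 0 and injectivity of R² makes f harmonic.
  have h2 := hL t f hf le_rfl hgf
  rw [sub_self, mul_zero, zero_smul, add_zero] at h2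
  have hf' : f ∈ homogPoly (m + 1) n k' := by simpa using hf
  refine ⟨f, ⟨?_, hf'⟩, hgf⟩
  by_cases hk : k' < 2
  · exact eq_zero_of_superLaplacian_apply hk hf'
  · refine eq_zero_of_superRSq_apply_eq_zero (q := k' - 2) ?_ h2
    rw [mem_homogPoly_iff, superEuler_superLaplacian_apply (mem_homogPoly_iff.mp hf')]
    congr 1; push_cast [Nat.cast_sub (not_lt.mp hk)]; ring

variable (m n) in
/-- The map `C I² R^{2t}`, where `I` is integration with respect to the last bosonic variable and
`C` corrects by elements without Cauchy data; `Δ` maps it to `R^{2t}`. -/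
def laplacianLift (t k' : ℕ) : Module.End ℝ (SuperPoly (m + 1) n) :=
  neumannSum m n (2 * t + 2 + k') * (superInteg m n * superInteg m n) * superRSq (m + 1) n ^ t

/-- The Laplacian of a Neumann sum is ∂² of its argument, and this undoes the two integrations. -/
theorem superLaplacian_laplacianLift {t k' : ℕ} {f : SuperPoly (m + 1) n}
    (hf : f ∈ homogPoly (m + 1) n k') :
    laplacianLift m n t k' f ∈ homogPoly (m + 1) n (2 * t + 2 + k') ∧
    superLaplacian (m + 1) n (laplacianLift m n t k' f) = (superRSq (m + 1) n ^ t) f := by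
  have h1 := superInteg_mem_homogPoly (superInteg_mem_homogPoly (superRSq_pow_mem_homogPoly hf t))
  rw [show k' + 2 * t + 1 + 1 = 2 * t + 2 + k' by ring] at h1
  refine ⟨mem_homogPoly_iff.mpr (superEuler_neumannSum_apply (mem_homogPoly_iff.mp h1) _), ?_⟩
  refine (superLaplacian_neumannSum_apply h1).trans ?_
  rw [dX_last_superInteg, dX_last_superInteg]

/-- Here the choice of M matters: the scalar for R^{2t+2}f is a multiple of 2t + 2k' + M = 0, so R²Δ
of the lift is harmonic. -/
theorem laplacianLift_mem_genHarmonics {t k' : ℕ}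
    (hM : superdim (m + 1) n = -2 * ((t + k' : ℕ) : ℤ)) {f : SuperPoly (m + 1) n}
    (hf : f ∈ harmonics (m + 1) n k') :
    laplacianLift m n t k' f ∈ genHarmonics (m + 1) n (2 * t + 2 + k') := by
  obtain ⟨h1, h2⟩ := superLaplacian_laplacianLift (t := t) hf.2
  refine ⟨?_, h1⟩
  change superLaplacian (m + 1) n (superRSq (m + 1) n (superLaplacian (m + 1) n _)) = 0
  obtain ⟨h3, h4⟩ := mem_harmonics_iff.mp hf
  rw [h2, ← Module.End.mul_apply (superRSq (m + 1) n), ← pow_succ',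
    superLaplacian_superRSq_pow_apply h4, h3, map_zero, zero_add, hM]
  push_cast
  have : (2 * (t + 1) * (2 * t + 2 * k' + -2 * (t + k')) : ℝ) = 0 := by ring
  rw [this, zero_smul]

theorem harmonics_le_genHarmonics (k : ℕ) : harmonics m n k ≤ genHarmonics m n k := by
  rintro f ⟨h1, h2⟩
  refine ⟨?_, h2⟩
  change superLaplacian m n (superRSq m n (superLaplacian m n f)) = 0
  rw [LinearMap.mem_ker.mp h1, map_zero, map_zero]

/-- Δu has the form R^{2t}g, and subtracting the lift of g leaves a harmonic polynomial. -/
theorem exists_add_laplacianLift_eq {t k' : ℕ}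
    (hM : superdim (m + 1) n = -2 * ((t + k' : ℕ) : ℤ)) {u : SuperPoly (m + 1) n}
    (hu : u ∈ genHarmonics (m + 1) n (2 * t + 2 + k')) :
    ∃ f ∈ harmonics (m + 1) n (2 * t + 2 + k'), ∃ g ∈ harmonics (m + 1) n k',
      f + laplacianLift m n t k' g = u := by
  obtain ⟨hu1, hu2⟩ := hu
  have hL : superLaplacian (m + 1) n u ∈ homogPoly (m + 1) n (2 * t + k') := by
    rw [mem_homogPoly_iff, superEuler_superLaplacian_apply (mem_homogPoly_iff.mp hu2)]
    congr 1; push_cast; ring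
  obtain ⟨g, hg, hug⟩ := exists_eq_superRSq_pow hM hL hu1
  obtain ⟨h1, h2⟩ := superLaplacian_laplacianLift (t := t) hg.2
  refine ⟨u + (-1 : ℝ) • laplacianLift m n t k' g, ⟨?_, ?_⟩, g, hg, by module⟩
  · change superLaplacian (m + 1) n _ = 0
    rw [map_add, map_smul, h2, hug]
    module
  · exact Submodule.add_mem _ hu2 (Submodule.smul_mem _ _ h1)

end GeneralizedHarmonics

/-! ### The parity involution and the basic operators. -/

section Parity

variable {m n : ℕ}

theorem parityInvol_mulX (i : SuperIdx m n) :
    parityInvol m n * mulX m n i = superSign i i • (mulX m n i * parityInvol m n) := by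
  rcases i with i | i <;> (apply TensorProduct.ext'; intro f w)
  · simp [parityInvol, mulX, superSign]
  · simp [parityInvol, mulX, superSign, ExteriorAlgebra.ι, TensorProduct.tmul_neg]

theorem involute_contractLeft {V : Type*} [AddCommGroup V] [Module ℝ V] {Q : QuadraticForm ℝ V}
    (d : Module.Dual ℝ V) (w : CliffordAlgebra Q) :
    CliffordAlgebra.involute (CliffordAlgebra.contractLeft d w) =
      -CliffordAlgebra.contractLeft d (CliffordAlgebra.involute w) := by
  induction w using CliffordAlgebra.left_induction with
  | algebraMap r => simp
  | add x y hx hy => simp only [map_add, hx, hy, neg_add]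
  | ι_mul x v hx =>
    simp only [map_mul, CliffordAlgebra.contractLeft_ι_mul, CliffordAlgebra.involute_ι, map_sub,
      map_smul, hx, neg_mul, map_neg]
    simp

theorem parityInvol_dX (i : SuperIdx m n) :
    parityInvol m n * dX m n i = superSign i i • (dX m n i * parityInvol m n) := by
  rcases i with i | i <;> (apply TensorProduct.ext'; intro f w)
  · simp [parityInvol, dX, superSign]
  · simp only [parityInvol, dX, superSign, Module.End.mul_apply, LinearMap.lTensor_tmul,
      AlgHom.toLinearMap_apply, LinearMap.smul_apply, involute_contractLeft,
      TensorProduct.tmul_neg, neg_one_smul]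

theorem superMetric_mul_sign_sign (i j : SuperIdx m n) :
    superMetric m n i j * superSign i i * superSign j j = superMetric m n i j := by
  have h1 := superMetric_mul_sign i j j
  have h2 := superMetric_mul_sign i j i
  have h3 := superSign_mul_self i i
  rw [superSign_comm j i] at h2
  linear_combination superSign i i * h1 + superSign i i * h2 + superMetric m n i j * h3

theorem superGram_mul_sign_sign (i j : SuperIdx m n) :
    superGram m n j i * superSign i i * superSign j j = superGram m n j i := by
  have h1 := superGram_mul_sign j i i
  have h2 := superGram_mul_sign j i j
  have h3 := superSign_mul_self j j
  rw [superSign_comm i j] at h2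
  linear_combination superSign j j * h1 + superSign j j * h2 + superGram m n j i * h3

theorem parityInvol_commute_superRSq : Commute (parityInvol m n) (superRSq m n) := by
  rw [superRSq_eq]
  refine Commute.sum_right _ _ _ fun i _ => Commute.sum_right _ _ _ fun j _ => ?_
  rw [Commute, SemiconjBy, mul_smul_comm, ← mul_assoc, parityInvol_mulX, smul_mul_assoc,
    mul_assoc, parityInvol_mulX, mul_smul_comm, smul_smul, smul_smul, smul_mul_assoc,
    superMetric_mul_sign_sign, mul_assoc]

theorem parityInvol_commute_superLaplacian : Commute (parityInvol m n) (superLaplacian m n) := by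
  rw [superLaplacian_eq]
  refine Commute.sum_right _ _ _ fun i _ => Commute.sum_right _ _ _ fun j _ => ?_
  rw [Commute, SemiconjBy, mul_smul_comm, ← mul_assoc, parityInvol_dX, smul_mul_assoc,
    mul_assoc, parityInvol_dX, mul_smul_comm, smul_smul, smul_smul, smul_mul_assoc,
    superGram_mul_sign_sign, mul_assoc]

theorem parityInvol_commute_superEuler : Commute (parityInvol m n) (superEuler m n) := by
  refine Commute.sum_right _ _ _ fun i _ => ?_
  rw [← Module.End.mul_eq_comp, Commute, SemiconjBy, ← mul_assoc, parityInvol_mulX,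
    smul_mul_assoc, mul_assoc, parityInvol_dX, mul_smul_comm, smul_smul, superSign_mul_self,
    one_smul, mul_assoc]

theorem parityInvol_mem_harmonics (ℓ : ℕ) {f : SuperPoly m n} (hf : f ∈ harmonics m n ℓ) :
    parityInvol m n f ∈ harmonics m n ℓ := by
  rw [mem_harmonics_iff] at hf ⊢
  have h1 := LinearMap.congr_fun (parityInvol_commute_superLaplacian (m := m) (n := n)).eq f
  have h2 := LinearMap.congr_fun (parityInvol_commute_superEuler (m := m) (n := n)).eq f
  simp only [Module.End.mul_apply, hf.1, hf.2, map_zero, map_smul] at h1 h2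
  exact ⟨h1.symm, h2.symm⟩

end Parity

/-! ### Operators compatible with the branching maps. -/

section Intertwining

variable {m n : ℕ}

/-- The compatibility of operators on `ℝ^{m|2n}` and on `ℝ^{m+1|2n}` which makes the embeddings of
harmonics intertwine them. -/
structure Intertwines (S : Module.End ℝ (SuperPoly m n))
    (T : Module.End ℝ (SuperPoly (m + 1) n)) : Prop where
  embed : ∀ f, T (superEmbed m n f) = superEmbed m n (S f)
  integ : Commute T (superInteg m n)
  trans : Commute T (transLaplacian m n)
  rsq : Commute S (superRSq m n)
  rsq_succ : Commute T (superRSq (m + 1) n)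

namespace Intertwines

variable {S : Module.End ℝ (SuperPoly m n)} {T : Module.End ℝ (SuperPoly (m + 1) n)}

theorem commute_neumannSum (h : Intertwines S T) (q : ℕ) : Commute T (neumannSum m n q) :=
  Commute.sum_right _ _ _ fun i _ =>
    ((((h.integ.mul_right h.integ).mul_right h.trans)).pow_right i).smul_right _

theorem harmonicExt (h : Intertwines S T) (q ℓ : ℕ) (f : SuperPoly m n) :
    T (harmonicExt m n q ℓ f) = _root_.harmonicExt m n q ℓ (S f) := by
  have h1 (g : SuperPoly (m + 1) n) : T (neumannSum m n q g) = neumannSum m n q (T g) :=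
    LinearMap.congr_fun (h.commute_neumannSum q).eq g
  have h2 (i : ℕ) (g : SuperPoly (m + 1) n) :
      T ((superInteg m n ^ i) g) = (superInteg m n ^ i) (T g) :=
    LinearMap.congr_fun (h.integ.pow_right i).eq g
  have h3 (i : ℕ) : S ((superRSq m n ^ i) f) = (superRSq m n ^ i) (S f) :=
    LinearMap.congr_fun (h.rsq.pow_right i).eq f
  simp only [_root_.harmonicExt, LinearMap.comp_apply, h1, h2, h.embed, h3]

theorem laplacianLift (h : Intertwines S T) (t k' : ℕ) (g : SuperPoly (m + 1) n) :
    T (laplacianLift m n t k' g) = _root_.laplacianLift m n t k' (T g) :=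
  LinearMap.congr_fun (((h.commute_neumannSum _).mul_right
    (h.integ.mul_right h.integ)).mul_right (h.rsq_succ.pow_right t)).eq g

end Intertwines

theorem intertwines_superAction (A : osp m n) :
    Intertwines (superAction m n A) (superAction (m + 1) n (ospInclusion m n A)) := by
  refine ⟨fun f => ?_, ?_, ?_, superAction_comm_superRSq A.2,
    superAction_comm_superRSq (ospInclusion m n A).2⟩
  · rw [superAction_ospInclusion]
    change _ = superEmbed m n ((∑ i, ∑ j, A.1 i j • (mulX m n i * dX m n j)) f)
    simp only [LinearMap.sum_apply, LinearMap.smul_apply, Module.End.mul_apply, dX_superEmbed,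
      mulX_superEmbed, map_sum, map_smul]
  · rw [superAction_ospInclusion]
    exact Commute.sum_left _ _ _ fun i _ => Commute.sum_left _ _ _ fun j _ =>
      ((mulX_superInteg i).mul_left (dX_commute_superInteg j)).smul_left _
  · have h1 : Commute (superAction (m + 1) n (ospInclusion m n A))
        (dX (m + 1) n (lastIdx m n)) := by
      rw [superAction_ospInclusion]
      exact Commute.sum_left _ _ _ fun i _ => Commute.sum_left _ _ _ fun j _ =>
        ((mulX_commute_dX_last i).mul_left (dX_commute_dX_last _)).smul_left _
    -- Commutation with Δ' is deduced from commutation with Δ and with ∂, since Δ' = Δ - ∂².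
    have h2 : transLaplacian m n = superLaplacian (m + 1) n +
        (-1 : ℝ) • (dX (m + 1) n (lastIdx m n) * dX (m + 1) n (lastIdx m n)) := by
      rw [superLaplacian_succ]; module
    rw [h2]
    exact (superAction_comm_superLaplacian (ospInclusion m n A).2).add_right
      ((h1.mul_right h1).smul_right _)

/-- With this, preservation of parity follows from the same argument as equivariance. -/
theorem intertwines_parityInvol : Intertwines (parityInvol m n) (parityInvol (m + 1) n) := by
  refine ⟨fun f => ?_, ?_, ?_, parityInvol_commute_superRSq, parityInvol_commute_superRSq⟩
  · induction f using TensorProduct.induction_on with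
    | zero => simp
    | add x y hx hy => simp only [map_add, hx, hy]
    | tmul p w => simp [parityInvol, superEmbed]
  · refine LinearMap.ext fun f => ?_
    simp only [Module.End.mul_apply]
    induction f using TensorProduct.induction_on with
    | zero => simp
    | add x y hx hy => simp only [map_add, hx, hy]
    | tmul p w => simp [parityInvol, superInteg]
  · have h1 : Commute (parityInvol (m + 1) n) (dX (m + 1) n (lastIdx m n)) := by
      have h := parityInvol_dX (lastIdx m n)
      rwa [superSign_lastIdx_left, one_smul] at h
    have h2 : transLaplacian m n = superLaplacian (m + 1) n +
        (-1 : ℝ) • (dX (m + 1) n (lastIdx m n) * dX (m + 1) n (lastIdx m n)) := by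
      rw [superLaplacian_succ]; module
    rw [h2]
    exact parityInvol_commute_superLaplacian.add_right ((h1.mul_right h1).smul_right _)

end Intertwining

/-! ### Nonzero harmonics from products of anticommuting variables. -/

section Nonvanishing

variable {m n : ℕ}

/-- The polynomial is the product of the θ_j with j in `s`. Carrying the vanishing of the other
derivatives through the induction gives ∂_a(θ_a f) = f, hence θ_a f ≠ 0. -/
theorem exists_homogPoly_ne_zero (s : Finset (Fin n × Fin 2)) :
    ∃ f ∈ homogPoly m n s.card, f ≠ 0 ∧ ∀ j ∉ s, dX m n (Sum.inr j) f = 0 := by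
  have h1 (a j : Fin n × Fin 2) (f : SuperPoly m n) (hf : dX m n (Sum.inr j) f = 0) :
      dX m n (Sum.inr j) (mulX m n (Sum.inr a) f) =
        (1 : Matrix (SuperIdx m n) (SuperIdx m n) ℝ) (Sum.inr j) (Sum.inr a) • f := by
    have h := LinearMap.congr_fun (dX_mulX m n (Sum.inr j) (Sum.inr a)) f
    simpa only [Module.End.mul_apply, LinearMap.add_apply, LinearMap.smul_apply, hf, map_zero,
      smul_zero, add_zero, Module.End.one_apply] using h
  induction s using Finset.induction_on with
  | empty =>
    refine ⟨superOne m n, ?_, fun h => ?_, fun j _ => dX_superOne _⟩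
    · rw [Finset.card_empty, homogPoly_zero]
      exact Submodule.mem_span_singleton_self _
    -- The augmentation (constant term in all variables) detects that 1 ≠ 0.
    · have h2 := congrArg (fun x => TensorProduct.lid ℝ ℝ (TensorProduct.map
        (MvPolynomial.aeval (0 : Fin m → ℝ)).toLinearMap
        (ExteriorAlgebra.algebraMapInv (R := ℝ) (M := Fin n × Fin 2 → ℝ)).toLinearMap x)) h
      simp [superOne] at h2
  | insert a s ha ih =>
    obtain ⟨f, hf, hne, hd⟩ := ih
    refine ⟨mulX m n (Sum.inr a) f, ?_, fun h => hne ?_, fun j hj => ?_⟩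
    · rw [Finset.card_insert_of_notMem ha]
      exact mulX_mem_homogPoly _ hf
    · have h2 := h1 a a f (hd a ha)
      rwa [h, map_zero, Matrix.one_apply_eq, one_smul, eq_comm] at h2
    · rw [Finset.mem_insert, not_or] at hj
      rw [h1 a j f (hd j hj.2), Matrix.one_apply_ne (by simpa using hj.1), zero_smul]

theorem harmonics_succ_ne_bot {q : ℕ} (hq : q ≤ 2 * n) : harmonics (m + 1) n q ≠ ⊥ := by
  obtain ⟨s, -, hs⟩ := Finset.exists_subset_card_eq (s := (Finset.univ : Finset (Fin n × Fin 2)))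
    (n := q) (by simpa [mul_comm] using hq)
  obtain ⟨f, hf, hne, -⟩ := exists_homogPoly_ne_zero (m := m) s
  rw [hs] at hf
  intro h
  have h1 := neumannSum_mem_harmonics (superEmbed_mem_homogPoly hf)
    (by rw [dX_last_superEmbed, map_zero])
  rw [h, Submodule.mem_bot] at h1
  have h2 := superRestr_neumannSum q (superEmbed m n f)
  rw [h1, map_zero, superRestr_superEmbed] at h2
  exact hne h2.symm

end Nonvanishing

/-! ### The assembled isomorphism. -/

section BranchingMap

variable {m n : ℕ}

open Classical in
theorem toModule_apply_eq_sum {I : Set ℕ} {β : I → Type*} [∀ ℓ, AddCommMonoid (β ℓ)]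
    [∀ ℓ, Module ℝ (β ℓ)] {N : Type*} [AddCommMonoid N] [Module ℝ N] (φ : ∀ ℓ, β ℓ →ₗ[ℝ] N)
    {q : ℕ} (hI : ∀ ℓ ∈ I, ℓ ≤ q) (x : ⨁ ℓ, β ℓ) :
    DirectSum.toModule ℝ I N φ x =
      ∑ ℓ ∈ Finset.range (q + 1), if h : ℓ ∈ I then φ ⟨ℓ, h⟩ (x ⟨ℓ, h⟩) else 0 := by
  induction x using DirectSum.induction_on with
  | zero => simp
  | of i y =>
    change DirectSum.toModule ℝ I N φ (DirectSum.lof ℝ I β i y) = _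
    rw [DirectSum.toModule_lof, Finset.sum_eq_single i.1]
    · rw [dif_pos i.2, DirectSum.of_eq_same]
    · intro ℓ _ hne
      split_ifs with h
      · rw [DirectSum.of_eq_of_ne, map_zero]
        exact fun h' => hne (congrArg Subtype.val h')
      · rfl
    · intro h
      exact absurd (Finset.mem_range.mpr (Nat.lt_succ_of_le (hI _ i.2))) h
  | add x y hx hy =>
    rw [map_add, hx, hy, ← Finset.sum_add_distrib]
    refine Finset.sum_congr rfl fun ℓ _ => ?_
    split_ifs
    · rw [DirectSum.add_apply, map_add]
    · rw [add_zero]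

variable (m n) in
/-- The map `⨁_{ℓ ∈ I} 2 ℋ_ℓ ⊕ ⨁_{ℓ ∈ J} ℋ_ℓ → 𝒫(ℝ^{m+1|2n})` which is given by the embeddings into
the harmonics of degree `k = 2t + 2 + k'` and, on the second copies, by those into the harmonics of
degree `k'`, followed by `laplacianLift`. -/
def branchingMap (t k' : ℕ) (I J : Set ℕ) : HarmonicSum m n I J →ₗ[ℝ] SuperPoly (m + 1) n :=
  LinearMap.coprod
    (DirectSum.toModule ℝ I _ fun ℓ => LinearMap.coprod
      (harmonicExt m n (2 * t + 2 + k') ℓ ∘ₗ (harmonics m n ℓ).subtype)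
      (laplacianLift m n t k' ∘ₗ harmonicExt m n k' ℓ ∘ₗ (harmonics m n ℓ).subtype))
    (DirectSum.toModule ℝ J _ fun ℓ =>
      harmonicExt m n (2 * t + 2 + k') ℓ ∘ₗ (harmonics m n ℓ).subtype)

/-- The componentwise action on `⨁_{ℓ ∈ I} 2 ℋ_ℓ ⊕ ⨁_{ℓ ∈ J} ℋ_ℓ` of an operator which preserves
the spaces of harmonics. -/
def harmonicSumMap (I J : Set ℕ) (S : Module.End ℝ (SuperPoly m n))
    (hS : ∀ ℓ, ∀ f ∈ harmonics m n ℓ, S f ∈ harmonics m n ℓ) :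
    Module.End ℝ (HarmonicSum m n I J) :=
  LinearMap.prodMap
    (DirectSum.lmap fun ℓ : I => LinearMap.prodMap (S.restrict (hS ℓ)) (S.restrict (hS ℓ)))
    (DirectSum.lmap fun ℓ : J => S.restrict (hS ℓ))

open Classical in
-- The index sets are disjoint with union {ℓ ≤ k}, so the first copies over `I` and the summands
-- over `J` combine to one family of components of ℋ_k; the second copies are the components of
-- ℋ_{k'}.
theorem branchingMap_apply {t k' : ℕ} {I J : Set ℕ} (hI : ∀ ℓ, ℓ ∈ I ↔ ℓ ≤ k')
    (hJ : ∀ ℓ, ℓ ∈ J ↔ k' < ℓ ∧ ℓ ≤ 2 * t + 2 + k') (x : HarmonicSum m n I J) :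
    branchingMap m n t k' I J x =
      (∑ ℓ ∈ Finset.range (2 * t + 2 + k' + 1), harmonicExt m n (2 * t + 2 + k') ℓ
        ((if h : ℓ ∈ I then ((x.1 ⟨ℓ, h⟩).1 : SuperPoly m n) else 0) +
          (if h : ℓ ∈ J then (x.2 ⟨ℓ, h⟩ : SuperPoly m n) else 0))) +
      laplacianLift m n t k' (∑ ℓ ∈ Finset.range (k' + 1), harmonicExt m n k' ℓ
        (if h : ℓ ∈ I then ((x.1 ⟨ℓ, h⟩).2 : SuperPoly m n) else 0)) := by
  have hIk : ∀ ℓ ∈ I, ℓ ≤ 2 * t + 2 + k' := fun ℓ h => ((hI ℓ).mp h).trans (by omega)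
  have hI' : ∀ ℓ ∈ I, ℓ ≤ k' := fun ℓ h => (hI ℓ).mp h
  have hJk : ∀ ℓ ∈ J, ℓ ≤ 2 * t + 2 + k' := fun ℓ h => ((hJ ℓ).mp h).2
  have h1 : DirectSum.toModule ℝ I _ (fun ℓ : I => LinearMap.coprod
      (harmonicExt m n (2 * t + 2 + k') ℓ ∘ₗ (harmonics m n ℓ).subtype)
      (laplacianLift m n t k' ∘ₗ harmonicExt m n k' ℓ ∘ₗ (harmonics m n ℓ).subtype)) =
      DirectSum.toModule ℝ I _ (fun ℓ : I => harmonicExt m n (2 * t + 2 + k') ℓ ∘ₗ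
        (harmonics m n ℓ).subtype ∘ₗ LinearMap.fst ℝ _ _) +
      laplacianLift m n t k' ∘ₗ DirectSum.toModule ℝ I _ (fun ℓ : I => harmonicExt m n k' ℓ ∘ₗ
        (harmonics m n ℓ).subtype ∘ₗ LinearMap.snd ℝ _ _) := by
    refine DirectSum.linearMap_ext _ fun ℓ => LinearMap.ext fun y => ?_
    simp [DirectSum.toModule_lof]
  rw [branchingMap, LinearMap.coprod_apply, h1, LinearMap.add_apply, LinearMap.comp_apply,
    toModule_apply_eq_sum _ hIk, toModule_apply_eq_sum _ hI', toModule_apply_eq_sum _ hJk,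
    add_right_comm, ← Finset.sum_add_distrib]
  congr 1
  · refine Finset.sum_congr rfl fun ℓ _ => ?_
    rw [map_add]
    congr 1 <;> split_ifs <;> simp
  · congr 1
    refine Finset.sum_congr rfl fun ℓ _ => ?_
    split_ifs <;> simp

theorem branchingMap_injective (hM : Odd (superdim m n)) {t k' : ℕ} {I J : Set ℕ}
    (hI : ∀ ℓ, ℓ ∈ I ↔ ℓ ≤ k') (hJ : ∀ ℓ, ℓ ∈ J ↔ k' < ℓ ∧ ℓ ≤ 2 * t + 2 + k') :
    Function.Injective (branchingMap m n t k' I J) := by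
  classical
  suffices hker : ∀ x, branchingMap m n t k' I J x = 0 → x = 0 by
    intro x y hxy
    have h := hker (x + (-1 : ℝ) • y) (by rw [map_add, map_smul, hxy]; module)
    have h' : x + (-1 : ℝ) • y + (1 : ℝ) • y = x := by
      rw [add_assoc, ← add_smul, neg_add_cancel, zero_smul, add_zero]
    rw [← h', h, zero_add, one_smul]
  intro x hx
  rw [branchingMap_apply hI hJ] at hx
  set h : ℕ → SuperPoly m n := fun ℓ =>
    (if h : ℓ ∈ I then ((x.1 ⟨ℓ, h⟩).1 : SuperPoly m n) else 0) +
      (if h : ℓ ∈ J then (x.2 ⟨ℓ, h⟩ : SuperPoly m n) else 0) with h_def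
  set b : ℕ → SuperPoly m n := fun ℓ =>
    (if h : ℓ ∈ I then ((x.1 ⟨ℓ, h⟩).2 : SuperPoly m n) else 0) with b_def
  have hh (ℓ : ℕ) : h ℓ ∈ harmonics m n ℓ := by
    refine Submodule.add_mem _ ?_ ?_ <;> split_ifs
    exacts [Subtype.property _, Submodule.zero_mem _, Subtype.property _, Submodule.zero_mem _]
  have hb (ℓ : ℕ) : b ℓ ∈ harmonics m n ℓ := by
    simp only [b_def]
    split_ifs
    exacts [Subtype.property _, Submodule.zero_mem _]
  have h1 : ∑ ℓ ∈ Finset.range (2 * t + 2 + k' + 1), harmonicExt m n (2 * t + 2 + k') ℓ (h ℓ) ∈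
      harmonics (m + 1) n (2 * t + 2 + k') := Submodule.sum_mem _ fun ℓ hℓ =>
    harmonicExt_mem_harmonics (Nat.lt_succ_iff.mp (Finset.mem_range.mp hℓ)) (hh ℓ)
  have h2 : ∑ ℓ ∈ Finset.range (k' + 1), harmonicExt m n k' ℓ (b ℓ) ∈
      harmonics (m + 1) n k' := Submodule.sum_mem _ fun ℓ hℓ =>
    harmonicExt_mem_harmonics (Nat.lt_succ_iff.mp (Finset.mem_range.mp hℓ)) (hb ℓ)
  -- Δ kills the ℋ_k part and turns the lift into R^{2t} of this sum; R² is injective.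
  have h3 : ∑ ℓ ∈ Finset.range (k' + 1), harmonicExt m n k' ℓ (b ℓ) = 0 := by
    refine eq_zero_of_superRSq_pow_apply_eq_zero h2.2 (i := t) ?_
    rw [← (superLaplacian_laplacianLift h2.2).2]
    have h4 := congrArg (superLaplacian (m + 1) n) hx
    rwa [map_add, (mem_harmonics_iff.mp h1).1, zero_add, map_zero] at h4
  rw [h3, map_zero, add_zero] at hx
  have hb0 (ℓ : ℕ) (hℓ : ℓ ≤ k') : b ℓ = 0 := eq_zero_of_sum_harmonicExt_eq_zero hM hb h3 hℓ
  have hh0 (ℓ : ℕ) (hℓ : ℓ ≤ 2 * t + 2 + k') : h ℓ = 0 :=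
    eq_zero_of_sum_harmonicExt_eq_zero hM hh hx hℓ
  refine Prod.ext (DFinsupp.ext fun ℓ => Prod.ext (Subtype.ext ?_) (Subtype.ext ?_))
    (DFinsupp.ext fun ℓ => Subtype.ext ?_)
  · have hℓ := (hI ℓ).mp ℓ.2
    have h5 := hh0 ℓ (by omega)
    have hJℓ : (ℓ : ℕ) ∉ J := fun h' => by have := (hJ ℓ).mp h'; omega
    simp only [h_def, dif_pos ℓ.2, dif_neg hJℓ, add_zero] at h5
    exact h5
  · have h5 := hb0 ℓ ((hI ℓ).mp ℓ.2)
    simp only [b_def, dif_pos ℓ.2] at h5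
    exact h5
  · have hℓ := (hJ ℓ).mp ℓ.2
    have h5 := hh0 ℓ hℓ.2
    have hIℓ : (ℓ : ℕ) ∉ I := fun h' => by have := (hI ℓ).mp h'; omega
    simp only [h_def, dif_pos ℓ.2, dif_neg hIℓ, zero_add] at h5
    exact h5

theorem range_branchingMap (hMo : Odd (superdim m n)) {t k' : ℕ}
    (hM : superdim (m + 1) n = -2 * ((t + k' : ℕ) : ℤ)) {I J : Set ℕ}
    (hI : ∀ ℓ, ℓ ∈ I ↔ ℓ ≤ k') (hJ : ∀ ℓ, ℓ ∈ J ↔ k' < ℓ ∧ ℓ ≤ 2 * t + 2 + k') :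
    LinearMap.range (branchingMap m n t k' I J) = genHarmonics (m + 1) n (2 * t + 2 + k') := by
  classical
  refine le_antisymm ?_ fun u hu => ?_
  · rintro _ ⟨x, rfl⟩
    rw [branchingMap_apply hI hJ]
    refine Submodule.add_mem _ (harmonics_le_genHarmonics _ (Submodule.sum_mem _ fun ℓ hℓ =>
        harmonicExt_mem_harmonics (Nat.lt_succ_iff.mp (Finset.mem_range.mp hℓ)) ?_))
      (laplacianLift_mem_genHarmonics hM (Submodule.sum_mem _ fun ℓ hℓ =>
        harmonicExt_mem_harmonics (Nat.lt_succ_iff.mp (Finset.mem_range.mp hℓ)) ?_))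
    · refine Submodule.add_mem _ ?_ ?_ <;> split_ifs
      exacts [Subtype.property _, Submodule.zero_mem _, Subtype.property _, Submodule.zero_mem _]
    · split_ifs
      exacts [Subtype.property _, Submodule.zero_mem _]
  · obtain ⟨f, hf, g, hg, rfl⟩ := exists_add_laplacianLift_eq hM hu
    obtain ⟨h, hh, rfl⟩ := exists_sum_harmonicExt_eq hMo hf
    obtain ⟨b, hb, rfl⟩ := exists_sum_harmonicExt_eq hMo hg
    rw [map_sum]
    refine Submodule.add_mem _ (Submodule.sum_mem _ fun ℓ hℓ => ?_)
      (Submodule.sum_mem _ fun ℓ hℓ => ?_)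
    · rw [Finset.mem_range, Nat.lt_succ_iff] at hℓ
      by_cases hℓk : ℓ ≤ k'
      · refine ⟨(DirectSum.lof ℝ I (fun ℓ : I => harmonics m n ℓ × harmonics m n ℓ)
          ⟨ℓ, (hI ℓ).mpr hℓk⟩ (⟨h ℓ, hh ℓ⟩, 0), 0), ?_⟩
        simp [branchingMap]
      · refine ⟨(0, DirectSum.lof ℝ J (fun ℓ : J => harmonics m n ℓ)
          ⟨ℓ, (hJ ℓ).mpr ⟨not_le.mp hℓk, hℓ⟩⟩ ⟨h ℓ, hh ℓ⟩), ?_⟩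
        simp [branchingMap]
    · rw [Finset.mem_range, Nat.lt_succ_iff] at hℓ
      refine ⟨(DirectSum.lof ℝ I (fun ℓ : I => harmonics m n ℓ × harmonics m n ℓ)
        ⟨ℓ, (hI ℓ).mpr hℓ⟩ (0, ⟨b ℓ, hb ℓ⟩), 0), ?_⟩
      simp [branchingMap]

theorem Intertwines.branchingMap {S : Module.End ℝ (SuperPoly m n)}
    {T : Module.End ℝ (SuperPoly (m + 1) n)} (h : Intertwines S T)
    (hS : ∀ ℓ, ∀ f ∈ harmonics m n ℓ, S f ∈ harmonics m n ℓ) (t k' : ℕ) (I J : Set ℕ)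
    (x : HarmonicSum m n I J) :
    T (branchingMap m n t k' I J x) =
      _root_.branchingMap m n t k' I J (harmonicSumMap I J S hS x) := by
  suffices h' : T ∘ₗ _root_.branchingMap m n t k' I J =
      _root_.branchingMap m n t k' I J ∘ₗ harmonicSumMap I J S hS from LinearMap.congr_fun h' x
  classical
  refine LinearMap.prod_ext (DirectSum.linearMap_ext _ fun ℓ => LinearMap.prod_ext ?_ ?_)
    (DirectSum.linearMap_ext _ fun ℓ => ?_) <;>
  · ext y
    simp [_root_.branchingMap, harmonicSumMap, h.harmonicExt, h.laplacianLift]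

theorem mem_parityPart_iff {p : ZMod 2} {f : SuperPoly m n} :
    f ∈ parityPart m n p ↔ parityInvol m n f = (-1 : ℝ) ^ p.val • f :=
  Module.End.mem_eigenspace_iff

/-- The injective map intertwines the parity involutions, so an image in the eigenspace of (-1)^p
comes from components in that eigenspace. -/
theorem mem_parityPart_of_branchingMap {t k' : ℕ} {I J : Set ℕ}
    (hinj : Function.Injective (branchingMap m n t k' I J)) {p : ZMod 2}
    {x : HarmonicSum m n I J} (hx : branchingMap m n t k' I J x ∈ parityPart (m + 1) n p) :
    (∀ ℓ, ((x.1 ℓ).1 : SuperPoly m n) ∈ parityPart m n p ∧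
      ((x.1 ℓ).2 : SuperPoly m n) ∈ parityPart m n p) ∧
    ∀ ℓ, (x.2 ℓ : SuperPoly m n) ∈ parityPart m n p := by
  have h := intertwines_parityInvol.branchingMap (fun ℓ _ => parityInvol_mem_harmonics ℓ) t k' I J x
  rw [mem_parityPart_iff.mp hx, ← map_smul] at h
  have h1 := (hinj h).symm
  have h2 (ℓ : I) := DFunLike.congr_fun (congrArg Prod.fst h1) ℓ
  have h3 (ℓ : J) := DFunLike.congr_fun (congrArg Prod.snd h1) ℓ
  simp only [harmonicSumMap, LinearMap.prodMap_apply, Prod.smul_fst, Prod.smul_snd] at h2 h3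
  simp only [mem_parityPart_iff]
  refine ⟨fun ℓ => ⟨?_, ?_⟩, fun ℓ => ?_⟩
  · exact congrArg (fun y => (y.1 : SuperPoly m n)) (h2 ℓ)
  · exact congrArg (fun y => (y.2 : SuperPoly m n)) (h2 ℓ)
  · exact congrArg Subtype.val (h3 ℓ)

theorem exists_genHarmonics_equiv (hMo : Odd (superdim m n)) {t k' : ℕ}
    (hM : superdim (m + 1) n = -2 * ((t + k' : ℕ) : ℤ)) {I J : Set ℕ}
    (hI : ∀ ℓ, ℓ ∈ I ↔ ℓ ≤ k') (hJ : ∀ ℓ, ℓ ∈ J ↔ k' < ℓ ∧ ℓ ≤ 2 * t + 2 + k') :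
    ∃ Φ : genHarmonics (m + 1) n (2 * t + 2 + k') ≃ₗ[ℝ] HarmonicSum m n I J,
      (∀ (A : osp m n) (u : genHarmonics (m + 1) n (2 * t + 2 + k')),
        Φ (genHarmonicRep (m + 1) n (2 * t + 2 + k') (ospInclusion m n A) u) =
          harmonicSumAction m n _ _ A (Φ u)) ∧
      (∀ (p : ZMod 2) (u : genHarmonics (m + 1) n (2 * t + 2 + k')),
        (u : SuperPoly (m + 1) n) ∈ parityPart (m + 1) n p →
          (∀ ℓ, (((Φ u).1 ℓ).1 : SuperPoly m n) ∈ parityPart m n p ∧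
            (((Φ u).1 ℓ).2 : SuperPoly m n) ∈ parityPart m n p) ∧
          (∀ ℓ, ((Φ u).2 ℓ : SuperPoly m n) ∈ parityPart m n p)) := by
  have hinj := branchingMap_injective hMo hI hJ
  obtain ⟨Ψ, hΨ⟩ : ∃ Ψ : HarmonicSum m n I J ≃ₗ[ℝ] genHarmonics (m + 1) n (2 * t + 2 + k'),
      ∀ x, (Ψ x : SuperPoly (m + 1) n) = branchingMap m n t k' I J x :=
    ⟨(LinearEquiv.ofInjective _ hinj).trans
      (LinearEquiv.ofEq _ _ (range_branchingMap hMo hM hI hJ)), fun _ => rfl⟩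
  have hcoe (u) : branchingMap m n t k' I J (Ψ.symm u) = u := by
    rw [← hΨ, LinearEquiv.apply_symm_apply]
  refine ⟨Ψ.symm, fun A u => hinj ?_, fun p u hu => ?_⟩
  · have h := (intertwines_superAction A).branchingMap (fun ℓ => superAction_mem_harmonics ℓ A)
      t k' I J (Ψ.symm u)
    rw [hcoe] at h
    rw [hcoe]
    exact h
  · refine mem_parityPart_of_branchingMap hinj ?_
    rw [hcoe]
    exact hu

end BranchingMap

/-! ### The theorem: numerical bookkeeping for M, k and n. -/

theorem theorem3 (m n k : ℕ)
    (hM : ∃ s : ℕ, superdim (m + 1) n = -2 * (s : ℤ))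
    (hk : k ∈ exceptionalIndices (superdim (m + 1) n)) :
    (∀ ℓ : ℕ, ℓ ≤ k → IsIrreducibleRep (harmonicRep m n ℓ)) ∧
    ∃ Φ : genHarmonics (m + 1) n k ≃ₗ[ℝ] HarmonicSum m n
        {ℓ : ℕ | (ℓ : ℤ) ≤ 2 - superdim (m + 1) n - (k : ℤ)}
        {ℓ : ℕ | 3 - superdim (m + 1) n - (k : ℤ) ≤ (ℓ : ℤ) ∧ ℓ ≤ k},
      (∀ (A : osp m n) (u : genHarmonics (m + 1) n k),
        Φ (genHarmonicRep (m + 1) n k (ospInclusion m n A) u) =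
          harmonicSumAction m n _ _ A (Φ u)) ∧
      (∀ (p : ZMod 2) (u : genHarmonics (m + 1) n k),
        (u : SuperPoly (m + 1) n) ∈ parityPart (m + 1) n p →
          (∀ ℓ, (((Φ u).1 ℓ).1 : SuperPoly m n) ∈ parityPart m n p ∧
            (((Φ u).1 ℓ).2 : SuperPoly m n) ∈ parityPart m n p) ∧
          (∀ ℓ, ((Φ u).2 ℓ : SuperPoly m n) ∈ parityPart m n p)) := by
  obtain ⟨s, hs⟩ := hM
  have hk1 : 2 + s ≤ k ∧ k ≤ 2 + 2 * s := by
    obtain ⟨h1, h2⟩ := hk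
    rw [hs] at h1 h2
    push_cast at h1 h2
    constructor
    · have : (2 + s : ℝ) ≤ k := by linarith
      exact_mod_cast this
    · have : (k : ℝ) ≤ 2 + 2 * s := by linarith
      exact_mod_cast this
  have hodd : Odd (superdim m n) := by
    refine ⟨-s - 1, ?_⟩
    rw [superdim] at hs ⊢
    push_cast at hs
    linarith
  -- m is odd, hence positive: a bosonic variable remains on the hyperplane, as the nonvanishing
  -- lemma requires.
  have hm : ∃ m', m = m' + 1 := by
    refine ⟨m - 1, ?_⟩
    obtain ⟨r, hr⟩ := hodd
    rw [superdim] at hr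
    omega
  -- k ≤ 2 - M = 2n + 1 - m ≤ 2n.
  have hkn : k ≤ 2 * n := by
    obtain ⟨m', rfl⟩ := hm
    rw [superdim] at hs
    push_cast at hs
    omega
  refine ⟨fun ℓ hℓ => isIrreducibleRep_harmonicRep hodd ?_, ?_⟩
  · obtain ⟨m', rfl⟩ := hm
    exact harmonics_succ_ne_bot (hℓ.trans hkn)
  -- The two bounds on k say precisely that k - 2 - s and 2 + 2s - k = 2 - M - k are natural
  -- numbers.
  obtain ⟨t, k', rfl, rfl⟩ : ∃ t k', s = t + k' ∧ k = 2 * t + 2 + k' :=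
    ⟨k - 2 - s, 2 + 2 * s - k, by omega, by omega⟩
  have hI (ℓ : ℕ) : ℓ ∈ {ℓ : ℕ | (ℓ : ℤ) ≤ 2 - superdim (m + 1) n - ((2 * t + 2 + k' : ℕ) : ℤ)} ↔
      ℓ ≤ k' := by
    rw [Set.mem_ofPred_eq, hs]; push_cast; omega
  have hJ (ℓ : ℕ) : ℓ ∈ {ℓ : ℕ | 3 - superdim (m + 1) n - ((2 * t + 2 + k' : ℕ) : ℤ) ≤ (ℓ : ℤ) ∧
      ℓ ≤ 2 * t + 2 + k'} ↔ k' < ℓ ∧ ℓ ≤ 2 * t + 2 + k' := by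
    rw [Set.mem_ofPred_eq, hs]; push_cast; omega
  exact exists_genHarmonics_equiv hodd hs hI hJ

end
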